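/- Let $(E,\|\cdot\|)$ be a complex Banach space, $p,q\ge 1$ integers, $k>0$ real and $d\in\mathbb R$ a direction. *Conventions.* Write $\hat f=\sum a_{n,m}x_1^nx_2^m\in E[[x_1,x_2]]$ uniquely as $\hat f=\sum_{n\ge 0}f_n(x_1,x_2)(x_1^px_2^q)^n$ with $f_n=\sum_{m<p\text{ or }j<q}a_{np+m,nq+j}x_1^mx_2^j$. The series $\hat f$ is *$\sigma$-Gevrey in the monomial $x_1^px_2^q$* if for some $r>0$ all $f_n$ converge on $D_r^2=\{|x_1|,|x_2|<r\}$ and $\sup_{D_r^2}\|f_n\|\le CA^n\,n!^{\sigma}$ for some $C,A>0$ and all $n$. A monomial sector is $\Pi_{p,q}(a,b,r)=\{0<|x_1|^p,|x_2|^q<r,\ a<\arg(x_1^px_2^q)<b\}$; it is taken over the Riemann surface of $\log(x_1^px_2^q)$, so its points are $(x_1,x_2)\in(\mathbb C\setminus\{0\})^2$ together with a value of $\arg (x_1^px_2^q)$, and the opening $b-a$ may exceed $2\pi$. Put $\Pi_{p,q}(a,b)=\Pi_{p,q}(a,b,\infty)$ and $S_{p,q}(d,2\epsilon)=\Pi_{p,q}(d-\epsilon,d+\epsilon)$.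 *Summability in a monomial.* A holomorphic $f:\Pi_{p,q}(a,b,r)\to E$ is a *$k$-sum of $\hat f$ in $x_1^px_2^q$ in direction $d$* if $(a+b)/2=d$, $b-a>\pi/k$, and for some $0<r'\le r$ all $f_n$ are bounded and holomorphic on $\{|x_1|^p,|x_2|^q<r'\}$ and for all $a<a'<b'<b$, $0<\rho<r'$ there are $C,A>0$ with $$\Big\|f(x_1,x_2)-\sum_{n=0}^{N-1}f_n(x_1,x_2)(x_1^px_2^q)^n\Big\|\le CA^N N!^{1/k}|x_1^px_2^q|^N\quad\text{on }\Pi_{p,q}(a',b',\rho),\ N\in\mathbb N.$$ The series $\hat f$ is *$k$-summable in $x_1^px_2^q$ in direction $d$* if it has such a sum for some $a,b$ and some $r>0$. *Borel summability.* Let $0<s<1$ and $R_s(\xi_1,\xi_2)=|\xi_1|^{pk/s}+|\xi_2|^{qk/(1-s)}$. The series $\hat f$ is *$k$-$(s,1-s)$-Borel summable in $x_1^px_2^q$ in direction $d$* if for some $\epsilon>0$ there is a holomorphic $\varphi_s:S_{p,q}(d,2\epsilon)\to E$ that coincides near the origin with the sum of $$\hat\varphi_s=\sum_{n,m}\frac{a_{n,m}}{\Gamma\left(1+\frac{ns}{pk}+\frac{m(1-s)}{qk}\right)}\xi_1^n\xi_2^m$$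 and is of exponential growth of order at most $\left(\frac{pk}{s},\frac{qk}{1-s}\right)$, i.e. for all $d-\epsilon<a'<b'<d+\epsilon$ there are $C,M>0$ with $\|\varphi_s\|\le Ce^{MR_s}$ on $\Pi_{p,q}(a',b')$. Its *Borel sum* is $$\frac{1}{x_1^{pk}x_2^{qk}}\mathcal L_\theta(\varphi_s)(x_1,x_2)=\int_0^{e^{i\theta}\infty}\varphi_s\big(x_1u^{\frac{s}{pk}},x_2u^{\frac{1-s}{qk}}\big)e^{-u}\,du,\qquad |\theta|<\tfrac{\pi}{2},$$ taken at the points with $a'<\arg(x_1^px_2^q)+\theta/k<b'$ and $M R_s(x_1,x_2)<\cos\theta$, for $a',b',M$ as above. **Theorem.** Let $\hat f\in E[[x_1,x_2]]$ be a $1/k$-Gevrey series in the monomial $x_1^px_2^q$. The following are equivalent: 1. $\hat f$ is $k$-summable in $x_1^px_2^q$ in direction $d$. 2. There is $0<s<1$ such that $\hat f$ is $k$-$(s,1-s)$-Borel summable in the monomial $x_1^px_2^q$ in direction $d$. 3. For all $0<s<1$, $\hat f$ is $k$-$(s,1-s)$-Borel summable in the monomial $x_1^px_2^q$ in direction $d$.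 In all cases the corresponding sums coincide: the Laplace integrals above converge absolutely; at every point where they are taken, their values do not depend on $\theta$, on the continuation $\varphi_s$ or on $s$; they agree with every $k$-sum of $\hat f$ in direction $d$ at the common points; and for every $s$ and every continuation $\varphi_s$ the Borel sum is, on a suitable monomial sector bisected by $d$ and of opening larger than $\pi/k$, a $k$-sum of $\hat f$ in direction $d$. -/

import Mathlib

namespace MonomialSummability

noncomputable section

/-! ### Formal power series and their decomposition along the monomial

A formal power series `∑ a_{n,m} x₁ⁿ x₂ᵐ` in `E[[x₁,x₂]]` is given by its coefficients
`a : ℕ × ℕ → E`. -/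

variable {E : Type*} [NormedAddCommGroup E] [NormedSpace ℂ E]

/-- The terms of the power series
`f_n(x₁,x₂) = ∑_{m < p or j < q} a_{np+m,nq+j} x₁ᵐ x₂ʲ`, where
`∑ a_{n,m} x₁ⁿ x₂ᵐ = ∑ f_n(x₁,x₂) (x₁ᵖ x₂^q)ⁿ`. -/
def coeffTerm (p q : ℕ) (a : ℕ × ℕ → E) (n : ℕ) (x₁ x₂ : ℂ) (i : ℕ × ℕ) : E :=
  if i.1 < p ∨ i.2 < q then (x₁ ^ i.1 * x₂ ^ i.2) • a (n * p + i.1, n * q + i.2) else 0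

/-- The sum `f_n(x₁,x₂)`. -/
def coeffFun (p q : ℕ) (a : ℕ × ℕ → E) (n : ℕ) (x₁ x₂ : ℂ) : E :=
  ∑' i : ℕ × ℕ, coeffTerm p q a n x₁ x₂ i

/-- `∑ a_{n,m} x₁ⁿ x₂ᵐ` is `σ`-Gevrey in the monomial `x₁ᵖ x₂^q`: on a common polydisc `D_r²` all
the series `f_n` converge (hence are holomorphic there) and `sup ‖f_n‖ ≤ C Aⁿ (n!)^σ`. -/
def IsMonomialGevrey (p q : ℕ) (σ : ℝ) (a : ℕ × ℕ → E) : Prop :=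
  ∃ r C A : ℝ, 0 < r ∧ 0 < C ∧ 0 < A ∧ ∀ (n : ℕ) (x₁ x₂ : ℂ), ‖x₁‖ < r → ‖x₂‖ < r →
    Summable (coeffTerm p q a n x₁ x₂) ∧
      ‖coeffFun p q a n x₁ x₂‖ ≤ C * A ^ n * (n.factorial : ℝ) ^ σ

/-! ### Monomial sectors

The opening of a sector may exceed `2π`, so sectors consist of points `y = (x₁, x₂, ω)` where
`ω ∈ ℝ` is a value of the argument of `x₁ᵖ x₂^q` (i.e. they lie over the Riemann surface of the
logarithm of the monomial). If the opening is at most `2π`, then `ω` is determined by `(x₁, x₂)`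
and the sector is a subset of `ℂ²`. -/

/-- `(x₁, x₂, ω)` with `x₁, x₂ ≠ 0` and `ω` an argument of `x₁ᵖ x₂^q`. -/
def surface (p q : ℕ) : Set (ℂ × ℂ × ℝ) :=
  {y | y.1 ≠ 0 ∧ y.2.1 ≠ 0 ∧
    y.1 ^ p * y.2.1 ^ q = (‖y.1 ^ p * y.2.1 ^ q‖ : ℂ) * Complex.exp (y.2.2 * Complex.I)}

/-- The unbounded sector `Π_{p,q}(α,β)`. -/
def sector (p q : ℕ) (α β : ℝ) : Set (ℂ × ℂ × ℝ) :=
  {y | y ∈ surface p q ∧ α < y.2.2 ∧ y.2.2 < β}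

/-- The sector `Π_{p,q}(α,β,r)` of radius `r`. -/
def boundedSector (p q : ℕ) (α β r : ℝ) : Set (ℂ × ℂ × ℝ) :=
  {y | y ∈ sector p q α β ∧ ‖y.1‖ ^ p < r ∧ ‖y.2.1‖ ^ q < r}

/-- The branch of the argument with values in `(ω - π, ω + π]`. -/
def branchArg (ω : ℝ) (t : ℂ) : ℝ :=
  ω + Complex.arg (t * Complex.exp (-(ω * Complex.I)))

/-- Holomorphy on an open part `S` of the surface: near each point `(x₁, x₂, ω)` of `S`, the
function is holomorphic in the local coordinates `(x₁, x₂)`, the argument of the monomial being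
continued by the branch that has the value `ω` at this point. -/
def IsHolomorphicOn (p q : ℕ) (f : ℂ × ℂ × ℝ → E) (S : Set (ℂ × ℂ × ℝ)) : Prop :=
  ∀ y ∈ S, DifferentiableAt ℂ
    (fun z : ℂ × ℂ => f (z.1, z.2, branchArg y.2.2 (z.1 ^ p * z.2 ^ q))) (y.1, y.2.1)

/-! ### Gevrey asymptotic expansions and summability in a monomial -/

/-- `f ∼_σ ∑ a_{n,m} x₁ⁿ x₂ᵐ` on `Π_{p,q}(α,β,r)`: asymptotic expansion of `σ`-Gevrey type in
the monomial `x₁ᵖ x₂^q`. -/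
def HasGevreyExpansion (p q : ℕ) (σ : ℝ) (a : ℕ × ℕ → E) (α β r : ℝ)
    (f : ℂ × ℂ × ℝ → E) : Prop :=
  ∃ r' : ℝ, 0 < r' ∧ r' ≤ r ∧
    (∀ n : ℕ, ∃ K : ℝ, ∀ x₁ x₂ : ℂ, ‖x₁‖ ^ p < r' → ‖x₂‖ ^ q < r' →
      Summable (coeffTerm p q a n x₁ x₂) ∧ ‖coeffFun p q a n x₁ x₂‖ ≤ K) ∧
    ∀ α' β' ρ : ℝ, α < α' → α' < β' → β' < β → 0 < ρ → ρ < r' →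
      ∃ C A : ℝ, 0 < C ∧ 0 < A ∧ ∀ N : ℕ, ∀ y ∈ boundedSector p q α' β' ρ,
        ‖f y - ∑ n ∈ Finset.range N, (y.1 ^ p * y.2.1 ^ q) ^ n • coeffFun p q a n y.1 y.2.1‖
          ≤ C * A ^ N * (N.factorial : ℝ) ^ σ * ‖y.1 ^ p * y.2.1 ^ q‖ ^ N

/-- `f` is a `k`-sum in `x₁ᵖ x₂^q` of the series in direction `d`, on the sector
`Π_{p,q}(α,β,r)` bisected by `d` and of opening larger than `π/k`. -/
def IsMonomialSum (p q : ℕ) (k : ℝ) (a : ℕ × ℕ → E) (d α β r : ℝ)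
    (f : ℂ × ℂ × ℝ → E) : Prop :=
  (α + β) / 2 = d ∧ Real.pi / k < β - α ∧ 0 < r ∧
    IsHolomorphicOn p q f (boundedSector p q α β r) ∧
    HasGevreyExpansion p q (1 / k) a α β r f

/-- The series is `k`-summable in `x₁ᵖ x₂^q` in direction `d`. -/
def IsMonomialSummable (p q : ℕ) (k : ℝ) (a : ℕ × ℕ → E) (d : ℝ) : Prop :=
  ∃ (α β r : ℝ) (f : ℂ × ℂ × ℝ → E), IsMonomialSum p q k a d α β r f

/-! ### Weighted monomial Borel and Laplace transforms -/

/-- Coefficients of the formal Borel transform, of weight `(s, 1-s)`, of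
`x₁^{pk} x₂^{qk} ∑ a_{n,m} x₁ⁿ x₂ᵐ`, where `x₁^{μ₁} x₂^{μ₂}` is sent to
`ξ₁^{μ₁-pk} ξ₂^{μ₂-qk} / Γ(μ₁ s/(pk) + μ₂ (1-s)/(qk))`. -/
def formalBorel (p q : ℕ) (k s : ℝ) (a : ℕ × ℕ → E) (i : ℕ × ℕ) : E :=
  ((Real.Gamma ((i.1 + p * k) * s / (p * k) + (i.2 + q * k) * (1 - s) / (q * k)))⁻¹ : ℂ) • a i

/-- `‖φ‖ ≤ C exp(M (|ξ₁|^{pk/s} + |ξ₂|^{qk/(1-s)}))` on `Π_{p,q}(α,β)`. -/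
def ExpBound (p q : ℕ) (k s : ℝ) (φ : ℂ × ℂ × ℝ → E) (α β C M : ℝ) : Prop :=
  ∀ y ∈ sector p q α β,
    ‖φ y‖ ≤ C * Real.exp (M * (‖y.1‖ ^ (p * k / s) + ‖y.2.1‖ ^ (q * k / (1 - s))))

/-- Exponential growth of order at most `(pk/s, qk/(1-s))` on `Π_{p,q}(α,β)`. -/
def HasExpGrowth (p q : ℕ) (k s : ℝ) (φ : ℂ × ℂ × ℝ → E) (α β : ℝ) : Prop :=
  ∀ α' β' : ℝ, α < α' → α' < β' → β' < β →
    ∃ C M : ℝ, 0 < C ∧ 0 < M ∧ ExpBound p q k s φ α' β' C M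

/-- `φ` is an analytic continuation of the formal Borel transform to the sector
`S_{p,q}(d, 2ε) = Π_{p,q}(d-ε, d+ε)`, of exponential growth of order at most
`(pk/s, qk/(1-s))` there. -/
def IsBorelContinuation (p q : ℕ) (k s : ℝ) (a : ℕ × ℕ → E) (d ε : ℝ)
    (φ : ℂ × ℂ × ℝ → E) : Prop :=
  0 < ε ∧ IsHolomorphicOn p q φ (sector p q (d - ε) (d + ε)) ∧
    (∃ r : ℝ, 0 < r ∧ ∀ y ∈ sector p q (d - ε) (d + ε), ‖y.1‖ < r → ‖y.2.1‖ < r →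
      HasSum (fun i : ℕ × ℕ => (y.1 ^ i.1 * y.2.1 ^ i.2) • formalBorel p q k s a i) (φ y)) ∧
    HasExpGrowth p q k s φ (d - ε) (d + ε)

/-- The series is `k-(s,1-s)`-Borel summable in the monomial `x₁ᵖ x₂^q` in direction `d`. -/
def IsBorelSummable (p q : ℕ) (k s : ℝ) (a : ℕ × ℕ → E) (d : ℝ) : Prop :=
  ∃ (ε : ℝ) (φ : ℂ × ℂ × ℝ → E), IsBorelContinuation p q k s a d ε φ

/-- The point `(x₁ u^{s/(pk)}, x₂ u^{(1-s)/(qk)})` for `u = ρ e^{iθ}`, `ρ > 0`; the argument of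
the monomial becomes `ω + θ/k`. -/
def dilate (p q : ℕ) (k s θ : ℝ) (y : ℂ × ℂ × ℝ) (ρ : ℝ) : ℂ × ℂ × ℝ :=
  (y.1 * Complex.exp ((s / (p * k) : ℝ) * (Real.log ρ + θ * Complex.I)),
   y.2.1 * Complex.exp (((1 - s) / (q * k) : ℝ) * (Real.log ρ + θ * Complex.I)),
   y.2.2 + θ / k)

/-- `x₁^{pk} x₂^{qk} = (x₁ᵖ x₂^q)ᵏ`, computed with the argument `ω` of `x₁ᵖ x₂^q`. -/
def monomialPow (p q : ℕ) (k : ℝ) (y : ℂ × ℂ × ℝ) : ℂ :=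
  Complex.exp (k * (Real.log ‖y.1 ^ p * y.2.1 ^ q‖ + y.2.2 * Complex.I))

/-- The integrand, for `u = ρ e^{iθ}`, of
`∫₀^{e^{iθ}∞} φ(x₁ u^{s/(pk)}, x₂ u^{(1-s)/(qk)}) e^{-u} du`. -/
def laplaceIntegrand (p q : ℕ) (k s θ : ℝ) (φ : ℂ × ℂ × ℝ → E) (y : ℂ × ℂ × ℝ) (ρ : ℝ) : E :=
  (Complex.exp (-(ρ * Complex.exp (θ * Complex.I))) * Complex.exp (θ * Complex.I)) •
    φ (dilate p q k s θ y ρ)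

/-- The `k`-Laplace transform with respect to `x₁ᵖ x₂^q` with weight `(s, 1-s)` in
direction `θ`. -/
def laplace (p q : ℕ) (k s θ : ℝ) (φ : ℂ × ℂ × ℝ → E) (y : ℂ × ℂ × ℝ) : E :=
  monomialPow p q k y • ∫ ρ in Set.Ioi (0 : ℝ), laplaceIntegrand p q k s θ φ y ρ

/-- Domain of the Laplace transform in direction `θ` of a function `φ` on `Π_{p,q}(α,β)`: the
points with `α' < ω + θ/k < β'` and `M (|x₁|^{pk/s} + |x₂|^{qk/(1-s)}) < cos θ`, where `M` is an
exponential growth constant of `φ` on a subsector `Π_{p,q}(α',β')`. -/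
def laplaceDomain (p q : ℕ) (k s θ : ℝ) (φ : ℂ × ℂ × ℝ → E) (α β : ℝ) : Set (ℂ × ℂ × ℝ) :=
  {y | y ∈ surface p q ∧ ∃ α' β' C M : ℝ, α < α' ∧ β' < β ∧
    α' < y.2.2 + θ / k ∧ y.2.2 + θ / k < β' ∧ 0 < C ∧ 0 < M ∧ ExpBound p q k s φ α' β' C M ∧
    M * (‖y.1‖ ^ (p * k / s) + ‖y.2.1‖ ^ (q * k / (1 - s))) < Real.cos θ}

/-- The value `x₁^{-pk} x₂^{-qk} 𝓛_θ(φ)(x₁,x₂)` of the `k-(s,1-s)`-Borel sum, computed with the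
Laplace transform in direction `θ`. -/
def borelSum (p q : ℕ) (k s θ : ℝ) (φ : ℂ × ℂ × ℝ → E) (y : ℂ × ℂ × ℝ) : E :=
  (monomialPow p q k y)⁻¹ • laplace p q k s θ φ y

end

end MonomialSummability

open MonomialSummability

namespace MonomialSummability
open MeasureTheory Set Filter Topology

variable {E : Type*} [NormedAddCommGroup E] [NormedSpace ℂ E]

/-! ### Holomorphic dependence of integrals on parameters -/

/-! The two-variable problem becomes a one-variable one along the orbits of the weighted dilation
`dil`, which sends (x₁, x₂) to (x₁ e^{sζ/(pk)}, x₂ e^{(1-s)ζ/(qk)}). It multiplies the monomial by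
e^{ζ/k} and the weight R_s by |e^ζ|, so that on each orbit the k-(s,1-s)-Borel sum is an ordinary
Laplace integral in u = e^ζ (`borelSum_eq_rayIntegral`), and the Borel transform of a function f is
a Hankel integral of f over v = e^τ (`borelTransform`). Holomorphy on the surface is holomorphy in
logarithmic coordinates (`differentiableAt_branch_iff`), where both integrals depend holomorphically
on their parameters.

From a k-sum to Borel summability, for any s: an opening larger than π/k leaves room for a Hankel
contour |Im τ| ≤ η with η > π/2. Starting the contour at e^R = 1 + c R_s keeps it in the domain of f
and gives the exponential growth (`norm_borelTransform_le`). Hankel's formula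
(`halfStripIntegral_exp_exp`) identifies the transform of each f_n (x₁ᵖ x₂^q)ⁿ with the
corresponding block of the formal Borel series. Contours with R = log N make the remainders vanish
near the origin (`hasSum_borelTransform`).

From a Borel continuation to a k-sum: by `exists_norm_borelTerm_le` the blocks of the formal Borel
series are defined everywhere and have exponential growth, and the Borel series converges wherever
the monomial is small. This yields a global estimate of the N-th remainder of φ, by C (A |x₁ᵖ
x₂^q|)^N e^{M R_s} (`IsBorelContinuation.norm_sub_blocks_le`). Its Laplace integral contributes Γ(1
+ N/k), which is N!^{1/k} up to geometric factors. Turning the direction θ over almost all of (-π/2,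
π/2) enlarges the sector of arguments beyond opening π/k
(`IsBorelContinuation.exists_isMonomialSum`).

Uniqueness is Watson's lemma on an orbit (`watson`, `IsMonomialSum.exists_eq`). It first identifies
the sums near the origin. Equality at every common point follows by analytic continuation along an
orbit that shrinks to the origin and then turns to an argument where Watson's lemma applies
(`eq_of_exists_eq_dil`). -/

theorem norm_fderiv_le_of_norm_le_ball {V : Type*} [NormedAddCommGroup V] [NormedSpace ℂ V]
    {f : V → E} {x : V} {r C : ℝ} (hr : 0 < r) (hd : DifferentiableOn ℂ f (Metric.ball x r))
    (hC : ∀ y ∈ Metric.ball x r, ‖f y‖ ≤ C) : ‖fderiv ℂ f x‖ ≤ 2 * C / r := by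
  have hC0 : 0 ≤ C := (norm_nonneg _).trans (hC x (Metric.mem_ball_self hr))
  refine ContinuousLinearMap.opNorm_le_bound _ (by positivity) fun v => ?_
  rcases eq_or_ne v 0 with rfl | hv
  · simp
  have hv' : 0 < ‖v‖ := norm_pos_iff.2 hv
  -- The complex disc of this radius in the direction v stays inside half of the ball. Cauchy's
  -- estimate on it gives C / R = (2C / r) ‖v‖.
  set R : ℝ := r / (2 * ‖v‖) with hR
  have hRpos : 0 < R := by positivity
  have hmem : ∀ l ∈ Metric.closedBall (0 : ℂ) R, x + l • v ∈ Metric.ball x r := by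
    intro l hl
    rw [mem_closedBall_zero_iff] at hl
    rw [Metric.mem_ball, dist_eq_norm, add_sub_cancel_left, norm_smul]
    calc ‖l‖ * ‖v‖ ≤ R * ‖v‖ := by gcongr
      _ = r / 2 := by rw [hR]; field_simp
      _ < r := by linarith
  have hline : DifferentiableOn ℂ (fun l : ℂ => f (x + l • v)) (Metric.closedBall 0 R) := by
    refine hd.comp (Differentiable.differentiableOn (by fun_prop)) ?_
    intro l hl
    exact hmem l hl
  have hdx : DifferentiableAt ℂ f x :=
    (hd x (Metric.mem_ball_self hr)).differentiableAt (Metric.ball_mem_nhds x hr)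
  have hder : deriv (fun l : ℂ => f (x + l • v)) 0 = fderiv ℂ f x v := by
    have h1 : HasDerivAt (fun l : ℂ => x + l • v) v 0 := by
      simpa using ((hasDerivAt_id (0 : ℂ)).smul_const v).const_add x
    have h2 : HasFDerivAt f (fderiv ℂ f x) (x + (0 : ℂ) • v) := by
      simpa using hdx.hasFDerivAt
    exact (h2.comp_hasDerivAt (0 : ℂ) h1).deriv
  have := Complex.norm_deriv_le_of_forall_mem_sphere_norm_le (f := fun l : ℂ => f (x + l • v))
    (c := 0) hRpos (hline.diffContOnCl_ball subset_rfl)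
    (fun z hz => hC _ (hmem z (Metric.sphere_subset_closedBall hz)))
  rw [hder] at this
  refine this.trans (le_of_eq ?_)
  rw [hR]; field_simp

/-- For holomorphic integrands a dominating function for the values is enough: Cauchy's estimate on
balls of half the radius turns it into a dominating function for the derivatives. -/
theorem differentiableAt_integral_of_norm_le [CompleteSpace E] {α : Type*} [MeasurableSpace α]
    {μ : Measure α}
    {F : ℂ × ℂ → α → E} {x₀ : ℂ × ℂ} {r : ℝ} {bound : α → ℝ} (hr : 0 < r)
    (hmeas : ∀ x ∈ Metric.ball x₀ r, AEStronglyMeasurable (F x) μ)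
    (hb : ∀ᵐ a ∂μ, ∀ x ∈ Metric.ball x₀ r, ‖F x a‖ ≤ bound a) (hint : Integrable bound μ)
    (hd : ∀ᵐ a ∂μ, DifferentiableOn ℂ (fun x => F x a) (Metric.ball x₀ r)) :
    DifferentiableAt ℂ (fun x => ∫ a, F x a ∂μ) x₀ := by
  have hx₀ : x₀ ∈ Metric.ball x₀ r := Metric.mem_ball_self hr
  have hsub : ∀ x ∈ Metric.ball x₀ (r / 2), Metric.ball x (r / 2) ⊆ Metric.ball x₀ r := by
    intro x hx
    apply Metric.ball_subset_ball'
    rw [Metric.mem_ball] at hx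
    linarith
  have hd₀ : ∀ᵐ a ∂μ, ∀ x ∈ Metric.ball x₀ (r / 2),
      HasFDerivAt (fun x => F x a) (fderiv ℂ (fun x => F x a) x) x := by
    filter_upwards [hd] with a ha x hx
    exact ((ha x (Metric.ball_subset_ball (by linarith) hx)).differentiableAt
      (Metric.isOpen_ball.mem_nhds (Metric.ball_subset_ball (by linarith) hx))).hasFDerivAt
  have hdir : ∀ v : ℂ × ℂ, AEStronglyMeasurable (fun a => fderiv ℂ (fun x => F x a) x₀ v) μ := by
    intro v
    -- The offset n₀ makes every increment v / (n + n₀ + 1) shorter than r, so all the difference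
    -- quotients use only values inside the ball.
    obtain ⟨n₀, hn₀⟩ := exists_nat_gt (‖v‖ / r)
    refine aestronglyMeasurable_of_tendsto_ae atTop
      (f := fun (n : ℕ) a => ((n + n₀ + 1 : ℕ) : ℂ) •
        (F (x₀ + ((n + n₀ + 1 : ℕ) : ℂ)⁻¹ • v) a - F x₀ a)) (fun n => ?_) ?_
    · refine AEStronglyMeasurable.const_smul ((hmeas _ ?_).sub (hmeas _ hx₀)) _
      rw [Metric.mem_ball, dist_eq_norm, add_sub_cancel_left, norm_smul, norm_inv,
        Complex.norm_natCast]
      rw [div_lt_iff₀ hr] at hn₀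
      have : (0 : ℝ) < (n + n₀ + 1 : ℕ) := by positivity
      rw [inv_mul_lt_iff₀ this]
      refine hn₀.trans_le ?_
      push_cast
      nlinarith [Nat.cast_nonneg (α := ℝ) n]
    · filter_upwards [hd₀] with a ha
      refine (ha x₀ (Metric.mem_ball_self (by linarith))).lim v ?_
      simp_rw [Complex.norm_natCast]
      exact tendsto_natCast_atTop_atTop.comp
        (tendsto_atTop_mono (fun n => by omega : ∀ n, n ≤ n + n₀ + 1) tendsto_id)
  have hF'meas : AEStronglyMeasurable (fun a => fderiv ℂ (fun x => F x a) x₀) μ := by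
    -- A linear map on ℂ × ℂ is assembled continuously from its two partial derivatives, and these
    -- are limits of measurable difference quotients.
    have heq : (fun a => fderiv ℂ (fun x => F x a) x₀) = fun a =>
        ContinuousLinearMap.smulRightL ℂ (ℂ × ℂ) E (ContinuousLinearMap.fst ℂ ℂ ℂ)
          (fderiv ℂ (fun x => F x a) x₀ (1, 0)) +
        ContinuousLinearMap.smulRightL ℂ (ℂ × ℂ) E (ContinuousLinearMap.snd ℂ ℂ ℂ)
          (fderiv ℂ (fun x => F x a) x₀ (0, 1)) := by
      funext a
      ext <;> simp
    rw [heq]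
    exact ((ContinuousLinearMap.continuous _).comp_aestronglyMeasurable (hdir (1, 0))).add
      ((ContinuousLinearMap.continuous _).comp_aestronglyMeasurable (hdir (0, 1)))
  refine (hasFDerivAt_integral_of_dominated_of_fderiv_le
    (F' := fun x a => fderiv ℂ (fun x => F x a) x)
    (bound := fun a => 2 * bound a / (r / 2))
    (Metric.ball_mem_nhds x₀ (half_pos hr)) ?_ ?_ hF'meas ?_ ?_ hd₀).differentiableAt
  · filter_upwards [Metric.ball_mem_nhds x₀ hr] with x hx using hmeas x hx
  · refine hint.mono' (hmeas _ hx₀) ?_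
    filter_upwards [hb] with a ha using ha _ hx₀
  · filter_upwards [hb, hd] with a ha hda x hx
    exact norm_fderiv_le_of_norm_le_ball (half_pos hr) (hda.mono (hsub x hx))
      fun y hy => ha y (hsub x hx hy)
  · exact (hint.const_mul 2).div_const _

/-! ### Cauchy estimates for coefficients -/

/-- Cauchy's inequality: the m-th Fourier coefficient of the sum on a circle of radius ρ < r is b m
times ρᵐ; then ρ tends to r. -/
theorem norm_coeff_le_of_norm_tsum_le [CompleteSpace E] {b : ℕ → E} {r K : ℝ} (hr : 0 < r)
    (h : ∀ x : ℂ, ‖x‖ < r → Summable (fun m => x ^ m • b m) ∧ ‖∑' m, x ^ m • b m‖ ≤ K) (m : ℕ) :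
    ‖b m‖ * r ^ m ≤ K := by
  have key : ∀ ρ : ℝ, 0 < ρ → ρ < r → ‖b m‖ * ρ ^ m ≤ K := by
    intro ρ hρ hρr
    -- Convergence at the larger radius ρ' bounds the terms there, and comparison with a geometric
    -- series then gives absolute convergence at ρ, as needed to integrate termwise.
    obtain ⟨ρ', hρ', hρ'r⟩ := exists_between hρr
    have hρ'0 : 0 < ρ' := hρ.trans hρ'
    obtain ⟨B, hB⟩ : ∃ B, ∀ n, ‖b n‖ * ρ' ^ n ≤ B := by
      have hs := (h (ρ' : ℂ) (by simpa [abs_of_pos hρ'0] using hρ'r)).1.tendsto_atTop_zero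
      obtain ⟨B, hB⟩ := hs.norm.bddAbove_range
      refine ⟨B, fun n => ?_⟩
      have := hB ⟨n, rfl⟩
      simpa [norm_smul, abs_of_pos hρ'0, mul_comm] using this
    have hsum : Summable fun n => ‖b n‖ * ρ ^ n := by
      have hg : Summable fun n : ℕ => B * (ρ / ρ') ^ n :=
        (summable_geometric_of_lt_one (by positivity) ((div_lt_one hρ'0).2 hρ')).mul_left B
      refine Summable.of_nonneg_of_le (fun n => by positivity) (fun n => ?_) hg
      calc ‖b n‖ * ρ ^ n = (‖b n‖ * ρ' ^ n) * (ρ / ρ') ^ n := by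
            rw [div_pow]; field_simp
        _ ≤ B * (ρ / ρ') ^ n := by gcongr; exact hB n
    set e : ℝ → ℂ := fun θ => Complex.exp (θ * Complex.I) with he
    have hen : ∀ θ, ‖e θ‖ = 1 := fun θ => Complex.norm_exp_ofReal_mul_I θ
    have hec : Continuous e := by fun_prop
    have hint := intervalIntegral.hasSum_integral_of_dominated_convergence (μ := volume)
      (a := 0) (b := 2 * Real.pi)
      (F := fun n θ => ((e θ) ^ m)⁻¹ • (((ρ : ℂ) * e θ) ^ n • b n))
      (f := fun θ => ((e θ) ^ m)⁻¹ • ∑' n, ((ρ : ℂ) * e θ) ^ n • b n)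
      (fun n _ => ‖b n‖ * ρ ^ n) ?_ ?_ ?_ ?_ ?_
    · have hterm : ∀ n, ∫ θ in (0 : ℝ)..(2 * Real.pi), ((e θ) ^ m)⁻¹ • (((ρ : ℂ) * e θ) ^ n • b n)
          = if n = m then ((2 * Real.pi * ρ ^ m : ℝ) : ℂ) • b m else 0 := by
        intro n
        have h1 : ∀ θ : ℝ, ((e θ) ^ m)⁻¹ • (((ρ : ℂ) * e θ) ^ n • b n) =
            (Complex.exp ((((n : ℂ) - m) * Complex.I) * θ)) • ((ρ : ℂ) ^ n • b n) := by
          intro θ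
          simp only [he, smul_smul, mul_pow, ← Complex.exp_nat_mul, ← Complex.exp_neg]
          rw [← mul_assoc, mul_right_comm, ← Complex.exp_add]
          congr 3
          ring
        simp_rw [h1]
        rw [intervalIntegral.integral_smul_const]
        split_ifs with hnm
        · subst hnm
          simp [smul_smul]
        · have hne : ((n : ℂ) - m) * Complex.I ≠ 0 :=
            mul_ne_zero (sub_ne_zero.2 (by exact_mod_cast hnm)) Complex.I_ne_zero
          rw [integral_exp_mul_complex hne]
          have : Complex.exp (((n : ℂ) - m) * Complex.I * ((2 * Real.pi : ℝ) : ℂ)) = 1 := by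
            rw [Complex.exp_eq_one_iff]
            exact ⟨(n : ℤ) - m, by push_cast; ring⟩
          rw [this]
          simp
      simp_rw [hterm] at hint
      have hval := hint.unique (hasSum_ite_eq m _)
      have hnorm : ‖∫ θ in (0 : ℝ)..(2 * Real.pi),
          ((e θ) ^ m)⁻¹ • ∑' n, ((ρ : ℂ) * e θ) ^ n • b n‖ ≤ K * |2 * Real.pi - 0| := by
        refine intervalIntegral.norm_integral_le_of_norm_le_const fun θ _ => ?_
        rw [norm_smul, norm_inv, norm_pow, hen, one_pow, inv_one, one_mul]
        exact (h _ (by simpa [hen, abs_of_pos hρ] using hρr)).2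
      rw [hval, norm_smul, Complex.norm_real, sub_zero, Real.norm_eq_abs,
        abs_of_pos (by positivity), abs_of_pos (by positivity)] at hnorm
      have h2 : (0 : ℝ) < 2 * Real.pi := by positivity
      nlinarith
    · intro n
      refine Continuous.aestronglyMeasurable ?_
      exact ((hec.pow m).inv₀ fun θ => pow_ne_zero _ (by simp [he])).smul
        (((continuous_const.mul hec).pow n).smul continuous_const)
    · intro n
      refine Eventually.of_forall fun θ _ => le_of_eq ?_
      simp [norm_smul, hen, abs_of_pos hρ, mul_comm]
    · exact Eventually.of_forall fun θ _ => hsum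
    · exact intervalIntegrable_const
    · refine Eventually.of_forall fun θ _ => ?_
      exact ((h ((ρ : ℂ) * e θ) (by simpa [hen, abs_of_pos hρ] using hρr)).1.hasSum).const_smul _
  have hlim : Tendsto (fun ρ : ℝ => ‖b m‖ * ρ ^ m) (𝓝[<] r) (𝓝 (‖b m‖ * r ^ m)) :=
    ((continuous_const.mul (continuous_pow m)).tendsto r).mono_left nhdsWithin_le_nhds
  refine le_of_tendsto hlim ?_
  filter_upwards [Ioo_mem_nhdsLT hr] with ρ hρ using key ρ hρ.1 hρ.2

end MonomialSummability

namespace MonomialSummability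
open MeasureTheory Set Filter Topology

variable {E : Type*} [NormedAddCommGroup E] [NormedSpace ℂ E]

/-! ### Estimates for the Gamma function -/

theorem setIntegral_Ioi_comp_add_right {F : Type*} [NormedAddCommGroup F] [NormedSpace ℝ F]
    (g : ℝ → F) (a c : ℝ) :
    ∫ x in Ioi a, g (x + c) = ∫ x in Ioi (a + c), g x := by
  have h := (measurePreserving_add_right (volume : Measure ℝ) c).setIntegral_preimage_emb
    (measurableEmbedding_addRight c) g (Ioi (a + c))
  rw [← h]
  congr 2
  simp

/-- Restrict the Gamma integral on the right to (Z, ∞), shift by Z, and use (x + Z)^{a+b} ≥ x^a Z^b.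
The inequality is what lets the extra exponents inside a block be absorbed by an exponential in R_s.
-/
theorem rpow_mul_exp_neg_mul_Gamma_le {a b Z : ℝ} (ha : 0 ≤ a) (hb : 0 ≤ b) (hZ : 0 ≤ Z) :
    Z ^ b * Real.exp (-Z) * Real.Gamma (1 + a) ≤ Real.Gamma (1 + a + b) := by
  have hia := Real.GammaIntegral_convergent (show 0 < 1 + a by positivity)
  have hiab := Real.GammaIntegral_convergent (show 0 < 1 + a + b by positivity)
  rw [Real.Gamma_eq_integral (by positivity), Real.Gamma_eq_integral (by positivity)]
  have h1 : ∫ x in Ioi (0 : ℝ), Real.exp (-(x + Z)) * (x + Z) ^ (1 + a + b - 1) ≤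
      ∫ x in Ioi (0 : ℝ), Real.exp (-x) * x ^ (1 + a + b - 1) := by
    rw [setIntegral_Ioi_comp_add_right (fun x : ℝ => Real.exp (-x) * x ^ (1 + a + b - 1)) 0 Z]
    refine setIntegral_mono_set hiab ?_ ?_
    · filter_upwards [ae_restrict_mem measurableSet_Ioi] with x (hx : 0 < x)
      simp only [Pi.zero_apply]
      positivity
    · exact (Ioi_subset_Ioi (by linarith)).eventuallyLE
  refine le_trans ?_ h1
  rw [← integral_const_mul]
  refine setIntegral_mono_on (hia.const_mul _) ?_ measurableSet_Ioi fun x (hx : 0 < x) => ?_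
  · have := (measurePreserving_add_right (volume : Measure ℝ) Z).integrableOn_comp_preimage
      (measurableEmbedding_addRight Z) (f := fun x : ℝ => Real.exp (-x) * x ^ (1 + a + b - 1))
      (s := Ioi Z)
    have h2 : (fun x : ℝ => x + Z) ⁻¹' Ioi Z = Ioi 0 := by ext; simp
    rw [h2] at this
    exact this.2 (hiab.mono_set (Ioi_subset_Ioi hZ))
  · rw [show 1 + a + b - 1 = b + a by ring, show 1 + a - 1 = a by ring,
      Real.rpow_add (by linarith), neg_add, Real.exp_add]
    calc Z ^ b * Real.exp (-Z) * (Real.exp (-x) * x ^ a)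
        = Real.exp (-x) * Real.exp (-Z) * (Z ^ b * x ^ a) := by ring
      _ ≤ Real.exp (-x) * Real.exp (-Z) * ((x + Z) ^ b * (x + Z) ^ a) := by
          gcongr <;> linarith

theorem rpow_le_exp_mul_Gamma {b Z : ℝ} (hb : 0 ≤ b) (hZ : 0 ≤ Z) :
    Z ^ b ≤ Real.exp Z * Real.Gamma (1 + b) := by
  have h := rpow_mul_exp_neg_mul_Gamma_le le_rfl hb hZ
  simp only [add_zero, Real.Gamma_one, mul_one] at h
  calc Z ^ b = Real.exp Z * (Z ^ b * Real.exp (-Z)) := by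
        rw [mul_left_comm, ← Real.exp_add]; simp
    _ ≤ _ := by gcongr

theorem factorial_rpow_le_Gamma {k : ℝ} (hk : 0 < k) (n : ℕ) :
    (n.factorial : ℝ) ^ (1 / k) ≤ ((Real.exp 1 * k) ^ (1 / k)) ^ n * Real.Gamma (1 + n / k) := by
  set Z : ℝ := n / k with hZ
  have hZ0 : 0 ≤ Z := by positivity
  have h1 : (n.factorial : ℝ) ^ (1 / k) ≤ ((n : ℝ) ^ n) ^ (1 / k) := by
    gcongr
    exact_mod_cast Nat.factorial_le_pow n
  have h2 : ((n : ℝ) ^ n) ^ (1 / k) = k ^ Z * Z ^ Z := by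
    rw [← Real.rpow_natCast, ← Real.rpow_mul (by positivity), ← Real.mul_rpow hk.le hZ0]
    congr 1
    · rw [hZ]; field_simp
    · rw [hZ]; ring
  have h3 : ((Real.exp 1 * k) ^ (1 / k)) ^ n = Real.exp Z * k ^ Z := by
    rw [← Real.rpow_natCast, ← Real.rpow_mul (by positivity),
      show 1 / k * (n : ℝ) = Z by rw [hZ]; ring, Real.mul_rpow (by positivity) hk.le,
      ← Real.exp_one_rpow Z]
  rw [h3]
  calc _ ≤ k ^ Z * Z ^ Z := h1.trans_eq h2
    _ ≤ k ^ Z * (Real.exp Z * Real.Gamma (1 + Z)) := by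
        gcongr
        exact rpow_le_exp_mul_Gamma hZ0 hZ0
    _ = _ := by ring

/-- Half of the decay pays for the power: x^b ≤ (2b)^b e^{x/2}, because x/(2b) ≤ e^{x/(2b)}. The
other half of the decay integrates to 2. -/
theorem Gamma_le_two_mul_rpow {b : ℝ} (hb : 0 ≤ b) : Real.Gamma (1 + b) ≤ 2 * (2 * b) ^ b := by
  rw [Real.Gamma_eq_integral (by positivity)]
  have hhalf : ∫ x in Ioi (0 : ℝ), Real.exp (-(1 / 2) * x) = 2 := by
    rw [integral_exp_mul_Ioi (by norm_num)]
    norm_num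
  have h2 : 2 * (2 * b) ^ b = ∫ x in Ioi (0 : ℝ), (2 * b) ^ b * Real.exp (-(1 / 2) * x) := by
    rw [integral_const_mul, hhalf, mul_comm]
  rw [h2]
  refine setIntegral_mono_on (Real.GammaIntegral_convergent (by positivity))
    ((integrableOn_exp_mul_Ioi (by norm_num) 0).const_mul _) measurableSet_Ioi
    fun x (hx : 0 < x) => ?_
  rw [show 1 + b - 1 = b by ring]
  have hx2 : x ^ b ≤ (2 * b) ^ b * Real.exp (x / 2) := by
    rcases hb.eq_or_lt with rfl | hb
    · simp only [Real.rpow_zero, one_mul]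
      exact Real.one_le_exp (by positivity)
    · have h3 : x / (2 * b) ≤ Real.exp (x / (2 * b)) := by
        linarith [Real.add_one_le_exp (x / (2 * b))]
      have h4 := Real.rpow_le_rpow (by positivity) h3 hb.le
      rw [← Real.exp_mul, Real.div_rpow hx.le (by positivity), div_le_iff₀ (by positivity)] at h4
      rwa [show x / (2 * b) * b = x / 2 by field_simp, mul_comm] at h4
  calc Real.exp (-x) * x ^ b ≤ Real.exp (-x) * ((2 * b) ^ b * Real.exp (x / 2)) := by gcongr
    _ = (2 * b) ^ b * (Real.exp (-x) * Real.exp (x / 2)) := by ring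
    _ = _ := by rw [← Real.exp_add]; congr 2; ring

theorem Gamma_le_factorial_rpow {k : ℝ} (hk : 0 < k) (n : ℕ) :
    Real.Gamma (1 + n / k) ≤
      2 * ((2 * Real.exp 1 / k) ^ (1 / k)) ^ n * (n.factorial : ℝ) ^ (1 / k) := by
  refine (Gamma_le_two_mul_rpow (by positivity)).trans ?_
  rw [mul_assoc]
  gcongr
  have h1 : ((2 * ((n : ℝ) / k)) ^ ((n : ℝ) / k)) = ((2 / k * n) ^ n) ^ (1 / k) := by
    rw [← Real.rpow_natCast, ← Real.rpow_mul (by positivity)]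
    congr 1 <;> ring
  have h2 : ((2 * Real.exp 1 / k) ^ (1 / k)) ^ n = ((2 / k * Real.exp 1) ^ n) ^ (1 / k) := by
    rw [← Real.rpow_natCast, ← Real.rpow_natCast, ← Real.rpow_mul (by positivity),
      ← Real.rpow_mul (by positivity)]
    congr 1 <;> ring
  rw [h1, h2, ← Real.mul_rpow (by positivity) (by positivity)]
  gcongr
  rw [mul_pow, mul_pow, mul_assoc]
  gcongr
  have := Real.pow_div_factorial_le_exp (n : ℝ) (by positivity) n
  rw [div_le_iff₀ (by positivity)] at this
  rwa [← Real.exp_nat_mul, mul_one]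

/-! ### Integrals over the boundary of a half strip -/

/-- The integral of `G` over the boundary of `{Re τ > R, |Im τ| < η}`, traversed clockwise,
that is from `∞ - iη` to `∞ + iη`. -/
noncomputable def halfStripIntegral (η R : ℝ) (G : ℂ → E) : E :=
  (∫ t in Ioi R, G (t + η * Complex.I)) - (∫ t in Ioi R, G (t + (-η : ℝ) * Complex.I)) +
    Complex.I • ∫ t in (-η)..η, G (R + t * Complex.I)

theorem halfStripIntegral_eq_of_le {η R R' : ℝ} (hη : 0 ≤ η) (hR : R ≤ R') {G : ℂ → E}
    (hG : DifferentiableOn ℂ G (Ici R ×ℂ Icc (-η) η))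
    (htop : IntegrableOn (fun t : ℝ => G (t + η * Complex.I)) (Ioi R))
    (hbot : IntegrableOn (fun t : ℝ => G (t + (-η : ℝ) * Complex.I)) (Ioi R)) :
    halfStripIntegral η R G = halfStripIntegral η R' G := by
  have h := Complex.integral_boundary_rect_eq_zero_of_differentiableOn G
    (R + (-η : ℝ) * Complex.I) (R' + η * Complex.I) (by
      simp only [Complex.add_re, Complex.ofReal_re, Complex.mul_re, Complex.I_re, mul_zero,
        Complex.ofReal_im, Complex.I_im, mul_one, sub_self, add_zero, Complex.add_im,
        Complex.mul_im, zero_add]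
      rw [uIcc_of_le hR, uIcc_of_le (by linarith)]
      refine hG.mono ?_
      exact inter_subset_inter (preimage_mono Icc_subset_Ici_self) subset_rfl)
  simp only [Complex.add_re, Complex.ofReal_re, Complex.mul_re, Complex.I_re, mul_zero,
        Complex.ofReal_im, Complex.I_im, mul_one, sub_self, add_zero, Complex.add_im,
        Complex.mul_im, zero_add] at h
  rw [← intervalIntegral.integral_Ioi_sub_Ioi htop hR,
    ← intervalIntegral.integral_Ioi_sub_Ioi hbot hR] at h
  unfold halfStripIntegral
  rw [← sub_eq_zero, ← neg_eq_zero]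
  refine Eq.trans ?_ h
  abel

/-- By Cauchy's theorem the left edge can be pushed to infinity, where the tails of the rays and the
short edge both vanish. -/
theorem halfStripIntegral_eq_zero {η R : ℝ} (hη : 0 ≤ η) {G : ℂ → E} {b : ℝ → ℝ}
    (hG : DifferentiableOn ℂ G (Ici R ×ℂ Icc (-η) η))
    (htop : IntegrableOn (fun t : ℝ => G (t + η * Complex.I)) (Ioi R))
    (hbot : IntegrableOn (fun t : ℝ => G (t + (-η : ℝ) * Complex.I)) (Ioi R))
    (hb : ∀ᶠ T : ℝ in atTop, ∀ t ∈ Icc (-η) η, ‖G (T + t * Complex.I)‖ ≤ b T)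
    (hlim : Tendsto b atTop (𝓝 0)) :
    halfStripIntegral η R G = 0 := by
  have h1 : Tendsto (fun T => halfStripIntegral η T G) atTop (𝓝 (0 - 0 + Complex.I • 0)) := by
    refine Tendsto.add (Tendsto.sub ?_ ?_) (Tendsto.const_smul ?_ _)
    · exact tendsto_integral_Ioi_zero tendsto_id
    · exact tendsto_integral_Ioi_zero tendsto_id
    · have h2 : Tendsto (fun T => b T * |η - -η|) atTop (𝓝 0) := by
        simpa using hlim.mul_const |η - -η|
      refine squeeze_zero_norm' ?_ h2
      filter_upwards [hb] with T hT
      refine intervalIntegral.norm_integral_le_of_norm_le_const fun t ht => hT t ?_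
      rw [uIoc_of_le (by linarith)] at ht
      exact Ioc_subset_Icc_self ht
  rw [sub_zero, smul_zero, add_zero] at h1
  refine tendsto_nhds_unique (tendsto_const_nhds.congr' ?_) h1
  filter_upwards [eventually_ge_atTop R] with T hT
  exact halfStripIntegral_eq_of_le hη hT hG htop hbot

end MonomialSummability

namespace MonomialSummability
open MeasureTheory Set Filter Topology

variable {E : Type*} [NormedAddCommGroup E] [NormedSpace ℂ E]

/-! ### Hankel's formula for the reciprocal Gamma function -/

/-- Fubini with ∫₀^∞ e^{(w-1)X} dX = 1/(1-w) for Re w < 1. It is stated for an arbitrary path γ, so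
that it serves the two rays and the left edge of the contour alike. -/
theorem integral_integral_exp_mul_path {μ : Measure ℝ} [SFinite μ] {γ : ℝ → ℂ}
    (hγ : Continuous γ) {a : ℝ} (hlt : ∀ᵐ t ∂μ, (Complex.exp (γ t)).re < 1)
    (hint : Integrable
      (fun t => ‖Complex.exp (-a * γ t)‖ * (1 - (Complex.exp (γ t)).re)⁻¹) μ) :
    IntegrableOn (fun X : ℝ => ∫ t, Complex.exp (-a * γ t) *
        Complex.exp ((Complex.exp (γ t) - 1) * X) ∂μ) (Ioi 0) ∧
      ∫ X in Ioi (0 : ℝ), ∫ t, Complex.exp (-a * γ t) *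
        Complex.exp ((Complex.exp (γ t) - 1) * X) ∂μ =
      ∫ t, Complex.exp (-a * γ t) * (1 - Complex.exp (γ t))⁻¹ ∂μ := by
  set f : ℝ → ℝ → ℂ := fun t X => Complex.exp (-a * γ t) *
        Complex.exp ((Complex.exp (γ t) - 1) * X) with hf
  have hcont : Continuous (Function.uncurry f) := by
    simp only [hf, Function.uncurry_def]
    fun_prop
  have hneg : ∀ᵐ t ∂μ, (Complex.exp (γ t) - 1).re < 0 := by
    filter_upwards [hlt] with t ht
    simpa using ht
  have hprod : Integrable (Function.uncurry f) (μ.prod (volume.restrict (Ioi (0 : ℝ)))) := by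
    rw [integrable_prod_iff hcont.aestronglyMeasurable]
    constructor
    · filter_upwards [hneg] with t ht
      exact Integrable.const_mul (integrableOn_exp_mul_complex_Ioi ht 0) (Complex.exp (-a * γ t))
    · refine hint.congr ?_
      filter_upwards [hneg] with t ht
      simp only [Function.uncurry, hf, norm_mul]
      rw [integral_const_mul]
      congr 1
      have : ∀ X : ℝ, ‖Complex.exp ((Complex.exp (γ t) - 1) * X)‖ =
          Real.exp (((Complex.exp (γ t)).re - 1) * X) := by
        intro X
        rw [Complex.norm_exp]
        simp
      simp_rw [this]
      rw [Complex.sub_re, Complex.one_re] at ht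
      rw [integral_exp_mul_Ioi ht, mul_zero, Real.exp_zero, neg_div, ← div_neg, neg_sub, one_div]
  refine ⟨hprod.integral_prod_right, ?_⟩
  rw [← integral_integral_swap hprod]
  refine integral_congr_ae ?_
  filter_upwards [hneg] with t ht
  simp only [hf]
  rw [integral_const_mul, integral_exp_mul_complex_Ioi ht]
  congr 1
  rw [Complex.ofReal_zero, mul_zero, Complex.exp_zero, neg_div, ← div_neg, neg_sub, one_div]

theorem integrableOn_exp_mul_exp {c : ℝ} (hc : c < 0) (R : ℝ) :
    IntegrableOn (fun t : ℝ => Real.exp (c * Real.exp t)) (Ioi R) := by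
  refine (integrableOn_exp_mul_Ioi hc R).mono' (by fun_prop) (Eventually.of_forall fun t => ?_)
  rw [Real.norm_eq_abs, Real.abs_exp, Real.exp_le_exp]
  nlinarith [Real.add_one_le_exp t]

theorem exp_add_mul_I_re (t η : ℝ) :
    (Complex.exp (t + η * Complex.I)).re = Real.exp t * Real.cos η := by
  rw [Complex.exp_re]; simp

theorem halfStripIntegral_comp_add (η R c : ℝ) (G : ℂ → E) :
    halfStripIntegral η R (fun τ => G (τ + c)) = halfStripIntegral η (R + c) G := by
  unfold halfStripIntegral
  rw [← setIntegral_Ioi_comp_add_right _ R c, ← setIntegral_Ioi_comp_add_right _ R c]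
  push_cast
  simp only [add_right_comm _ (c : ℂ)]

theorem halfStripIntegral_const_smul (η R : ℝ) (c : ℂ) (G : ℂ → E) :
    halfStripIntegral η R (fun τ => c • G τ) = c • halfStripIntegral η R G := by
  unfold halfStripIntegral
  rw [integral_smul, integral_smul, intervalIntegral.integral_smul, smul_add, smul_sub,
    smul_comm c]

theorem integrableOn_ray_inv_one_sub_exp {η : ℝ} (hη : Real.cos η < 0) {a : ℝ} (ha : 0 ≤ a)
    (R : ℝ) :
    IntegrableOn (fun t : ℝ => ‖Complex.exp (-a * (t + η * Complex.I))‖ *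
      (1 - (Complex.exp (t + η * Complex.I)).re)⁻¹) (Ioi R) := by
  have hpos : ∀ t : ℝ, 0 < 1 - Real.exp t * Real.cos η := fun t => by
    nlinarith [Real.exp_pos t]
  have hb : IntegrableOn (fun t : ℝ => (-Real.cos η)⁻¹ * Real.exp (-(a + 1) * t)) (Ioi R) :=
    (integrableOn_exp_mul_Ioi (by linarith) R).const_mul _
  refine hb.mono' (Continuous.aestronglyMeasurable ?_) (Eventually.of_forall fun t => ?_)
  · simp_rw [exp_add_mul_I_re]
    have : Continuous fun t : ℝ => (1 - Real.exp t * Real.cos η)⁻¹ :=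
      Continuous.inv₀ (by fun_prop) fun t => (hpos t).ne'
    exact Continuous.mul (by fun_prop) this
  · rw [exp_add_mul_I_re, norm_mul, norm_norm, Complex.norm_exp, Real.norm_eq_abs,
      abs_of_pos (inv_pos.2 (hpos t))]
    have h1 : (-a * (t + η * Complex.I) : ℂ).re = -a * t := by simp
    rw [h1, show -(a + 1) * t = -a * t + -t by ring, Real.exp_add, mul_left_comm]
    gcongr
    rw [Real.exp_neg, ← mul_inv]
    refine inv_anti₀ (mul_pos (by linarith) (Real.exp_pos t)) ?_
    nlinarith [Real.exp_pos t]

/-- Write 1 - e^τ = e^{τ - mi} (1 - e^{-τ}). The last factor has positive real part and tends to 1,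
and the bound on η - m keeps the sum of the arguments in the principal branch. The limit therefore
records which of ±π the ray belongs to. -/
theorem tendsto_sub_log_one_sub_exp {η m : ℝ} (hm : Complex.exp (m * Complex.I) = -1)
    (hη : |η - m| < Real.pi / 2) (hcos : Real.cos η < 0) :
    Tendsto (fun t : ℝ => (t + η * Complex.I) - Complex.log (1 - Complex.exp (t + η * Complex.I)))
      atTop (𝓝 (m * Complex.I)) := by
  have hexp0 : Tendsto (fun t : ℝ => Complex.exp (-(t + η * Complex.I))) atTop (𝓝 0) := by
    rw [tendsto_zero_iff_norm_tendsto_zero]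
    simp_rw [Complex.norm_exp]
    simpa using! Real.tendsto_exp_neg_atTop_nhds_zero
  have hlog : Tendsto (fun t : ℝ => Complex.log (1 - Complex.exp (-(t + η * Complex.I)))) atTop
      (𝓝 0) := by
    have h1 : Tendsto (fun t : ℝ => 1 - Complex.exp (-(t + η * Complex.I))) atTop (𝓝 1) := by
      simpa using hexp0.const_sub 1
    simpa using h1.clog (by simp)
  have heq : ∀ t : ℝ, (t + η * Complex.I) - Complex.log (1 - Complex.exp (t + η * Complex.I)) =
      m * Complex.I - Complex.log (1 - Complex.exp (-(t + η * Complex.I))) := by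
    intro t
    set w : ℂ := 1 - Complex.exp (-(t + η * Complex.I)) with hw
    have hwre : 0 < w.re := by
      rw [hw, Complex.sub_re, Complex.exp_re]
      simp only [Complex.one_re, Complex.neg_re, Complex.add_re, Complex.ofReal_re, Complex.mul_re,
        Complex.I_re, mul_zero, Complex.ofReal_im, Complex.I_im, mul_one, sub_self, add_zero,
        Complex.neg_im, Complex.add_im, Complex.mul_im, zero_add, Real.cos_neg]
      nlinarith [Real.exp_pos (-t)]
    have hw0 : w ≠ 0 := fun h => by simp [h] at hwre
    have harg : |w.arg| < Real.pi / 2 := Complex.abs_arg_lt_pi_div_two_iff.2 (Or.inl hwre)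
    have h1 : 1 - Complex.exp (t + η * Complex.I) =
        Complex.exp (t + η * Complex.I - m * Complex.I + Complex.log w) := by
      rw [Complex.exp_add _ (Complex.log w), Complex.exp_log hw0, Complex.exp_sub, hm, hw,
        Complex.exp_neg]
      have := Complex.exp_ne_zero (t + η * Complex.I)
      field_simp
      ring
    have h2 : (t + η * Complex.I - m * Complex.I + Complex.log w).im = η - m + w.arg := by
      simp [Complex.log_im]
    rw [abs_lt] at harg hη
    rw [h1, Complex.log_exp (by rw [h2]; linarith) (by rw [h2]; linarith)]
    ring
  simp_rw [heq]
  simpa using hlog.const_sub (m * Complex.I)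

theorem hasDerivAt_sub_log_one_sub_exp {τ : ℂ} (h : (Complex.exp τ).re < 1) :
    HasDerivAt (fun τ : ℂ => τ - Complex.log (1 - Complex.exp τ)) ((1 - Complex.exp τ)⁻¹) τ := by
  have hs : 1 - Complex.exp τ ∈ Complex.slitPlane := Or.inl (by simpa using h)
  have hne : 1 - Complex.exp τ ≠ 0 := Complex.slitPlane_ne_zero hs
  have := (hasDerivAt_id τ).sub (((Complex.hasDerivAt_exp τ).const_sub 1).clog hs)
  refine this.congr_deriv ?_
  field_simp
  ring

/-- Since Re e^τ < 1 on the whole contour, τ - log(1 - e^τ) is a primitive along it. Its boundary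
values at the corners cancel, leaving the difference of the limits πi and -πi at the two ends. -/
theorem halfStripIntegral_inv_one_sub_exp {η R : ℝ} (hη : Real.pi / 2 < η) (hη' : η < Real.pi)
    (hR : R < 0) :
    halfStripIntegral η R (fun τ => (1 - Complex.exp τ)⁻¹) = 2 * Real.pi * Complex.I := by
  have hcos : Real.cos η < 0 := Real.cos_neg_of_pi_div_two_lt_of_lt hη (by linarith)
  have hcos' : Real.cos (-η) < 0 := by rwa [Real.cos_neg]
  have hray : ∀ σ : ℝ, Real.cos σ < 0 → ∀ t : ℝ, (Complex.exp (t + σ * Complex.I)).re < 1 := by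
    intro σ hσ t
    rw [exp_add_mul_I_re]
    nlinarith [Real.exp_pos t]
  have hside : ∀ t : ℝ, (Complex.exp (R + t * Complex.I)).re < 1 := by
    intro t
    rw [exp_add_mul_I_re]
    nlinarith [Real.exp_pos R, Real.exp_lt_one_iff.2 hR, Real.cos_le_one t]
  have hJ : ∀ σ m : ℝ, Real.cos σ < 0 → Complex.exp (m * Complex.I) = -1 →
      |σ - m| < Real.pi / 2 → ∫ t in Ioi R, (1 - Complex.exp (t + σ * Complex.I))⁻¹ =
        m * Complex.I -
          ((R + σ * Complex.I) - Complex.log (1 - Complex.exp (R + σ * Complex.I))) := by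
    intro σ m hσ hm hσm
    have hd : ∀ t : ℝ, HasDerivAt
        (fun t : ℝ => (t + σ * Complex.I) - Complex.log (1 - Complex.exp (t + σ * Complex.I)))
        ((1 - Complex.exp (t + σ * Complex.I))⁻¹) t := by
      intro t
      have h1 : HasDerivAt (fun t : ℝ => (t + σ * Complex.I : ℂ)) 1 t :=
        Complex.ofRealCLM.hasDerivAt.add_const _
      simpa [Function.comp_def] using (hasDerivAt_sub_log_one_sub_exp (hray σ hσ t)).scomp t h1
    refine integral_Ioi_of_hasDerivAt_of_tendsto (hd R).continuousAt.continuousWithinAt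
      (fun t _ => hd t) ?_ (tendsto_sub_log_one_sub_exp hm hσm hσ)
    have h0 := integrableOn_ray_inv_one_sub_exp hσ le_rfl R
    refine h0.mono' (Continuous.aestronglyMeasurable (Continuous.inv₀ (by fun_prop) ?_)) ?_
    · intro t h
      have := hray σ hσ t
      rw [sub_eq_zero] at h
      simp [← h] at this
    · refine Eventually.of_forall fun t => ?_
      simp only [Complex.ofReal_zero, neg_zero, zero_mul, Complex.exp_zero, norm_one, one_mul,
        norm_inv]
      refine inv_anti₀ (by linarith [hray σ hσ t]) ?_
      have := Complex.re_le_norm (1 - Complex.exp (t + σ * Complex.I))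
      simpa using this
  have hleft : Complex.I • ∫ t in (-η)..η, (1 - Complex.exp (R + t * Complex.I))⁻¹ =
      ((R + η * Complex.I) - Complex.log (1 - Complex.exp (R + η * Complex.I))) -
      ((R + (-η : ℝ) * Complex.I) - Complex.log (1 - Complex.exp (R + (-η : ℝ) * Complex.I))) := by
    rw [← intervalIntegral.integral_smul]
    refine intervalIntegral.integral_eq_sub_of_hasDerivAt
      (f := fun t : ℝ => (R + t * Complex.I) - Complex.log (1 - Complex.exp (R + t * Complex.I)))
      (fun t _ => ?_) ?_
    · have h1 : HasDerivAt (fun t : ℝ => (R + t * Complex.I : ℂ)) Complex.I t := by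
        simpa using (Complex.ofRealCLM.hasDerivAt (x := t)).mul_const Complex.I |>.const_add (R : ℂ)
      simpa [Function.comp_def] using (hasDerivAt_sub_log_one_sub_exp (hside t)).scomp t h1
    · have hne : ∀ t : ℝ, 1 - Complex.exp (R + t * Complex.I) ≠ 0 := by
        intro t h
        have := hside t
        rw [sub_eq_zero] at h
        simp [← h] at this
      have hc : Continuous fun t : ℝ => (1 - Complex.exp (R + t * Complex.I))⁻¹ :=
        Continuous.inv₀ (by fun_prop) hne
      exact (hc.const_smul Complex.I).intervalIntegrable _ _
  unfold halfStripIntegral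
  rw [hJ η Real.pi hcos (by simp) (by rw [abs_lt]; constructor <;> linarith),
    hJ (-η) (-Real.pi) hcos' (by simp [Complex.exp_neg])
      (by rw [abs_lt]; constructor <;> linarith), hleft]
  push_cast
  ring

end MonomialSummability

/-! ### Hankel's formula for a general exponent. -/

namespace MonomialSummability
open MeasureTheory Set Filter Topology

variable {E : Type*} [NormedAddCommGroup E] [NormedSpace ℂ E]

theorem halfStripIntegral_congr {η R : ℝ} (hη : 0 ≤ η) {G H : ℂ → E}
    (h : ∀ τ ∈ Ici R ×ℂ Icc (-η) η, τ.re = R ∨ τ.im = η ∨ τ.im = -η → G τ = H τ) :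
    halfStripIntegral η R G = halfStripIntegral η R H := by
  unfold halfStripIntegral
  congr 1
  · congr 1 <;>
    · refine setIntegral_congr_fun measurableSet_Ioi fun t (ht : R < t) => ?_
      refine h _ ⟨?_, ?_⟩ ?_ <;> simp [ht.le, hη]
  · congr 1
    refine intervalIntegral.integral_congr fun t ht => ?_
    rw [uIcc_of_le (by linarith)] at ht
    refine h _ ⟨?_, ?_⟩ ?_ <;> simp [ht.1, ht.2]

/-- The difference from the case a = 0 is (e^{-aτ} - 1)/(1 - e^τ), whose singularity at 0 is
removable and which has no other pole in the strip because η < π. It decays as Re τ grows, so its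
contour integral is zero. -/
theorem halfStripIntegral_exp_mul_inv_one_sub_exp {η R : ℝ} (hη : Real.pi / 2 < η)
    (hη' : η < Real.pi) (hR : R < 0) {a : ℝ} (ha : 0 ≤ a) :
    halfStripIntegral η R (fun τ => Complex.exp (-a * τ) * (1 - Complex.exp τ)⁻¹) =
      2 * Real.pi * Complex.I := by
  have hπ := Real.pi_pos
  have hη0 : 0 ≤ η := by linarith
  have hcos : Real.cos η < 0 := Real.cos_neg_of_pi_div_two_lt_of_lt hη (by linarith)
  have hcos' : Real.cos (-η) < 0 := by rwa [Real.cos_neg]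
  set g : ℂ → ℂ := fun τ => Complex.exp (-a * τ) with hg
  -- The quotient of difference slopes is the holomorphic extension of (e^{-aτ} - 1)/(1 - e^τ)
  -- across 0.
  set D : ℂ → ℂ := fun τ => -(dslope g 0 τ * (dslope Complex.exp 0 τ)⁻¹) with hD
  have hdg : Differentiable ℂ (dslope g 0) := by
    rw [← differentiableOn_univ, Complex.differentiableOn_dslope univ_mem]
    exact Differentiable.differentiableOn (by fun_prop)
  have hde : Differentiable ℂ (dslope Complex.exp 0) := by
    rw [← differentiableOn_univ, Complex.differentiableOn_dslope univ_mem]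
    exact Differentiable.differentiableOn (by fun_prop)
  have hexp1 : ∀ τ : ℂ, τ ≠ 0 → τ.im ∈ Icc (-η) η → Complex.exp τ ≠ 1 := by
    intro τ hτ him h
    rw [Complex.exp_eq_one_iff] at h
    obtain ⟨n, hn⟩ := h
    have hn' : τ.im = n * (2 * Real.pi) := by rw [hn]; simp
    rw [hn'] at him
    have hn0 : n = 0 := by
      have h1 : (n : ℝ) < 1 := by nlinarith [him.2]
      have h2 : (-1 : ℝ) < n := by nlinarith [him.1]
      have h1' : n < 1 := by exact_mod_cast h1
      have h2' : -1 < n := by exact_mod_cast h2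
      omega
    rw [hn0] at hn
    exact hτ (by simpa using hn)
  have hne : ∀ τ : ℂ, τ.im ∈ Icc (-η) η → dslope Complex.exp 0 τ ≠ 0 := by
    intro τ him
    rcases eq_or_ne τ 0 with rfl | hτ
    · rw [dslope_same]
      simp
    · rw [dslope_of_ne _ hτ, slope_def_field]
      simp [hτ, sub_eq_zero, hexp1 τ hτ him]
  have hDval : ∀ τ : ℂ, τ ≠ 0 → τ.im ∈ Icc (-η) η →
      D τ = Complex.exp (-a * τ) * (1 - Complex.exp τ)⁻¹ - (1 - Complex.exp τ)⁻¹ := by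
    intro τ hτ him
    have h1 : Complex.exp τ - 1 ≠ 0 := sub_ne_zero.2 (hexp1 τ hτ him)
    have h2 : 1 - Complex.exp τ ≠ 0 := sub_ne_zero.2 (hexp1 τ hτ him).symm
    simp only [hD, hg]
    rw [dslope_of_ne _ hτ, dslope_of_ne _ hτ, slope_def_field, slope_def_field]
    simp only [mul_zero, Complex.exp_zero, sub_zero]
    field_simp
    ring
  have hrayInt : ∀ σ : ℝ, Real.cos σ < 0 → ∀ b : ℝ, 0 ≤ b → IntegrableOn
      (fun t : ℝ => Complex.exp (-b * (t + σ * Complex.I)) *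
        (1 - Complex.exp (t + σ * Complex.I))⁻¹) (Ioi R) := by
    intro σ hσ b hb
    have hpos : ∀ t : ℝ, 0 < (1 - Complex.exp (t + σ * Complex.I)).re := by
      intro t
      rw [Complex.sub_re, exp_add_mul_I_re, Complex.one_re]
      nlinarith [Real.exp_pos t]
    have hne : ∀ t : ℝ, 1 - Complex.exp (t + σ * Complex.I) ≠ 0 := by
      intro t h
      have := hpos t
      simp [h] at this
    have hc : Continuous fun t : ℝ => (1 - Complex.exp (t + σ * Complex.I))⁻¹ :=
      Continuous.inv₀ (by fun_prop) hne
    refine (integrableOn_ray_inv_one_sub_exp hσ hb R).mono'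
      (Continuous.aestronglyMeasurable (Continuous.mul (by fun_prop) hc))
      (Eventually.of_forall fun t => ?_)
    rw [norm_mul, norm_inv]
    gcongr
    · simpa using hpos t
    · simpa using Complex.re_le_norm (1 - Complex.exp (t + σ * Complex.I))
  have hDray : ∀ σ : ℝ, Real.cos σ < 0 → σ ∈ Icc (-η) η →
      IntegrableOn (fun t : ℝ => D (t + σ * Complex.I)) (Ioi R) := by
    intro σ hσ hσm
    have h1 := (hrayInt σ hσ a ha).sub (hrayInt σ hσ 0 le_rfl)
    refine h1.congr (Eventually.of_forall fun t => ?_)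
    have hne0 : (t + σ * Complex.I : ℂ) ≠ 0 := by
      intro h
      have := congrArg Complex.im h
      simp only [Complex.add_im, Complex.ofReal_im, Complex.mul_im, Complex.ofReal_re,
        Complex.I_im, mul_one, Complex.I_re, mul_zero, add_zero, zero_add, Complex.zero_im] at this
      rw [this, Real.cos_zero] at hσ
      linarith
    have hv := hDval _ hne0 (by simpa using hσm)
    simp only [Pi.sub_apply, hv]
    simp
  have hzero : halfStripIntegral η R D = 0 := by
    refine halfStripIntegral_eq_zero hη0 (b := fun T => 2 * (Real.exp T - 1)⁻¹) ?_
      (hDray η hcos ⟨by linarith, le_rfl⟩) (hDray (-η) hcos' ⟨le_rfl, by linarith⟩) ?_ ?_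
    · intro τ hτ
      exact ((hdg τ).mul ((hde τ).inv (hne τ hτ.2))).neg.differentiableWithinAt
    · filter_upwards [eventually_gt_atTop (0 : ℝ)] with T hT t ht
      have hne0 : (T + t * Complex.I : ℂ) ≠ 0 := by
        intro h
        have := congrArg Complex.re h
        simp at this
        linarith
      rw [hDval _ hne0 (by simpa using ht), ← sub_one_mul, norm_mul, norm_inv]
      have hT1 : 1 < Real.exp T := Real.one_lt_exp_iff.2 hT
      have h1 : ‖Complex.exp (-a * (T + t * Complex.I)) - 1‖ ≤ 2 := by
        refine (norm_sub_le _ _).trans ?_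
        rw [Complex.norm_exp, norm_one]
        have : (-a * (T + t * Complex.I) : ℂ).re = -(a * T) := by simp
        rw [this]
        have : Real.exp (-(a * T)) ≤ 1 := Real.exp_le_one_iff.2 (by nlinarith)
        linarith
      have h2 : Real.exp T - 1 ≤ ‖1 - Complex.exp (T + t * Complex.I)‖ := by
        have := norm_sub_norm_le (Complex.exp (T + t * Complex.I)) 1
        rw [Complex.norm_exp, norm_one, norm_sub_rev] at this
        simpa using this
      gcongr
    · have h1 : Tendsto (fun T : ℝ => (Real.exp T - 1)⁻¹) atTop (𝓝 0) :=
        (tendsto_atTop_add_const_right _ (-1) Real.tendsto_exp_atTop).inv_tendsto_atTop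
      simpa using h1.const_mul 2
  rw [← halfStripIntegral_inv_one_sub_exp hη hη' hR, ← sub_eq_zero, ← hzero]
  have hDc : halfStripIntegral η R D = halfStripIntegral η R (fun τ =>
      Complex.exp (-a * τ) * (1 - Complex.exp τ)⁻¹ - (1 - Complex.exp τ)⁻¹) := by
    refine halfStripIntegral_congr hη0 fun τ hτ hb => hDval τ ?_ hτ.2
    rintro rfl
    simp only [Complex.zero_re, Complex.zero_im] at hb
    rcases hb with hb | hb | hb <;> linarith
  rw [hDc]
  have hcside : ∀ b : ℝ, Continuous fun t : ℝ => Complex.exp (-b * (R + t * Complex.I)) *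
      (1 - Complex.exp (R + t * Complex.I))⁻¹ := by
    intro b
    have hne : ∀ t : ℝ, 1 - Complex.exp (R + t * Complex.I) ≠ 0 := by
      intro t h
      have h1 := congrArg Complex.re h
      rw [Complex.sub_re, exp_add_mul_I_re, Complex.one_re, Complex.zero_re] at h1
      nlinarith [Real.exp_pos R, Real.exp_lt_one_iff.2 hR, Real.cos_le_one t]
    have hc : Continuous fun t : ℝ => (1 - Complex.exp (R + t * Complex.I))⁻¹ :=
      Continuous.inv₀ (by fun_prop) hne
    exact Continuous.mul (by fun_prop) hc
  have hr0 : ∀ σ : ℝ, Real.cos σ < 0 →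
      IntegrableOn (fun t : ℝ => (1 - Complex.exp (t + σ * Complex.I))⁻¹) (Ioi R) := fun σ hσ => by
    simpa using hrayInt σ hσ 0 le_rfl
  have hc0 : Continuous fun t : ℝ => (1 - Complex.exp (R + t * Complex.I))⁻¹ := by
    simpa using hcside 0
  unfold halfStripIntegral
  rw [integral_sub (hrayInt η hcos a ha) (hr0 η hcos),
    integral_sub (hrayInt (-η) hcos' a ha) (hr0 (-η) hcos'),
    intervalIntegral.integral_sub ((hcside a).intervalIntegrable _ _) (hc0.intervalIntegrable _ _),
    smul_sub]
  abel

theorem norm_exp_exp_ray (t η : ℝ) :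
    ‖Complex.exp (Complex.exp (t + η * Complex.I))‖ = Real.exp (Real.cos η * Real.exp t) := by
  rw [Complex.norm_exp, exp_add_mul_I_re, mul_comm]

/-- Let h be the integral to be found. Rescaling v to vX gives a contour integral equal to e^{-X}
X^a h, and integrating over X > 0 gives Γ(1+a) h. Interchanging the integrations gives the integral
of e^{-aτ}/(1 - e^τ), which is 2πi. -/
theorem halfStripIntegral_exp_exp {η : ℝ} (hη : Real.pi / 2 < η)
    (hη' : η < Real.pi) (R : ℝ) {a : ℝ} (ha : 0 ≤ a) :
    halfStripIntegral η R (fun τ => Complex.exp (Complex.exp τ) * Complex.exp (-a * τ)) =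
      2 * Real.pi * Complex.I * ((Real.Gamma (1 + a))⁻¹ : ℂ) := by
  have hπ := Real.pi_pos
  have hη0 : 0 ≤ η := by linarith
  have hcos : Real.cos η < 0 := Real.cos_neg_of_pi_div_two_lt_of_lt hη (by linarith)
  have hcos' : Real.cos (-η) < 0 := by rwa [Real.cos_neg]
  set G : ℂ → ℂ := fun τ => Complex.exp (Complex.exp τ) * Complex.exp (-a * τ) with hG
  have hGd : Differentiable ℂ G := by
    simp only [hG]
    fun_prop
  have hray : ∀ σ : ℝ, Real.cos σ < 0 → ∀ R : ℝ,
      IntegrableOn (fun t : ℝ => G (t + σ * Complex.I)) (Ioi R) := by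
    intro σ hσ R
    refine ((integrableOn_exp_mul_exp hσ R).const_mul (Real.exp (-a * R))).mono'
      (Continuous.aestronglyMeasurable (by fun_prop)) ?_
    filter_upwards [ae_restrict_mem measurableSet_Ioi] with t (ht : R < t)
    simp only [hG]
    rw [norm_mul, norm_exp_exp_ray, mul_comm, Complex.norm_exp]
    have : (-a * (t + σ * Complex.I) : ℂ).re = -a * t := by simp
    rw [this]
    have : -a * t ≤ -a * R := by nlinarith
    gcongr
  -- The translation by log X below moves the left edge of the contour; independence of R moves it
  -- back.
  have hind : ∀ R R' : ℝ, halfStripIntegral η R G = halfStripIntegral η R' G := by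
    have key : ∀ R R' : ℝ, R ≤ R' → halfStripIntegral η R G = halfStripIntegral η R' G :=
      fun R R' h => halfStripIntegral_eq_of_le hη0 h hGd.differentiableOn
        (hray η hcos R) (hray (-η) hcos' R)
    intro R R'
    rcases le_total R R' with h | h
    · exact key R R' h
    · exact (key R' R h).symm
  set h := halfStripIntegral η R G with hh
  set P : ℝ → ℂ → ℂ := fun X τ => Complex.exp (-a * τ) * Complex.exp ((Complex.exp τ - 1) * X)
    with hP
  have hscale : ∀ X : ℝ, 0 < X →
      halfStripIntegral η (-1) (P X) = ((Real.exp (-X) * X ^ a : ℝ) : ℂ) * h := by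
    intro X hX
    have h1 : P X = fun τ => ((Real.exp (-X) * X ^ a : ℝ) : ℂ) • G (τ + Real.log X) := by
      funext τ
      simp only [hP, hG, smul_eq_mul]
      rw [Complex.exp_add τ, ← Complex.ofReal_exp (Real.log X), Real.exp_log hX,
        Real.rpow_def_of_pos hX]
      push_cast
      simp only [← Complex.exp_add]
      congr 1
      ring
    rw [h1, halfStripIntegral_const_smul, halfStripIntegral_comp_add η (-1) (Real.log X) G,
      hind _ R, smul_eq_mul]
  have hGam : ∫ X in Ioi (0 : ℝ), halfStripIntegral η (-1) (P X) =
      (Real.Gamma (1 + a) : ℂ) * h := by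
    rw [setIntegral_congr_fun measurableSet_Ioi (fun X hX => hscale X hX), integral_mul_const,
      integral_complex_ofReal, Real.Gamma_eq_integral (by positivity)]
    simp
  have htop := integral_integral_exp_mul_path (μ := volume.restrict (Ioi (-1 : ℝ)))
    (γ := fun t : ℝ => (t + η * Complex.I : ℂ)) (by fun_prop) (a := a)
    (Eventually.of_forall fun t => by
      rw [exp_add_mul_I_re]; nlinarith [Real.exp_pos t])
    (integrableOn_ray_inv_one_sub_exp hcos ha (-1))
  have hbot := integral_integral_exp_mul_path (μ := volume.restrict (Ioi (-1 : ℝ)))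
    (γ := fun t : ℝ => (t + (-η : ℝ) * Complex.I : ℂ)) (by fun_prop) (a := a)
    (Eventually.of_forall fun t => by
      rw [exp_add_mul_I_re]; nlinarith [Real.exp_pos t])
    (integrableOn_ray_inv_one_sub_exp hcos' ha (-1))
  have hlt1 : ∀ t : ℝ, (Complex.exp ((-1 : ℝ) + t * Complex.I)).re < 1 := by
    intro t
    rw [exp_add_mul_I_re]
    nlinarith [Real.exp_pos (-1), Real.exp_lt_one_iff.2 (show (-1 : ℝ) < 0 by norm_num),
      Real.cos_le_one t]
  have hside := integral_integral_exp_mul_path (μ := volume.restrict (Ioc (-η) η))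
    (γ := fun t : ℝ => ((-1 : ℝ) + t * Complex.I : ℂ)) (by fun_prop) (a := a)
    (Eventually.of_forall hlt1)
    (by
      have hc : Continuous fun t : ℝ =>
          (1 - (Complex.exp ((-1 : ℝ) + t * Complex.I)).re)⁻¹ :=
        Continuous.inv₀ (by fun_prop) fun t => by linarith [hlt1 t]
      have : Continuous fun t : ℝ => ‖Complex.exp (-a * ((-1 : ℝ) + t * Complex.I))‖ *
          (1 - (Complex.exp ((-1 : ℝ) + t * Complex.I)).re)⁻¹ :=
        Continuous.mul (by fun_prop) hc
      exact this.integrableOn_Ioc)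
  have hswap : ∫ X in Ioi (0 : ℝ), halfStripIntegral η (-1) (P X) =
      halfStripIntegral η (-1) (fun τ => Complex.exp (-a * τ) * (1 - Complex.exp τ)⁻¹) := by
    simp only [halfStripIntegral, hP, intervalIntegral.integral_of_le (show -η ≤ η by linarith)]
    refine (integral_add (htop.1.sub hbot.1) (hside.1.smul Complex.I)).trans ?_
    refine congrArg₂ (· + ·) ((integral_sub htop.1 hbot.1).trans ?_)
      ((integral_smul Complex.I _).trans ?_)
    · rw [htop.2, hbot.2]
    · rw [hside.2]
  rw [hswap, halfStripIntegral_exp_mul_inv_one_sub_exp hη hη' (by norm_num) ha] at hGam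
  have hΓ : (Real.Gamma (1 + a) : ℂ) ≠ 0 := by
    exact_mod_cast (Real.Gamma_pos_of_pos (by positivity)).ne'
  rw [hGam]
  field_simp

end MonomialSummability

namespace MonomialSummability
open MeasureTheory Set Filter Topology

variable {E : Type*} [NormedAddCommGroup E] [NormedSpace ℂ E]

/-! ### The Borel transform as a Hankel integral in logarithmic coordinates -/

/-- The integral `(2πi)⁻¹ ∫ F(log v) e^v dv/v` over a Hankel contour, in the variable
`τ = log v`. -/
noncomputable def hankel (η R : ℝ) (F : ℂ → E) : E :=
  (2 * Real.pi * Complex.I : ℂ)⁻¹ •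
    halfStripIntegral η R (fun τ => Complex.exp (Complex.exp τ) • F τ)

theorem mem_halfStrip_top {η R t : ℝ} (hη : 0 ≤ η) (ht : R ≤ t) :
    (t + η * Complex.I : ℂ) ∈ Ici R ×ℂ Icc (-η) η := by
  refine ⟨?_, ?_⟩ <;> simp [ht, hη]

theorem mem_halfStrip_bot {η R t : ℝ} (hη : 0 ≤ η) (ht : R ≤ t) :
    (t + (-η : ℝ) * Complex.I : ℂ) ∈ Ici R ×ℂ Icc (-η) η := by
  refine ⟨?_, ?_⟩ <;> simp [ht, hη]

theorem mem_halfStrip_side {η R t : ℝ} (ht : t ∈ Icc (-η) η) :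
    (R + t * Complex.I : ℂ) ∈ Ici R ×ℂ Icc (-η) η := by
  refine ⟨?_, ?_⟩ <;> simp [ht.1, ht.2]

theorem continuousOn_hankel_integrand {η R : ℝ} {F : ℂ → E}
    (hF : ContinuousOn F (Ici R ×ℂ Icc (-η) η)) :
    ContinuousOn (fun τ => Complex.exp (Complex.exp τ) • F τ) (Ici R ×ℂ Icc (-η) η) :=
  (Continuous.continuousOn (by fun_prop)).smul hF

theorem aestronglyMeasurable_hankel_ray {η R σ : ℝ} (hσ : σ = η ∨ σ = -η) (hη : 0 ≤ η) {F : ℂ → E}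
    (hF : ContinuousOn F (Ici R ×ℂ Icc (-η) η)) :
    AEStronglyMeasurable (fun t : ℝ => Complex.exp (Complex.exp (t + σ * Complex.I)) •
      F (t + σ * Complex.I)) (volume.restrict (Ioi R)) := by
  refine ContinuousOn.aestronglyMeasurable ?_ measurableSet_Ioi
  refine (continuousOn_hankel_integrand hF).comp (f := fun t : ℝ => (t + σ * Complex.I : ℂ))
    (Continuous.continuousOn (by fun_prop)) fun t (ht : R < t) => ?_
  rcases hσ with rfl | rfl
  · exact mem_halfStrip_top hη ht.le
  · exact mem_halfStrip_bot hη ht.le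

theorem norm_hankel_ray_le {η R σ K t : ℝ} (hσ : σ = η ∨ σ = -η) (hη : 0 ≤ η) {F : ℂ → E}
    (hK : ∀ τ ∈ Ici R ×ℂ Icc (-η) η, ‖F τ‖ ≤ K) (ht : R ≤ t) :
    ‖Complex.exp (Complex.exp (t + σ * Complex.I)) • F (t + σ * Complex.I)‖ ≤
      K * Real.exp (Real.cos η * Real.exp t) := by
  have hcos : Real.cos σ = Real.cos η := by rcases hσ with rfl | rfl <;> simp
  rw [norm_smul, norm_exp_exp_ray, hcos, mul_comm]
  gcongr
  apply hK
  rcases hσ with rfl | rfl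
  · exact mem_halfStrip_top hη ht
  · exact mem_halfStrip_bot hη ht

theorem integrableOn_hankel_ray {η R σ K : ℝ} (hσ : σ = η ∨ σ = -η) (hη : 0 ≤ η)
    (hcos : Real.cos η < 0) {F : ℂ → E}
    (hF : ContinuousOn F (Ici R ×ℂ Icc (-η) η)) (hK : ∀ τ ∈ Ici R ×ℂ Icc (-η) η, ‖F τ‖ ≤ K) :
    IntegrableOn (fun t : ℝ => Complex.exp (Complex.exp (t + σ * Complex.I)) •
      F (t + σ * Complex.I)) (Ioi R) := by
  refine ((integrableOn_exp_mul_exp hcos R).const_mul K).mono'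
    (aestronglyMeasurable_hankel_ray hσ hη hF) ?_
  filter_upwards [ae_restrict_mem measurableSet_Ioi] with t (ht : R < t)
  exact norm_hankel_ray_le hσ hη hK ht.le

theorem intervalIntegrable_hankel_side {η R : ℝ} (hη : 0 ≤ η) {F : ℂ → E}
    (hF : ContinuousOn F (Ici R ×ℂ Icc (-η) η)) :
    IntervalIntegrable (fun t : ℝ => Complex.exp (Complex.exp (R + t * Complex.I)) •
      F (R + t * Complex.I)) volume (-η) η := by
  refine ContinuousOn.intervalIntegrable ?_
  rw [uIcc_of_le (by linarith)]
  exact (continuousOn_hankel_integrand hF).comp (f := fun t : ℝ => (R + t * Complex.I : ℂ))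
    (Continuous.continuousOn (by fun_prop)) fun t ht => mem_halfStrip_side ht

theorem norm_exp_exp_side_le (R t : ℝ) :
    ‖Complex.exp (Complex.exp (R + t * Complex.I))‖ ≤ Real.exp (Real.exp R) := by
  rw [norm_exp_exp_ray, Real.exp_le_exp]
  nlinarith [Real.exp_pos R, Real.cos_le_one t]

theorem hankel_eq_of_le {η R R' K : ℝ} (hη : 0 ≤ η) (hcos : Real.cos η < 0) (hR : R ≤ R')
    {F : ℂ → E} (hF : DifferentiableOn ℂ F (Ici R ×ℂ Icc (-η) η))
    (hK : ∀ τ ∈ Ici R ×ℂ Icc (-η) η, ‖F τ‖ ≤ K) : hankel η R F = hankel η R' F := by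
  unfold hankel
  rw [halfStripIntegral_eq_of_le hη hR]
  · exact (Differentiable.differentiableOn (by fun_prop)).smul hF
  · exact integrableOn_hankel_ray (Or.inl rfl) hη hcos hF.continuousOn hK
  · exact integrableOn_hankel_ray (Or.inr rfl) hη hcos hF.continuousOn hK

/-- On the rays the kernel has modulus e^{cos η · e^t} ≤ e^{cos η · t}, with cos η < 0; on the left
edge it is at most e^{e^R}. The explicit factor e^{e^R} matters: it becomes exponential growth in
R_s for one choice of R, and e^N for R = log N. -/
theorem norm_hankel_le {η R K : ℝ} (hη : 0 ≤ η) (hcos : Real.cos η < 0) (hR : 0 ≤ R)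
    {F : ℂ → E} (hK : ∀ τ ∈ Ici R ×ℂ Icc (-η) η, ‖F τ‖ ≤ K) :
    ‖hankel η R F‖ ≤ (2 * (-Real.cos η)⁻¹ + 2 * η) * K * Real.exp (Real.exp R) := by
  have hK0 : 0 ≤ K := (norm_nonneg _).trans (hK _ (mem_halfStrip_top hη le_rfl))
  have h1 : ∀ σ, σ = η ∨ σ = -η → ‖∫ t in Ioi R, Complex.exp (Complex.exp (t + σ * Complex.I)) •
      F (t + σ * Complex.I)‖ ≤ K * (-Real.cos η)⁻¹ * Real.exp (Real.exp R) := by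
    intro σ hσ
    have h2 : ‖∫ t in Ioi R, Complex.exp (Complex.exp (t + σ * Complex.I)) •
        F (t + σ * Complex.I)‖ ≤ ∫ t in Ioi R, K * Real.exp (Real.cos η * t) := by
      refine norm_integral_le_of_norm_le ((integrableOn_exp_mul_Ioi hcos R).const_mul K) ?_
      filter_upwards [ae_restrict_mem measurableSet_Ioi] with t (ht : R < t)
      refine (norm_hankel_ray_le hσ hη hK ht.le).trans ?_
      have h3 : Real.cos η * Real.exp t ≤ Real.cos η * t := by
        nlinarith [Real.add_one_le_exp t]
      gcongr
    refine h2.trans ?_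
    rw [integral_const_mul, integral_exp_mul_Ioi hcos, mul_assoc, neg_div, ← div_neg,
      div_eq_inv_mul]
    have h3 : 0 < (-Real.cos η)⁻¹ := inv_pos.2 (by linarith)
    gcongr
    nlinarith [Real.exp_pos R]
  have h2 : ‖Complex.I • ∫ t in (-η)..η, Complex.exp (Complex.exp (R + t * Complex.I)) •
      F (R + t * Complex.I)‖ ≤ 2 * η * K * Real.exp (Real.exp R) := by
    rw [norm_smul, Complex.norm_I, one_mul]
    have := intervalIntegral.norm_integral_le_of_norm_le_const (a := -η) (b := η)
      (f := fun t : ℝ => Complex.exp (Complex.exp (R + t * Complex.I)) • F (R + t * Complex.I))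
      (C := Real.exp (Real.exp R) * K) (fun t ht => by
        rw [uIoc_of_le (by linarith)] at ht
        rw [norm_smul]
        exact mul_le_mul (norm_exp_exp_side_le R t)
          (hK _ (mem_halfStrip_side (Ioc_subset_Icc_self ht))) (norm_nonneg _) (by positivity))
    rw [show |η - -η| = 2 * η by rw [abs_of_nonneg] <;> linarith] at this
    linarith
  unfold hankel
  rw [norm_smul, norm_inv]
  have h3 : 1 ≤ ‖(2 * Real.pi * Complex.I : ℂ)‖ := by
    simp only [norm_mul, Complex.norm_ofNat, Complex.norm_real, Real.norm_eq_abs, Complex.norm_I,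
      mul_one, abs_of_pos Real.pi_pos]
    linarith [Real.pi_gt_three]
  refine (mul_le_of_le_one_left (norm_nonneg _) (inv_le_one_of_one_le₀ h3)).trans ?_
  unfold halfStripIntegral
  refine (norm_add_le _ _).trans ((add_le_add ((norm_sub_le _ _).trans
    (add_le_add (h1 η (Or.inl rfl)) (h1 (-η) (Or.inr rfl)))) h2).trans (le_of_eq ?_))
  ring

theorem hankel_sub {η R K K' : ℝ} (hη : 0 ≤ η) (hcos : Real.cos η < 0) {F G : ℂ → E}
    (hF : ContinuousOn F (Ici R ×ℂ Icc (-η) η)) (hK : ∀ τ ∈ Ici R ×ℂ Icc (-η) η, ‖F τ‖ ≤ K)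
    (hG : ContinuousOn G (Ici R ×ℂ Icc (-η) η)) (hK' : ∀ τ ∈ Ici R ×ℂ Icc (-η) η, ‖G τ‖ ≤ K') :
    hankel η R (fun τ => F τ - G τ) = hankel η R F - hankel η R G := by
  simp only [hankel, halfStripIntegral, smul_sub]
  rw [integral_sub (integrableOn_hankel_ray (Or.inl rfl) hη hcos hF hK)
      (integrableOn_hankel_ray (Or.inl rfl) hη hcos hG hK'),
    integral_sub (integrableOn_hankel_ray (Or.inr rfl) hη hcos hF hK)
      (integrableOn_hankel_ray (Or.inr rfl) hη hcos hG hK'),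
    intervalIntegral.integral_sub (intervalIntegrable_hankel_side hη hF)
      (intervalIntegrable_hankel_side hη hG)]
  simp only [smul_add, smul_sub]
  abel

/-- As the exponents are nonnegative, each term is largest on the left edge Re τ = R, so summability
there dominates the series on the whole contour and Hankel's formula applies termwise. -/
theorem hasSum_hankel [CompleteSpace E] {ι : Type*} [Countable ι] {η R : ℝ}
    (hη : Real.pi / 2 < η) (hη' : η < Real.pi) {c : ι → E} {e : ι → ℝ} (he : ∀ i, 0 ≤ e i)
    (hc : Summable fun i => ‖c i‖ * Real.exp (-e i * R)) :
    HasSum (fun i => ((Real.Gamma (1 + e i))⁻¹ : ℂ) • c i)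
      (hankel η R (fun τ => ∑' i, Complex.exp (-e i * τ) • c i)) := by
  have hη0 : 0 ≤ η := by linarith [Real.pi_pos]
  have hcos : Real.cos η < 0 := Real.cos_neg_of_pi_div_two_lt_of_lt hη (by linarith)
  set T : ι → ℂ → E := fun i τ => Complex.exp (-e i * τ) • c i with hT
  have hTc : ∀ i, Continuous (T i) := fun i => by simp only [hT]; fun_prop
  have hTb : ∀ i, ∀ τ ∈ Ici R ×ℂ Icc (-η) η, ‖T i τ‖ ≤ ‖c i‖ * Real.exp (-e i * R) := by
    intro i τ hτ
    have h1 : R ≤ τ.re := hτ.1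
    simp only [hT]
    rw [norm_smul, Complex.norm_exp, mul_comm]
    have h2 : (-e i * τ : ℂ).re = -e i * τ.re := by simp
    rw [h2]
    have h3 : -e i * τ.re ≤ -e i * R := by nlinarith [he i]
    gcongr
  have hsum : ∀ τ ∈ Ici R ×ℂ Icc (-η) η, Summable fun i => T i τ := fun τ hτ =>
    Summable.of_norm_bounded hc fun i => hTb i τ hτ
  have hray : ∀ σ, σ = η ∨ σ = -η →
      HasSum (fun i => ∫ t in Ioi R, Complex.exp (Complex.exp (t + σ * Complex.I)) •
        T i (t + σ * Complex.I)) (∫ t in Ioi R, Complex.exp (Complex.exp (t + σ * Complex.I)) •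
        ∑' i, T i (t + σ * Complex.I)) := by
    intro σ hσ
    have h1 := hasSum_integral_of_summable_integral_norm (μ := volume.restrict (Ioi R))
      (F := fun i (t : ℝ) => Complex.exp (Complex.exp (t + σ * Complex.I)) •
        T i (t + σ * Complex.I))
      (fun i => integrableOn_hankel_ray hσ hη0 hcos (hTc i).continuousOn (hTb i)) ?_
    · convert h1 using 1
      refine setIntegral_congr_fun measurableSet_Ioi fun t (ht : R < t) => ?_
      refine ((hsum _ ?_).tsum_const_smul _).symm
      rcases hσ with rfl | rfl
      · exact mem_halfStrip_top hη0 ht.le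
      · exact mem_halfStrip_bot hη0 ht.le
    · refine Summable.of_nonneg_of_le (fun i => integral_nonneg fun t => norm_nonneg _)
        (fun i => ?_) (hc.mul_right (∫ t in Ioi R, Real.exp (Real.cos η * Real.exp t)))
      rw [← integral_const_mul]
      refine setIntegral_mono_on
        (integrableOn_hankel_ray hσ hη0 hcos (hTc i).continuousOn (hTb i)).norm
        ((integrableOn_exp_mul_exp hcos R).const_mul _) measurableSet_Ioi fun t (ht : R < t) => ?_
      exact norm_hankel_ray_le hσ hη0 (hTb i) ht.le
  have hside : HasSum (fun i => ∫ t in (-η)..η, Complex.exp (Complex.exp (R + t * Complex.I)) •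
        T i (R + t * Complex.I)) (∫ t in (-η)..η, Complex.exp (Complex.exp (R + t * Complex.I)) •
        ∑' i, T i (R + t * Complex.I)) := by
    refine intervalIntegral.hasSum_integral_of_dominated_convergence
      (fun i _ => Real.exp (Real.exp R) * (‖c i‖ * Real.exp (-e i * R))) ?_ ?_ ?_ ?_ ?_
    · intro i
      have := hTc i
      exact Continuous.aestronglyMeasurable (by fun_prop)
    · refine fun i => Eventually.of_forall fun t ht => ?_
      rw [uIoc_of_le (by linarith)] at ht
      rw [norm_smul]
      exact mul_le_mul (norm_exp_exp_side_le R t)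
        (hTb i _ (mem_halfStrip_side (Ioc_subset_Icc_self ht))) (norm_nonneg _) (by positivity)
    · exact Eventually.of_forall fun t _ => hc.mul_left _
    · exact intervalIntegrable_const
    · refine Eventually.of_forall fun t ht => ?_
      rw [uIoc_of_le (by linarith)] at ht
      exact (hsum _ (mem_halfStrip_side (Ioc_subset_Icc_self ht))).hasSum.const_smul _
  have hall := (((hray η (Or.inl rfl)).sub (hray (-η) (Or.inr rfl))).add
    (hside.const_smul Complex.I)).const_smul (2 * Real.pi * Complex.I : ℂ)⁻¹
  refine HasSum.congr_fun hall fun i => Eq.symm ?_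
  have hone : ∀ τ, Complex.exp (Complex.exp τ) • T i τ =
      (Complex.exp (Complex.exp τ) * Complex.exp (-e i * τ)) • c i := fun τ => by
    simp only [hT, smul_smul]
  simp only [hone]
  rw [integral_smul_const, integral_smul_const, intervalIntegral.integral_smul_const, smul_smul,
    ← sub_smul, ← add_smul, smul_smul]
  congr 1
  have := halfStripIntegral_exp_exp hη hη' R (he i)
  simp only [halfStripIntegral, smul_eq_mul] at this
  rw [this, inv_mul_cancel_left₀]
  simp [Real.pi_ne_zero]

theorem differentiableAt_hankel [CompleteSpace E] {η R K r : ℝ} (hη : 0 ≤ η)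
    (hcos : Real.cos η < 0) {F : ℂ × ℂ → ℂ → E} {w₀ : ℂ × ℂ} (hr : 0 < r)
    (hF : ∀ w ∈ Metric.ball w₀ r, ContinuousOn (F w) (Ici R ×ℂ Icc (-η) η))
    (hK : ∀ w ∈ Metric.ball w₀ r, ∀ τ ∈ Ici R ×ℂ Icc (-η) η, ‖F w τ‖ ≤ K)
    (hd : ∀ τ ∈ Ici R ×ℂ Icc (-η) η, DifferentiableOn ℂ (fun w => F w τ) (Metric.ball w₀ r)) :
    DifferentiableAt ℂ (fun w => hankel η R (F w)) w₀ := by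
  have hray : ∀ σ, σ = η ∨ σ = -η → DifferentiableAt ℂ (fun w => ∫ t in Ioi R,
      Complex.exp (Complex.exp (t + σ * Complex.I)) • F w (t + σ * Complex.I)) w₀ := by
    intro σ hσ
    refine differentiableAt_integral_of_norm_le hr
      (fun w hw => aestronglyMeasurable_hankel_ray hσ hη (hF w hw))
      (bound := fun t => K * Real.exp (Real.cos η * Real.exp t)) ?_
      ((integrableOn_exp_mul_exp hcos R).const_mul K) ?_
    · filter_upwards [ae_restrict_mem measurableSet_Ioi] with t (ht : R < t) w hw
      exact norm_hankel_ray_le hσ hη (hK w hw) ht.le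
    · filter_upwards [ae_restrict_mem measurableSet_Ioi] with t (ht : R < t)
      refine (hd _ ?_).const_smul _
      rcases hσ with rfl | rfl
      · exact mem_halfStrip_top hη ht.le
      · exact mem_halfStrip_bot hη ht.le
  have hside : DifferentiableAt ℂ (fun w => ∫ t in (-η)..η,
      Complex.exp (Complex.exp (R + t * Complex.I)) • F w (R + t * Complex.I)) w₀ := by
    simp only [intervalIntegral.integral_of_le (show -η ≤ η by linarith)]
    refine differentiableAt_integral_of_norm_le hr
      (fun w hw => ((intervalIntegrable_hankel_side hη (hF w hw)).1).aestronglyMeasurable)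
      (bound := fun t => Real.exp (Real.exp R) * K) ?_
      (integrable_const _) ?_
    · filter_upwards [ae_restrict_mem measurableSet_Ioc] with t ht w hw
      rw [norm_smul]
      exact mul_le_mul (norm_exp_exp_side_le R t)
          (hK w hw _ (mem_halfStrip_side (Ioc_subset_Icc_self ht))) (norm_nonneg _) (by positivity)
    · filter_upwards [ae_restrict_mem measurableSet_Ioc] with t ht
      exact (hd _ (mem_halfStrip_side (Ioc_subset_Icc_self ht))).const_smul _
  unfold hankel halfStripIntegral
  exact (((hray η (Or.inl rfl)).sub (hray (-η) (Or.inr rfl))).add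
    (hside.const_smul _)).const_smul _

end MonomialSummability

namespace MonomialSummability
open MeasureTheory Set Filter Topology

variable {E : Type*} [NormedAddCommGroup E] [NormedSpace ℂ E]

/-! ### Rotation of the ray of integration in a Laplace integral -/

theorem integral_horizontal_eq {G : ℂ → E} {a b : ℝ} (hab : a ≤ b) {g : ℝ → ℝ}
    (hG : DifferentiableOn ℂ G (univ ×ℂ Icc a b))
    (hg : ∀ x : ℝ, ∀ y ∈ Icc a b, ‖G (x + y * Complex.I)‖ ≤ g x) (hint : Integrable g)
    (htop : Tendsto g atTop (𝓝 0)) (hbot : Tendsto g atBot (𝓝 0)) :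
    ∫ x : ℝ, G (x + a * Complex.I) = ∫ x : ℝ, G (x + b * Complex.I) := by
  have hline : ∀ y ∈ Icc a b, Integrable fun x : ℝ => G (x + y * Complex.I) := by
    intro y hy
    refine hint.mono' (Continuous.aestronglyMeasurable ?_) (Eventually.of_forall fun x => hg x y hy)
    refine hG.continuousOn.comp_continuous (f := fun x : ℝ => (x + y * Complex.I : ℂ))
      (by fun_prop) fun x => ⟨mem_univ _, by simpa using hy⟩
  have hrect : ∀ T : ℝ, 0 ≤ T →
      (∫ x : ℝ in (-T)..T, G (x + a * Complex.I)) - (∫ x : ℝ in (-T)..T, G (x + b * Complex.I)) +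
      Complex.I • (∫ y : ℝ in a..b, G (T + y * Complex.I)) -
      Complex.I • (∫ y : ℝ in a..b, G ((-T : ℝ) + y * Complex.I)) = 0 := by
    intro T hT
    have h := Complex.integral_boundary_rect_eq_zero_of_differentiableOn G
      ((-T : ℝ) + a * Complex.I) (T + b * Complex.I) (by
        simp only [Complex.add_re, Complex.ofReal_re, Complex.mul_re, Complex.I_re, mul_zero,
          Complex.ofReal_im, Complex.I_im, mul_one, sub_self, add_zero, Complex.add_im,
          Complex.mul_im, zero_add]
        rw [uIcc_of_le hab]
        exact hG.mono (inter_subset_inter (preimage_mono (subset_univ _)) subset_rfl))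
    simpa only [Complex.add_re, Complex.ofReal_re, Complex.mul_re, Complex.I_re, mul_zero,
        Complex.ofReal_im, Complex.I_im, mul_one, sub_self, add_zero, Complex.add_im,
        Complex.mul_im, zero_add] using h
  have hlim : ∀ y ∈ Icc a b, Tendsto (fun T : ℝ => ∫ x : ℝ in (-T)..T, G (x + y * Complex.I)) atTop
      (𝓝 (∫ x : ℝ, G (x + y * Complex.I))) := fun y hy =>
    intervalIntegral_tendsto_integral (hline y hy) tendsto_neg_atTop_atBot tendsto_id
  have hside : ∀ u : ℝ → ℝ, Tendsto (fun T => g (u T)) atTop (𝓝 0) →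
      Tendsto (fun T : ℝ => Complex.I • ∫ y : ℝ in a..b, G (u T + y * Complex.I)) atTop (𝓝 0) := by
    intro u hu
    have h2 : Tendsto (fun T => g (u T) * |b - a|) atTop (𝓝 0) := by
      simpa using hu.mul_const |b - a|
    refine squeeze_zero_norm (fun T => ?_) h2
    rw [norm_smul, Complex.norm_I, one_mul]
    refine intervalIntegral.norm_integral_le_of_norm_le_const fun y hy => hg _ y ?_
    rw [uIoc_of_le hab] at hy
    exact Ioc_subset_Icc_self hy
  have htot := (((hlim a ⟨le_rfl, hab⟩).sub (hlim b ⟨hab, le_rfl⟩)).add (hside id htop)).sub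
    (hside (fun T => -T) (hbot.comp tendsto_neg_atTop_atBot))
  rw [add_zero, sub_zero] at htot
  rw [← sub_eq_zero]
  refine tendsto_nhds_unique htot (tendsto_const_nhds.congr' ?_)
  filter_upwards [eventually_ge_atTop (0 : ℝ)] with T hT
  exact (hrect T hT).symm

theorem setIntegral_Ioi_zero_eq_integral_exp {F : Type*} [NormedAddCommGroup F] [NormedSpace ℝ F]
    (g : ℝ → F) :
    ∫ ρ in Ioi (0 : ℝ), g ρ = ∫ x : ℝ, Real.exp x • g (Real.exp x) := by
  have h := integral_image_eq_integral_abs_deriv_smul (s := univ) (f := Real.exp) (f' := Real.exp)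
    MeasurableSet.univ (fun x _ => (Real.hasDerivAt_exp x).hasDerivWithinAt)
    Real.exp_injective.injOn g
  rw [image_univ, Real.range_exp] at h
  simpa [Real.abs_exp] using h

theorem integrable_exp_mul_exp_neg {κ : ℝ} (hκ : 0 < κ) :
    Integrable fun x : ℝ => Real.exp x * Real.exp (-κ * Real.exp x) := by
  have h := integrableOn_image_iff_integrableOn_abs_deriv_smul (s := univ) (f := Real.exp)
    (f' := Real.exp) MeasurableSet.univ (fun x _ => (Real.hasDerivAt_exp x).hasDerivWithinAt)
    Real.exp_injective.injOn (fun ρ => Real.exp (-κ * ρ))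
  rw [image_univ, Real.range_exp] at h
  simpa [Real.abs_exp] using h.1 (integrableOn_exp_mul_Ioi (by linarith) 0)

/-- The integral `∫₀^{e^{iθ}∞} Φ(log u) e^{-u} du`. -/
noncomputable def rayIntegral (θ : ℝ) (Φ : ℂ → E) : E :=
  ∫ ρ in Ioi (0 : ℝ), (Complex.exp (-(ρ * Complex.exp (θ * Complex.I))) *
    Complex.exp (θ * Complex.I)) • Φ (Real.log ρ + θ * Complex.I)

theorem norm_ray_kernel (θ ρ : ℝ) :
    ‖Complex.exp (-(ρ * Complex.exp (θ * Complex.I))) * Complex.exp (θ * Complex.I)‖ =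
      Real.exp (-(Real.cos θ) * ρ) := by
  rw [norm_mul, Complex.norm_exp_ofReal_mul_I, mul_one, Complex.norm_exp]
  congr 1
  rw [Complex.neg_re, Complex.re_ofReal_mul, Complex.exp_ofReal_mul_I_re]
  ring

/-- In the variable ζ = log u the rays are horizontal lines, and Cauchy's theorem on rectangles
compares them. -/
theorem rayIntegral_eq_of_le {Φ : ℂ → E} {a b c m C : ℝ} (hab : a ≤ b) (hm : m < c)
    (hc : ∀ y ∈ Icc a b, c ≤ Real.cos y)
    (hΦ : DifferentiableOn ℂ Φ (univ ×ℂ Icc a b))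
    (hb : ∀ ζ ∈ univ ×ℂ Icc a b, ‖Φ ζ‖ ≤ C * Real.exp (m * Real.exp ζ.re)) :
    rayIntegral a Φ = rayIntegral b Φ := by
  set G : ℂ → E := fun ζ => (Complex.exp (-Complex.exp ζ) * Complex.exp ζ) • Φ ζ with hG
  have hC0 : 0 ≤ C := by
    have h1 := (norm_nonneg _).trans (hb ((0 : ℝ) + a * Complex.I)
      ⟨mem_univ _, by simpa using hab⟩)
    exact nonneg_of_mul_nonneg_left h1 (Real.exp_pos _)
  have hconv : ∀ θ : ℝ, rayIntegral θ Φ = ∫ x : ℝ, G (x + θ * Complex.I) := by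
    intro θ
    unfold rayIntegral
    rw [setIntegral_Ioi_zero_eq_integral_exp]
    congr 1
    funext x
    simp only [hG, Real.log_exp]
    rw [Complex.exp_add, ← Complex.ofReal_exp, ← Complex.coe_smul, smul_smul]
    congr 1
    ring
  rw [hconv, hconv]
  refine integral_horizontal_eq hab
    -- One majorant for all the lines. It vanishes on the right because m < c, and on the left
    -- because of the factor e^x coming from du.
    (g := fun x => C * (Real.exp x * Real.exp (-(c - m) * Real.exp x))) ?_ ?_
    ((integrable_exp_mul_exp_neg (by linarith)).const_mul C) ?_ ?_
  · exact (Differentiable.differentiableOn (by fun_prop)).smul hΦ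
  · intro x y hy
    simp only [hG]
    have h1 := hb (x + y * Complex.I) ⟨mem_univ _, by simpa using hy⟩
    have h2 : (x + y * Complex.I : ℂ).re = x := by simp
    rw [h2] at h1
    rw [norm_smul, norm_mul, Complex.norm_exp, Complex.norm_exp, h2, Complex.neg_re,
      exp_add_mul_I_re]
    calc Real.exp (-(Real.exp x * Real.cos y)) * Real.exp x * ‖Φ (x + y * Complex.I)‖
        ≤ Real.exp (-(Real.exp x * c)) * Real.exp x * (C * Real.exp (m * Real.exp x)) := by
          gcongr
          exact hc y hy
      _ = C * (Real.exp x * (Real.exp (-(Real.exp x * c)) * Real.exp (m * Real.exp x))) := by ring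
      _ = _ := by
          rw [← Real.exp_add]
          congr 4
          ring
  · have h1 : Tendsto (fun ρ : ℝ => ρ ^ (1 : ℝ) * Real.exp (-(c - m) * ρ)) atTop (𝓝 0) :=
      tendsto_rpow_mul_exp_neg_mul_atTop_nhds_zero 1 (c - m) (by linarith)
    have h2 := (h1.comp Real.tendsto_exp_atTop).const_mul C
    simpa [Function.comp_def] using h2
  · have h1 : Tendsto (fun ρ : ℝ => ρ * Real.exp (-(c - m) * ρ)) (𝓝 0)
        (𝓝 (0 * Real.exp (-(c - m) * 0))) :=
      Continuous.tendsto (by fun_prop) 0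
    have h2 := (h1.comp Real.tendsto_exp_atBot).const_mul C
    simpa [Function.comp_def] using h2

/-! ### Watson's lemma -/

/-- Optimal truncation: Gevrey bounds for every N amount to exponential smallness in the inverse of
the variable e^x. -/
theorem exists_exp_bound_of_gevrey_bound {k C A : ℝ} (hk : 0 < k) (hC : 0 < C) (hA : 0 < A) :
    ∃ C' c : ℝ, 0 < C' ∧ 0 < c ∧ ∀ x δ : ℝ,
      (∀ N : ℕ, δ ≤ C * A ^ N * (N.factorial : ℝ) ^ (1 / k) * Real.exp (N * (x / k))) →
      δ ≤ C' * Real.exp (-c * Real.exp (-x)) := by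
  refine ⟨C * Real.exp (1 / k), 1 / (Real.exp 1 * A ^ k * k), by positivity, by positivity, ?_⟩
  intro x δ h
  set y : ℝ := A ^ k * Real.exp x with hy
  have hy0 : 0 < y := by positivity
  -- This N gives yN ≤ 1/e, hence y^N N! ≤ e^{-N}. Rounding down costs at most the factor e^{1/k} in
  -- the constant.
  set N : ℕ := ⌊1 / (Real.exp 1 * y)⌋₊ with hN
  have hN1 : (N : ℝ) ≤ 1 / (Real.exp 1 * y) := Nat.floor_le (by positivity)
  have hN2 : 1 / (Real.exp 1 * y) < N + 1 := Nat.lt_floor_add_one _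
  have h1 : A ^ N * (N.factorial : ℝ) ^ (1 / k) * Real.exp (N * (x / k)) =
      (y ^ N * N.factorial) ^ (1 / k) := by
    rw [Real.mul_rpow (by positivity) (by positivity), hy, mul_pow,
      Real.mul_rpow (by positivity) (by positivity)]
    have e1 : ((A ^ k) ^ N) ^ (1 / k) = A ^ N := by
      rw [← Real.rpow_natCast, ← Real.rpow_mul hA.le, ← Real.rpow_mul hA.le, ← Real.rpow_natCast]
      congr 1
      field_simp
    have e2 : (Real.exp x ^ N) ^ (1 / k) = Real.exp (N * (x / k)) := by
      rw [← Real.exp_nat_mul, ← Real.exp_mul]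
      congr 1
      ring
    rw [e1, e2]
    ring
  have h2 : y ^ N * N.factorial ≤ Real.exp (-N) := by
    calc y ^ N * N.factorial ≤ y ^ N * (N : ℝ) ^ N := by
          gcongr
          exact_mod_cast Nat.factorial_le_pow N
      _ = (y * N) ^ N := (mul_pow y (N : ℝ) N).symm
      _ ≤ (Real.exp (-1)) ^ N := by
          gcongr
          rw [le_div_iff₀ (by positivity)] at hN1
          rw [Real.exp_neg, ← one_div, le_div_iff₀ (Real.exp_pos 1)]
          linarith
      _ = Real.exp (-N) := by rw [← Real.exp_nat_mul]; congr 1; ring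
  refine (h N).trans ?_
  calc C * A ^ N * (N.factorial : ℝ) ^ (1 / k) * Real.exp (N * (x / k))
      = C * (y ^ N * N.factorial) ^ (1 / k) := by rw [← h1]; ring
    _ ≤ C * (Real.exp (-N)) ^ (1 / k) := by gcongr
    _ = C * Real.exp (-N * (1 / k)) := by rw [← Real.exp_mul]
    _ ≤ C * Real.exp ((1 - 1 / (Real.exp 1 * y)) * (1 / k)) := by
        gcongr
        linarith
    _ = _ := by
        rw [mul_assoc, ← Real.exp_add, hy]
        congr 2
        rw [Real.exp_neg]
        have := Real.exp_pos x
        field_simp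
        ring

/-- A half-strip wider than π contains the image of the right half-plane under z ↦ -ν log(z + 2) for
some ν > 1. The pulled-back function is bounded by C' e^{-c|z+2|^ν}, a superexponential decay, so
Phragmén–Lindelöf makes it vanish. -/
theorem watson [CompleteSpace E] {Δ : ℂ → E} {η k C A : ℝ} (hη : Real.pi / 2 < η) (hk : 0 < k)
    (hC : 0 < C) (hA : 0 < A) (hd : DifferentiableOn ℂ Δ (Iio 0 ×ℂ Ioo (-η) η))
    (hb : ∀ (N : ℕ), ∀ τ ∈ Iio 0 ×ℂ Ioo (-η) η,
      ‖Δ τ‖ ≤ C * A ^ N * (N.factorial : ℝ) ^ (1 / k) * Real.exp (N * (τ.re / k)))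
    {σ : ℝ} (hσ : |σ| < Real.pi / 2) : ∃ X : ℝ, ∀ x < X, Δ (x + σ * Complex.I) = 0 := by
  have hπ := Real.pi_pos
  obtain ⟨C', c, hC', hc, hexp⟩ := exists_exp_bound_of_gevrey_bound hk hC hA
  have hb' : ∀ τ ∈ Iio 0 ×ℂ Ioo (-η) η, ‖Δ τ‖ ≤ C' * Real.exp (-c * Real.exp (-τ.re)) :=
    fun τ hτ => hexp _ _ fun N => hb N τ hτ
  -- The midpoint of 1 and η/(π/2): larger than 1 for superexponential decay, yet with νπ/2 < η so
  -- that the image stays in the strip.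
  set ν : ℝ := (η / (Real.pi / 2) + 1) / 2 with hν
  have hη1 : 1 < η / (Real.pi / 2) := (one_lt_div (by positivity)).2 hη
  have hν1 : 1 < ν := by rw [hν]; linarith
  have hνη : ν * (Real.pi / 2) < η := by
    have : η = η / (Real.pi / 2) * (Real.pi / 2) := by field_simp
    rw [this]
    gcongr
    rw [hν]; linarith
  -- The shift by 2 keeps |z + 2| > 1, hence Re L(z) < 0, on the closed half-plane.
  set L : ℂ → ℂ := fun z => -ν * Complex.log (z + 2) with hL
  have hre : ∀ z : ℂ, 0 ≤ z.re → 0 < (z + 2).re := fun z hz => by simp; linarith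
  have hn2 : ∀ z : ℂ, 0 ≤ z.re → 2 ≤ ‖z + 2‖ := fun z hz => by
    refine le_trans ?_ (Complex.re_le_norm _)
    simp; linarith
  have hLre : ∀ z, (L z).re = -(ν * Real.log ‖z + 2‖) := fun z => by
    simp only [hL]
    rw [show (-ν * Complex.log (z + 2) : ℂ) = ((-ν : ℝ) : ℂ) * Complex.log (z + 2) by
        push_cast; ring,
      Complex.re_ofReal_mul, Complex.log_re]
    ring
  have hLim : ∀ z, (L z).im = -(ν * (z + 2).arg) := fun z => by
    simp only [hL]
    rw [show (-ν * Complex.log (z + 2) : ℂ) = ((-ν : ℝ) : ℂ) * Complex.log (z + 2) by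
        push_cast; ring,
      Complex.im_ofReal_mul, Complex.log_im]
    ring
  have hmem : ∀ z : ℂ, 0 ≤ z.re → L z ∈ Iio 0 ×ℂ Ioo (-η) η := by
    intro z hz
    have h1 : |(z + 2).arg| < Real.pi / 2 := Complex.abs_arg_lt_pi_div_two_iff.2 (Or.inl (hre z hz))
    rw [abs_lt] at h1
    refine ⟨?_, ?_⟩
    · change (L z).re < 0
      rw [hLre]
      have : 0 < Real.log ‖z + 2‖ := Real.log_pos (by linarith [hn2 z hz])
      nlinarith
    · change (L z).im ∈ Ioo (-η) η
      rw [hLim]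
      constructor <;> nlinarith
  have hopen : IsOpen (Iio (0 : ℝ) ×ℂ Ioo (-η) η) := isOpen_Iio.reProdIm isOpen_Ioo
  set f : ℂ → E := fun z => Δ (L z) with hf
  have hfd : ∀ z : ℂ, 0 ≤ z.re → DifferentiableAt ℂ f z := by
    intro z hz
    have h1 : DifferentiableAt ℂ L z := by
      refine DifferentiableAt.const_mul (DifferentiableAt.clog (by fun_prop) ?_) _
      exact Or.inl (hre z hz)
    exact ((hd (L z) (hmem z hz)).differentiableAt (hopen.mem_nhds (hmem z hz))).comp z h1
  have hfb : ∀ z : ℂ, 0 ≤ z.re → ‖f z‖ ≤ C' * Real.exp (-c * ‖z + 2‖ ^ ν) := by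
    intro z hz
    refine (hb' _ (hmem z hz)).trans (le_of_eq ?_)
    have : 0 < ‖z + 2‖ := by linarith [hn2 z hz]
    rw [hLre, neg_neg, Real.rpow_def_of_pos this, mul_comm ν]
  have hfC : ∀ z : ℂ, 0 ≤ z.re → ‖f z‖ ≤ C' := by
    intro z hz
    refine (hfb z hz).trans (mul_le_of_le_one_right hC'.le (Real.exp_le_one_iff.2 ?_))
    have : 0 ≤ ‖z + 2‖ ^ ν := by positivity
    nlinarith
  have hzero : EqOn f 0 {z : ℂ | 0 ≤ z.re} := by
    refine PhragmenLindelof.eq_zero_on_right_half_plane_of_superexponential_decay ?_ ?_ ?_ ?_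
    · refine DifferentiableOn.diffContOnCl fun z hz => ?_
      rw [Complex.closure_setOfPred_lt_re] at hz
      exact (hfd z hz).differentiableWithinAt
    · refine ⟨1, by norm_num, 0, Asymptotics.IsBigO.of_bound C' ?_⟩
      refine eventually_inf_principal.2 (Eventually.of_forall fun z (hz : 0 < z.re) => ?_)
      simpa using hfC z hz.le
    · intro n
      have h1 : Tendsto (fun x : ℝ => x * (n - c * x ^ (ν - 1))) atTop atBot := by
        refine tendsto_id.atTop_mul_atBot₀ ?_
        have h2 : Tendsto (fun x : ℝ => c * x ^ (ν - 1)) atTop atTop :=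
          (tendsto_rpow_atTop (by linarith)).const_mul_atTop hc
        exact tendsto_atBot_add_const_left _ _ (tendsto_neg_atTop_atBot.comp h2)
      have h2 : Tendsto (fun x : ℝ => C' * Real.exp (x * (n - c * x ^ (ν - 1)))) atTop (𝓝 0) := by
        simpa using (Real.tendsto_exp_atBot.comp h1).const_mul C'
      refine squeeze_zero' (Eventually.of_forall fun x => by positivity) ?_ h2
      filter_upwards [eventually_gt_atTop (0 : ℝ)] with x hx
      rw [← Real.exp_nat_mul]
      have h3 := hfb (x : ℂ) (by simpa using hx.le)
      have h4 : x ^ ν ≤ ‖(x : ℂ) + 2‖ ^ ν := by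
        gcongr
        refine le_trans ?_ (Complex.re_le_norm _)
        simp
      calc Real.exp (n * x) * ‖f x‖ ≤ Real.exp (n * x) * (C' * Real.exp (-c * x ^ ν)) := by
            refine mul_le_mul_of_nonneg_left (h3.trans ?_) (by positivity)
            gcongr C' * Real.exp ?_
            nlinarith
        _ = C' * (Real.exp (n * x) * Real.exp (-c * x ^ ν)) := by ring
        _ = _ := by
            rw [← Real.exp_add]
            congr 2
            have : x ^ ν = x * x ^ (ν - 1) := by
              rw [Real.rpow_sub hx, Real.rpow_one]
              field_simp
            rw [this]
            ring
    · exact ⟨C', fun x => hfC _ (by simp)⟩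
  have hσν : |σ / ν| < Real.pi / 2 := by
    rw [abs_div, abs_of_pos (by linarith : 0 < ν)]
    refine lt_of_le_of_lt ?_ hσ
    exact div_le_self (abs_nonneg _) hν1.le
  have hcosν : 0 < Real.cos (σ / ν) := Real.cos_pos_of_mem_Ioo (abs_lt.1 hσν)
  refine ⟨-(ν * Real.log (2 / Real.cos (σ / ν))), fun x hx => ?_⟩
  -- The preimage of x + iσ under L. It lies in the right half-plane for x very negative because
  -- cos(σ/ν) > 0.
  set z : ℂ := Complex.exp (-(x + σ * Complex.I) / ν) - 2 with hz
  have hexpz : (-(x + σ * Complex.I) / ν : ℂ) =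
      ((-x / ν : ℝ) : ℂ) + ((-(σ / ν) : ℝ) : ℂ) * Complex.I := by
    push_cast
    ring
  have hzre : 0 ≤ z.re := by
    rw [hz, Complex.sub_re, hexpz, exp_add_mul_I_re, Real.cos_neg]
    have h1 : Real.log (2 / Real.cos (σ / ν)) ≤ -x / ν := by
      rw [le_div_iff₀ (by linarith)]
      linarith
    rw [Real.log_le_iff_le_exp (by positivity), div_le_iff₀ hcosν] at h1
    simpa using h1
  have h0 := hzero hzre
  have hLz : L z = x + σ * Complex.I := by
    have hν0 : (ν : ℂ) ≠ 0 := by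
      have : ν ≠ 0 := by linarith
      exact_mod_cast this
    rw [abs_lt] at hσν
    simp only [hL, hz, sub_add_cancel]
    rw [Complex.log_exp]
    · field_simp
    · rw [hexpz]
      simp
      linarith
    · rw [hexpz]
      simp
      linarith
  simpa [hf, hLz] using h0

end MonomialSummability

namespace MonomialSummability
open MeasureTheory Set Filter Topology

variable {E : Type*} [NormedAddCommGroup E] [NormedSpace ℂ E]

/-! ### Logarithmic coordinates on the surface -/

/-- The point with logarithmic coordinates `w` relative to the base point `y`. -/
noncomputable def act (p q : ℕ) (w : ℂ × ℂ) (y : ℂ × ℂ × ℝ) : ℂ × ℂ × ℝ :=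
  (y.1 * Complex.exp w.1, y.2.1 * Complex.exp w.2, y.2.2 + (p * w.1.im + q * w.2.im))

/-- The logarithmic coordinates `(s ζ/(pk), (1-s) ζ/(qk))`. -/
noncomputable def weightVec (p q : ℕ) (k s : ℝ) (ζ : ℂ) : ℂ × ℂ :=
  (((s / (p * k) : ℝ) : ℂ) * ζ, (((1 - s) / (q * k) : ℝ) : ℂ) * ζ)

/-- The point `(x₁ u^{s/(pk)}, x₂ u^{(1-s)/(qk)})` for `u = e^ζ`. -/
noncomputable def dil (p q : ℕ) (k s : ℝ) (ζ : ℂ) (y : ℂ × ℂ × ℝ) : ℂ × ℂ × ℝ :=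
  act p q (weightVec p q k s ζ) y

/-- The exponent `|x₁|^{pk/s} + |x₂|^{qk/(1-s)}`. -/
noncomputable def weightNorm (p q : ℕ) (k s : ℝ) (y : ℂ × ℂ × ℝ) : ℝ :=
  ‖y.1‖ ^ (p * k / s) + ‖y.2.1‖ ^ (q * k / (1 - s))

variable {p q : ℕ} {k s : ℝ} {y : ℂ × ℂ × ℝ}

theorem weightNorm_nonneg : 0 ≤ weightNorm p q k s y := by
  unfold weightNorm; positivity

@[simp] theorem act_zero : act p q 0 y = y := by
  simp [act]

theorem act_add (w w' : ℂ × ℂ) : act p q (w + w') y = act p q w (act p q w' y) := by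
  simp only [act, Prod.fst_add, Prod.snd_add, Complex.exp_add, Complex.add_im, Prod.mk.injEq]
  refine ⟨by ring, by ring, by ring⟩

theorem weightVec_add (ζ ζ' : ℂ) :
    weightVec p q k s (ζ + ζ') = weightVec p q k s ζ + weightVec p q k s ζ' := by
  simp [weightVec, mul_add]

@[simp] theorem weightVec_zero : weightVec p q k s 0 = 0 := by
  simp [weightVec]

theorem differentiable_weightVec : Differentiable ℂ (weightVec p q k s) := by
  unfold weightVec
  fun_prop

@[simp] theorem dil_zero : dil p q k s 0 y = y := by
  simp [dil]

theorem dil_add (ζ ζ' : ℂ) : dil p q k s (ζ + ζ') y = dil p q k s ζ (dil p q k s ζ' y) := by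
  simp only [dil, weightVec_add, act_add]

theorem act_dil (w : ℂ × ℂ) (ζ : ℂ) :
    act p q w (dil p q k s ζ y) = dil p q k s ζ (act p q w y) := by
  simp only [dil, ← act_add, add_comm]

theorem monomial_act (w : ℂ × ℂ) :
    (act p q w y).1 ^ p * (act p q w y).2.1 ^ q =
      y.1 ^ p * y.2.1 ^ q * Complex.exp (p * w.1 + q * w.2) := by
  simp only [act, mul_pow, Complex.exp_add, Complex.exp_nat_mul]
  ring

theorem act_mem_surface (hy : y ∈ surface p q) (w : ℂ × ℂ) : act p q w y ∈ surface p q := by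
  obtain ⟨h1, h2, h3⟩ := hy
  refine ⟨by simp [act, h1], by simp [act, h2], ?_⟩
  rw [monomial_act, norm_mul, Complex.norm_exp]
  nth_rewrite 1 [h3]
  have h4 : (p * w.1 + q * w.2 : ℂ) = ((p * w.1 + q * w.2 : ℂ).re : ℂ) +
      (p * w.1.im + q * w.2.im : ℝ) * Complex.I := by
    apply Complex.ext <;> simp
  nth_rewrite 1 [h4]
  simp only [act]
  push_cast
  rw [Complex.exp_add, add_mul (y.2.2 : ℂ), Complex.exp_add (y.2.2 * Complex.I)]
  ring

theorem dil_mem_surface (hy : y ∈ surface p q) (ζ : ℂ) : dil p q k s ζ y ∈ surface p q :=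
  act_mem_surface hy _

theorem dil_arg (hp : 0 < p) (hq : 0 < q) (ζ : ℂ) :
    (dil p q k s ζ y).2.2 = y.2.2 + ζ.im / k := by
  have hp' : (p : ℝ) ≠ 0 := by exact_mod_cast hp.ne'
  have hq' : (q : ℝ) ≠ 0 := by exact_mod_cast hq.ne'
  simp only [dil, act, weightVec, Complex.im_ofReal_mul]
  rcases eq_or_ne k 0 with rfl | hk
  · simp
  · field_simp
    ring

theorem monomial_dil (hp : 0 < p) (hq : 0 < q) (ζ : ℂ) :
    (dil p q k s ζ y).1 ^ p * (dil p q k s ζ y).2.1 ^ q =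
      y.1 ^ p * y.2.1 ^ q * Complex.exp (ζ / k) := by
  have hp' : (p : ℂ) ≠ 0 := by exact_mod_cast hp.ne'
  have hq' : (q : ℂ) ≠ 0 := by exact_mod_cast hq.ne'
  rw [dil, monomial_act]
  congr 2
  simp only [weightVec]
  push_cast
  rcases eq_or_ne (k : ℂ) 0 with hk | hk
  · simp [hk]
  · field_simp
    ring

theorem norm_monomial_dil (hp : 0 < p) (hq : 0 < q) (ζ : ℂ) :
    ‖(dil p q k s ζ y).1 ^ p * (dil p q k s ζ y).2.1 ^ q‖ =
      ‖y.1 ^ p * y.2.1 ^ q‖ * Real.exp (ζ.re / k) := by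
  rw [monomial_dil hp hq, norm_mul, Complex.norm_exp]
  congr 2
  exact Complex.div_ofReal_re ζ k

theorem norm_dil_fst (ζ : ℂ) :
    ‖(dil p q k s ζ y).1‖ = ‖y.1‖ * Real.exp (s / (p * k) * ζ.re) := by
  simp [dil, act, weightVec, Complex.norm_exp, -Complex.ofReal_div]

theorem norm_dil_snd (ζ : ℂ) :
    ‖(dil p q k s ζ y).2.1‖ = ‖y.2.1‖ * Real.exp ((1 - s) / (q * k) * ζ.re) := by
  simp [dil, act, weightVec, Complex.norm_exp, -Complex.ofReal_div]

theorem norm_dil_fst_pow (hp : 0 < p) (ζ : ℂ) :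
    ‖(dil p q k s ζ y).1‖ ^ p = ‖y.1‖ ^ p * Real.exp (s / k * ζ.re) := by
  have hp' : (p : ℝ) ≠ 0 := by exact_mod_cast hp.ne'
  rw [norm_dil_fst, mul_pow, ← Real.exp_nat_mul]
  congr 2
  rcases eq_or_ne k 0 with rfl | hk
  · simp
  · field_simp

theorem norm_dil_snd_pow (hq : 0 < q) (ζ : ℂ) :
    ‖(dil p q k s ζ y).2.1‖ ^ q = ‖y.2.1‖ ^ q * Real.exp ((1 - s) / k * ζ.re) := by
  have hq' : (q : ℝ) ≠ 0 := by exact_mod_cast hq.ne'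
  rw [norm_dil_snd, mul_pow, ← Real.exp_nat_mul]
  congr 2
  rcases eq_or_ne k 0 with rfl | hk
  · simp
  · field_simp

/-- The exponents in R_s are chosen for this homogeneity: on an orbit, growth e^{M R_s} becomes
growth e^{M R_s |u|}, which the kernel e^{-u} can absorb. -/
theorem weightNorm_dil (hp : 0 < p) (hq : 0 < q) (hk : 0 < k) (hs : 0 < s) (hs' : s < 1) (ζ : ℂ) :
    weightNorm p q k s (dil p q k s ζ y) = Real.exp ζ.re * weightNorm p q k s y := by
  have hp' : (0 : ℝ) < p := by exact_mod_cast hp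
  have hq' : (0 : ℝ) < q := by exact_mod_cast hq
  have hs1 : 0 < 1 - s := by linarith
  unfold weightNorm
  rw [norm_dil_fst, norm_dil_snd, Real.mul_rpow (by positivity) (by positivity),
    Real.mul_rpow (by positivity) (by positivity), ← Real.exp_mul, ← Real.exp_mul,
    show s / (p * k) * ζ.re * (p * k / s) = ζ.re by field_simp,
    show (1 - s) / (q * k) * ζ.re * (q * k / (1 - s)) = ζ.re by field_simp]
  ring

theorem dilate_eq_dil (hp : 0 < p) (hq : 0 < q) (θ ρ : ℝ) :
    dilate p q k s θ y ρ = dil p q k s (Real.log ρ + θ * Complex.I) y := by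
  refine Prod.ext rfl (Prod.ext rfl ?_)
  rw [dil_arg hp hq]
  simp [dilate]

theorem dil_mem_sector (hp : 0 < p) (hq : 0 < q) {α β : ℝ} (hy : y ∈ surface p q) {ζ : ℂ}
    (h1 : α < y.2.2 + ζ.im / k) (h2 : y.2.2 + ζ.im / k < β) :
    dil p q k s ζ y ∈ sector p q α β := by
  refine ⟨dil_mem_surface hy _, ?_, ?_⟩ <;> rwa [dil_arg hp hq]

theorem dil_mem_boundedSector (hp : 0 < p) (hq : 0 < q) (hk : 0 < k) (hs : 0 < s) (hs' : s < 1)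
    {α β r : ℝ} (hy : y ∈ surface p q) (hy1 : ‖y.1‖ ^ p < r) (hy2 : ‖y.2.1‖ ^ q < r) {ζ : ℂ}
    (hζ : ζ.re ≤ 0) (h1 : α < y.2.2 + ζ.im / k) (h2 : y.2.2 + ζ.im / k < β) :
    dil p q k s ζ y ∈ boundedSector p q α β r := by
  have hs1 : 0 < 1 - s := by linarith
  refine ⟨dil_mem_sector hp hq hy h1 h2, ?_, ?_⟩
  · rw [norm_dil_fst_pow hp]
    refine lt_of_le_of_lt (mul_le_of_le_one_right (by positivity) ?_) hy1
    exact Real.exp_le_one_iff.2 (mul_nonpos_of_nonneg_of_nonpos (by positivity) hζ)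
  · rw [norm_dil_snd_pow hq]
    refine lt_of_le_of_lt (mul_le_of_le_one_right (by positivity) ?_) hy2
    exact Real.exp_le_one_iff.2 (mul_nonpos_of_nonneg_of_nonpos (by positivity) hζ)

theorem continuous_act : Continuous fun w : ℂ × ℂ => act p q w y := by
  unfold act
  fun_prop

/-- A set of points of the surface is open in the logarithmic coordinates. -/
def IsActOpen (p q : ℕ) (S : Set (ℂ × ℂ × ℝ)) : Prop :=
  S ⊆ surface p q ∧ ∀ y ∈ S, ∀ᶠ w in 𝓝 (0 : ℂ × ℂ), act p q w y ∈ S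

theorem isActOpen_of_isOpen {U : Set (ℂ × ℂ × ℝ)} (hU : IsOpen U) :
    IsActOpen p q (surface p q ∩ U) := by
  refine ⟨inter_subset_left, fun y hy => ?_⟩
  have h1 : ∀ᶠ w in 𝓝 (0 : ℂ × ℂ), act p q w y ∈ U :=
    (continuous_act (p := p) (q := q) (y := y)).continuousAt.eventually_mem
      (hU.mem_nhds (by simpa using hy.2))
  filter_upwards [h1] with w hw using ⟨act_mem_surface hy.1 w, hw⟩

theorem isOpen_argInterval (α β : ℝ) : IsOpen {y : ℂ × ℂ × ℝ | α < y.2.2 ∧ y.2.2 < β} :=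
  isOpen_Ioo.preimage (continuous_snd.comp continuous_snd)

theorem isActOpen_sector (α β : ℝ) : IsActOpen p q (sector p q α β) :=
  isActOpen_of_isOpen (isOpen_argInterval α β)

theorem isActOpen_boundedSector (α β r : ℝ) : IsActOpen p q (boundedSector p q α β r) := by
  have h1 : IsOpen {y : ℂ × ℂ × ℝ | ‖y.1‖ ^ p < r} :=
    isOpen_Iio.preimage (f := fun y : ℂ × ℂ × ℝ => ‖y.1‖ ^ p) (by fun_prop)
  have h2 : IsOpen {y : ℂ × ℂ × ℝ | ‖y.2.1‖ ^ q < r} :=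
    isOpen_Iio.preimage (f := fun y : ℂ × ℂ × ℝ => ‖y.2.1‖ ^ q) (by fun_prop)
  have h := isActOpen_of_isOpen (p := p) (q := q)
    ((isOpen_argInterval α β).inter (h1.inter h2))
  rwa [← inter_assoc] at h

/-- As long as the argument of the monomial changes by less than π, the branch centred at the old
argument recovers the continued one. -/
theorem act_eq_branchArg (hy : y ∈ surface p q) {w : ℂ × ℂ}
    (hw : p * w.1.im + q * w.2.im ∈ Ioo (-Real.pi) Real.pi) :
    act p q w y = (y.1 * Complex.exp w.1, y.2.1 * Complex.exp w.2, branchArg y.2.2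
      ((y.1 * Complex.exp w.1) ^ p * (y.2.1 * Complex.exp w.2) ^ q)) := by
  have hm := monomial_act (p := p) (q := q) (y := y) w
  simp only [act] at hm
  simp only [act, branchArg, hm, Prod.mk.injEq, true_and, add_right_inj]
  obtain ⟨h1, h2, h3⟩ := hy
  have hpos : 0 < ‖y.1 ^ p * y.2.1 ^ q‖ := by
    rw [norm_pos_iff]
    exact mul_ne_zero (pow_ne_zero _ h1) (pow_ne_zero _ h2)
  rw [h3, show ((‖y.1 ^ p * y.2.1 ^ q‖ : ℂ) * Complex.exp (y.2.2 * Complex.I)) *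
      Complex.exp (p * w.1 + q * w.2) * Complex.exp (-(y.2.2 * Complex.I)) =
      (‖y.1 ^ p * y.2.1 ^ q‖ : ℂ) * Complex.exp (p * w.1 + q * w.2) by
    rw [Complex.exp_neg]
    have := Complex.exp_ne_zero (y.2.2 * Complex.I)
    field_simp,
    Complex.arg_real_mul _ hpos, Complex.arg_exp]
  simp only [Complex.add_im, Complex.mul_im, Complex.natCast_re, Complex.natCast_im, zero_mul,
    add_zero]
  rw [eq_comm, toIocMod_eq_self]
  constructor
  · exact hw.1
  · linarith [hw.2]

/-- The exponential and logarithm are mutually inverse local charts at a point with nonzero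
coordinates. After this, branches of the argument are no longer needed. -/
theorem differentiableAt_branch_iff (hy : y ∈ surface p q) (f : ℂ × ℂ × ℝ → E) :
    DifferentiableAt ℂ
      (fun z : ℂ × ℂ => f (z.1, z.2, branchArg y.2.2 (z.1 ^ p * z.2 ^ q))) (y.1, y.2.1) ↔
    DifferentiableAt ℂ (fun w : ℂ × ℂ => f (act p q w y)) 0 := by
  have hy1 : y.1 ≠ 0 := hy.1
  have hy2 : y.2.1 ≠ 0 := hy.2.1
  have hsmall : ∀ᶠ w in 𝓝 (0 : ℂ × ℂ),
      (p * w.1.im + q * w.2.im : ℝ) ∈ Ioo (-Real.pi) Real.pi := by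
    have hc : Continuous fun w : ℂ × ℂ => p * w.1.im + q * w.2.im := by fun_prop
    refine hc.continuousAt.eventually_mem (Ioo_mem_nhds ?_ ?_) <;> simp [Real.pi_pos]
  constructor
  · intro h
    have hg : DifferentiableAt ℂ (fun w : ℂ × ℂ => (y.1 * Complex.exp w.1, y.2.1 * Complex.exp w.2))
        0 := by fun_prop
    have h' : DifferentiableAt ℂ
        (fun z : ℂ × ℂ => f (z.1, z.2, branchArg y.2.2 (z.1 ^ p * z.2 ^ q)))
        ((fun w : ℂ × ℂ => (y.1 * Complex.exp w.1, y.2.1 * Complex.exp w.2)) 0) := by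
      simpa using h
    refine (h'.comp 0 hg).congr_of_eventuallyEq ?_
    filter_upwards [hsmall] with w hw
    simp only [Function.comp]
    rw [act_eq_branchArg hy hw]
  · intro h
    set g : ℂ × ℂ → ℂ × ℂ := fun z =>
      (Complex.log (z.1 / y.1), Complex.log (z.2 / y.2.1)) with hgdef
    have hg0 : g (y.1, y.2.1) = 0 := by simp [hgdef, hy1, hy2]
    have hg : DifferentiableAt ℂ g (y.1, y.2.1) := by
      refine DifferentiableAt.prodMk ?_ ?_
      · refine DifferentiableAt.clog (by fun_prop) ?_
        simp [hy1]
      · refine DifferentiableAt.clog (by fun_prop) ?_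
        simp [hy2]
    have h' : DifferentiableAt ℂ (fun w : ℂ × ℂ => f (act p q w y)) (g (y.1, y.2.1)) := by
      rwa [hg0]
    refine (h'.comp _ hg).congr_of_eventuallyEq ?_
    have hev : ∀ᶠ z in 𝓝 (y.1, y.2.1),
        (p * (g z).1.im + q * (g z).2.im : ℝ) ∈ Ioo (-Real.pi) Real.pi :=
      hg.continuousAt.eventually (by rwa [hg0])
    have hne1 : ∀ᶠ z : ℂ × ℂ in 𝓝 (y.1, y.2.1), z.1 ≠ 0 :=
      continuousAt_fst.eventually_ne hy1
    have hne2 : ∀ᶠ z : ℂ × ℂ in 𝓝 (y.1, y.2.1), z.2 ≠ 0 :=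
      continuousAt_snd.eventually_ne hy2
    filter_upwards [hev, hne1, hne2] with z hz hz1 hz2
    simp only [Function.comp]
    rw [act_eq_branchArg hy hz]
    have e1 : y.1 * Complex.exp (g z).1 = z.1 := by
      simp only [hgdef]
      rw [Complex.exp_log (div_ne_zero hz1 hy1)]
      field_simp
    have e2 : y.2.1 * Complex.exp (g z).2 = z.2 := by
      simp only [hgdef]
      rw [Complex.exp_log (div_ne_zero hz2 hy2)]
      field_simp
    rw [e1, e2]

theorem isHolomorphicOn_iff {S : Set (ℂ × ℂ × ℝ)} (hS : S ⊆ surface p q) {f : ℂ × ℂ × ℝ → E} :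
    IsHolomorphicOn p q f S ↔
      ∀ y ∈ S, DifferentiableAt ℂ (fun w : ℂ × ℂ => f (act p q w y)) 0 :=
  forall₂_congr fun _ hy => differentiableAt_branch_iff (hS hy) f

theorem IsHolomorphicOn.differentiableAt_act {S : Set (ℂ × ℂ × ℝ)} (hS : S ⊆ surface p q)
    {f : ℂ × ℂ × ℝ → E} (hf : IsHolomorphicOn p q f S) {w : ℂ × ℂ} (hw : act p q w y ∈ S) :
    DifferentiableAt ℂ (fun w : ℂ × ℂ => f (act p q w y)) w := by
  have h := (isHolomorphicOn_iff hS).1 hf _ hw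
  have h' : DifferentiableAt ℂ (fun v : ℂ × ℂ => f (act p q v (act p q w y))) (w - w) := by
    rwa [sub_self]
  have h2 := h'.comp w (f := fun v : ℂ × ℂ => v - w) (by fun_prop)
  refine h2.congr_of_eventuallyEq (Eventually.of_forall fun v => ?_)
  simp only [Function.comp]
  rw [← act_add, sub_add_cancel]

theorem IsHolomorphicOn.differentiableAt_dil {S : Set (ℂ × ℂ × ℝ)} (hS : S ⊆ surface p q)
    {f : ℂ × ℂ × ℝ → E} (hf : IsHolomorphicOn p q f S) {ζ : ℂ} (hζ : dil p q k s ζ y ∈ S) :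
    DifferentiableAt ℂ (fun ζ : ℂ => f (dil p q k s ζ y)) ζ :=
  (hf.differentiableAt_act hS hζ).comp ζ (differentiable_weightVec ζ)

theorem IsHolomorphicOn.analyticAt_dil [CompleteSpace E] {S : Set (ℂ × ℂ × ℝ)}
    (hS : IsActOpen p q S) {f : ℂ × ℂ × ℝ → E} (hf : IsHolomorphicOn p q f S) {ζ : ℂ}
    (hζ : dil p q k s ζ y ∈ S) :
    AnalyticAt ℂ (fun ζ : ℂ => f (dil p q k s ζ y)) ζ := by
  rw [Complex.analyticAt_iff_eventually_differentiableAt]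
  have h1 := hS.2 _ hζ
  have h2 : Tendsto (fun ζ' : ℂ => weightVec p q k s (ζ' - ζ)) (𝓝 ζ) (𝓝 0) := by
    have : Continuous fun ζ' : ℂ => weightVec p q k s (ζ' - ζ) :=
      differentiable_weightVec.continuous.comp (by fun_prop)
    simpa using this.tendsto ζ
  filter_upwards [h2.eventually h1] with ζ' hζ'
  refine hf.differentiableAt_dil hS.1 ?_
  rw [dil, ← act_add, ← weightVec_add, sub_add_cancel] at hζ'
  exact hζ'

end MonomialSummability

namespace MonomialSummability
open MeasureTheory Set Filter Topology

variable {E : Type*} [NormedAddCommGroup E] [NormedSpace ℂ E]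

/-! ### Coefficients and series -/

/-- The coefficients of a Gevrey series satisfy the corresponding bounds. -/
theorem IsMonomialGevrey.exists_norm_coeff_le [CompleteSpace E] {p q : ℕ} {σ : ℝ}
    {a : ℕ × ℕ → E} (ha : IsMonomialGevrey p q σ a) :
    ∃ r C A : ℝ, 0 < r ∧ 0 < C ∧ 0 < A ∧ ∀ (n : ℕ) (i : ℕ × ℕ), i.1 < p ∨ i.2 < q →
      ‖a (n * p + i.1, n * q + i.2)‖ * (r ^ i.1 * r ^ i.2) ≤
        C * A ^ n * (n.factorial : ℝ) ^ σ := by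
  obtain ⟨r, C, A, hr, hC, hA, h⟩ := ha
  refine ⟨r, C, A, hr, hC, hA, fun n i hi => ?_⟩
  set b : ℕ × ℕ → E := fun i => if i.1 < p ∨ i.2 < q then a (n * p + i.1, n * q + i.2) else 0
    with hb
  set K := C * A ^ n * (n.factorial : ℝ) ^ σ with hK
  have hterm : ∀ x₁ x₂ : ℂ, coeffTerm p q a n x₁ x₂ = fun i => x₁ ^ i.1 • (x₂ ^ i.2 • b i) := by
    intro x₁ x₂
    funext i
    simp only [coeffTerm, hb]
    split_ifs <;> simp [smul_smul]
  have hsum : ∀ x₁ x₂ : ℂ, ‖x₁‖ < r → ‖x₂‖ < r →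
      Summable fun i : ℕ × ℕ => x₁ ^ i.1 • (x₂ ^ i.2 • b i) := by
    intro x₁ x₂ h1 h2
    have := (h n x₁ x₂ h1 h2).1
    rwa [hterm] at this
  have hinner : ∀ (m : ℕ) (x₂ : ℂ), ‖x₂‖ < r → Summable fun j => x₂ ^ j • b (m, j) := by
    intro m x₂ h2
    -- A nonzero value of x₁ is used so that x₁ᵐ can be divided out of the m-th row of the double
    -- series.
    have hr2 : ((r / 2 : ℝ) : ℂ) ^ m ≠ 0 := pow_ne_zero _ (by exact_mod_cast (by positivity))
    have h3 := (hsum (r / 2 : ℝ) x₂ (by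
      rw [Complex.norm_real, Real.norm_eq_abs, abs_of_pos (by positivity)]
      linarith) h2).prod_factor m
    have h4 := h3.const_smul ((((r / 2 : ℝ) : ℂ) ^ m)⁻¹)
    simpa only [smul_smul, inv_mul_cancel₀ hr2, one_smul, inv_mul_cancel_left₀ hr2] using h4
  -- Cauchy's inequality is applied in x₁ with x₂ fixed, and afterwards in x₂ to the row just
  -- bounded.
  have houter : ∀ (m : ℕ) (x₂ : ℂ), ‖x₂‖ < r → ‖∑' j, x₂ ^ j • b (m, j)‖ * r ^ m ≤ K := by
    intro m x₂ h2
    refine norm_coeff_le_of_norm_tsum_le (b := fun m => ∑' j, x₂ ^ j • b (m, j)) hr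
      (fun x₁ h1 => ?_) m
    have h3 := hsum x₁ x₂ h1 h2
    have h4 : ∀ m, ∑' j, x₁ ^ m • (x₂ ^ j • b (m, j)) = x₁ ^ m • ∑' j, x₂ ^ j • b (m, j) :=
      fun m => (hinner m x₂ h2).tsum_const_smul _
    constructor
    · have := h3.prod
      simpa only [h4] using this
    · have h5 := (h n x₁ x₂ h1 h2).2
      rw [coeffFun, hterm, h3.tsum_prod] at h5
      simpa only [h4] using h5
  have hfin := norm_coeff_le_of_norm_tsum_le (b := fun j => b (i.1, j)) (K := K / r ^ i.1) hr
    (fun x₂ h2 => ⟨hinner i.1 x₂ h2, by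
      rw [le_div_iff₀ (by positivity)]
      exact houter i.1 x₂ h2⟩) i.2
  rw [le_div_iff₀ (by positivity)] at hfin
  simp only [hb, if_pos hi] at hfin
  linarith

/-- The exponent of `u` in `x₁ⁿ x₂ᵐ` at `(x₁ u^{s/(pk)}, x₂ u^{(1-s)/(qk)})`. -/
noncomputable def expo (p q : ℕ) (k s : ℝ) (i : ℕ × ℕ) : ℝ :=
  i.1 * (s / (p * k)) + i.2 * ((1 - s) / (q * k))

variable {p q : ℕ} {k s : ℝ} {y : ℂ × ℂ × ℝ}

theorem expo_nonneg (hk : 0 < k) (hs : 0 < s) (hs' : s < 1) (i : ℕ × ℕ) :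
    0 ≤ expo p q k s i := by
  have : 0 < 1 - s := by linarith
  unfold expo; positivity

/-- The monomial itself has exponent 1/k, whatever s is. This is why the Gevrey order in the
monomial matches Γ(1 + n/k) for every weight. -/
theorem expo_block (hp : 0 < p) (hq : 0 < q) (hk : 0 < k) (n : ℕ) (i : ℕ × ℕ) :
    expo p q k s (n * p + i.1, n * q + i.2) = n / k + expo p q k s i := by
  have hp' : (p : ℝ) ≠ 0 := by exact_mod_cast hp.ne'
  have hq' : (q : ℝ) ≠ 0 := by exact_mod_cast hq.ne'
  unfold expo
  push_cast
  field_simp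
  ring

theorem formalBorel_eq (hp : 0 < p) (hq : 0 < q) (hk : 0 < k) (a : ℕ × ℕ → E) (i : ℕ × ℕ) :
    formalBorel p q k s a i = ((Real.Gamma (1 + expo p q k s i))⁻¹ : ℂ) • a i := by
  have hp' : (p : ℝ) ≠ 0 := by exact_mod_cast hp.ne'
  have hq' : (q : ℝ) ≠ 0 := by exact_mod_cast hq.ne'
  unfold formalBorel expo
  congr 4
  field_simp
  ring

theorem pow_mul_pow_dil (ζ : ℂ) (i : ℕ × ℕ) :
    (dil p q k s ζ y).1 ^ i.1 * (dil p q k s ζ y).2.1 ^ i.2 =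
      Complex.exp (expo p q k s i * ζ) * (y.1 ^ i.1 * y.2.1 ^ i.2) := by
  simp only [dil, act, weightVec, mul_pow, ← Complex.exp_nat_mul]
  rw [mul_mul_mul_comm, ← Complex.exp_add, mul_comm]
  congr 2
  unfold expo
  push_cast
  ring

theorem pow_block (x₁ x₂ : ℂ) (n : ℕ) (i : ℕ × ℕ) :
    x₁ ^ (n * p + i.1) * x₂ ^ (n * q + i.2) = (x₁ ^ p * x₂ ^ q) ^ n * (x₁ ^ i.1 * x₂ ^ i.2) := by
  rw [pow_add, pow_add, mul_pow, mul_comm n p, mul_comm n q, pow_mul, pow_mul]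
  ring

variable {V : Type*} [NormedAddCommGroup V]

/-- The part of a double series over the exponents `(np+m, nq+j)` with `m < p` or `j < q`. -/
def blockTerm (p q : ℕ) (F : ℕ × ℕ → V) (n : ℕ) (i : ℕ × ℕ) : V :=
  if i.1 < p ∨ i.2 < q then F (n * p + i.1, n * q + i.2) else 0

theorem coeffTerm_smul (a : ℕ × ℕ → E) (n : ℕ) (x₁ x₂ : ℂ) (i : ℕ × ℕ) :
    (x₁ ^ p * x₂ ^ q) ^ n • coeffTerm p q a n x₁ x₂ i =
      blockTerm p q (fun i => (x₁ ^ i.1 * x₂ ^ i.2) • a i) n i := by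
  unfold coeffTerm blockTerm
  split_ifs
  · simp only [pow_block, smul_smul]
  · simp

theorem blockIndex_bijective (hp : 0 < p) (hq : 0 < q) :
    Function.Bijective (fun x : {x : ℕ × (ℕ × ℕ) | x.2.1 < p ∨ x.2.2 < q} =>
      ((x.1.1 * p + x.1.2.1, x.1.1 * q + x.1.2.2) : ℕ × ℕ)) := by
  have key : ∀ n n' m m' j j' : ℕ, m < p ∨ j < q → n * p + m = n' * p + m' →
      n * q + j = n' * q + j' → n' ≤ n := by
    intro n n' m m' j j' hmj h1 h2
    by_contra hlt
    push Not at hlt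
    obtain ⟨c, rfl⟩ := Nat.exists_eq_add_of_lt hlt
    have e1 : (n + c + 1) * p = n * p + c * p + p := by ring
    have e2 : (n + c + 1) * q = n * q + c * q + q := by ring
    rw [e1] at h1
    rw [e2] at h2
    rcases hmj with h | h
    · have := Nat.zero_le (c * p); omega
    · have := Nat.zero_le (c * q); omega
  constructor
  · rintro ⟨⟨n, m, j⟩, h⟩ ⟨⟨n', m', j'⟩, h'⟩ heq
    simp only [Prod.mk.injEq] at heq
    obtain ⟨h1, h2⟩ := heq
    have hn : n = n' := le_antisymm (key n' n m' m j' j h' h1.symm h2.symm)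
      (key n n' m m' j j' h h1 h2)
    subst hn
    simp only [Subtype.mk.injEq, Prod.mk.injEq, true_and]
    omega
  · rintro ⟨i, j⟩
    -- The largest number of copies of (p, q) that can be subtracted; the coordinate attaining the
    -- minimum leaves a remainder below p or q.
    set n := min (i / p) (j / q) with hn
    have h1 : n * p ≤ i :=
      (Nat.mul_le_mul_right p (min_le_left _ _)).trans (Nat.div_mul_le_self i p)
    have h2 : n * q ≤ j :=
      (Nat.mul_le_mul_right q (min_le_right _ _)).trans (Nat.div_mul_le_self j q)
    refine ⟨⟨(n, i - n * p, j - n * q), ?_⟩, ?_⟩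
    · rcases min_choice (i / p) (j / q) with h | h
      · left
        have h3 : n = i / p := by rw [hn, h]
        have := Nat.mod_lt i hp
        have e := Nat.div_add_mod i p
        simp only [h3]
        rw [mul_comm] at e
        omega
      · right
        have h3 : n = j / q := by rw [hn, h]
        have := Nat.mod_lt j hq
        have e := Nat.div_add_mod j q
        simp only [h3]
        rw [mul_comm] at e
        omega
    · simp only [Prod.mk.injEq]
      omega

theorem hasSum_blockTerm_iff (hp : 0 < p) (hq : 0 < q) {F : ℕ × ℕ → V} {S : V} :
    HasSum (fun x : ℕ × (ℕ × ℕ) => blockTerm p q F x.1 x.2) S ↔ HasSum F S := by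
  rw [← (Equiv.ofBijective _ (blockIndex_bijective hp hq)).hasSum_iff]
  have h := hasSum_subtype_iff_indicator (s := {x : ℕ × (ℕ × ℕ) | x.2.1 < p ∨ x.2.2 < q})
    (f := fun x : ℕ × (ℕ × ℕ) => F (x.1 * p + x.2.1, x.1 * q + x.2.2)) (a := S)
  refine Iff.trans ?_ h.symm
  refine iff_of_eq (congrArg (fun g => HasSum g S) ?_)
  funext x
  simp only [blockTerm, indicator]
  rfl

theorem hasSum_half_pow : HasSum (fun i : ℕ × ℕ => (1 / 2 : ℝ) ^ (i.1 + i.2)) 4 := by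
  have h := hasSum_geometric_two.mul hasSum_geometric_two
    (summable_mul_of_summable_norm hasSum_geometric_two.summable.norm
      hasSum_geometric_two.summable.norm)
  norm_num at h
  simpa only [pow_add, one_div, inv_pow] using h

theorem norm_blockTerm_le {F : ℕ × ℕ → V} {n : ℕ} {B : ℝ} (hB : 0 ≤ B)
    (h : ∀ i : ℕ × ℕ, i.1 < p ∨ i.2 < q →
      ‖F (n * p + i.1, n * q + i.2)‖ ≤ B * (1 / 2) ^ (i.1 + i.2)) (i : ℕ × ℕ) :
    ‖blockTerm p q F n i‖ ≤ B * (1 / 2) ^ (i.1 + i.2) := by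
  unfold blockTerm
  split_ifs with hi
  · exact h i hi
  · rw [norm_zero]; positivity

theorem summable_blockTerm [CompleteSpace V] {F : ℕ × ℕ → V} {n : ℕ} {B : ℝ} (hB : 0 ≤ B)
    (h : ∀ i : ℕ × ℕ, i.1 < p ∨ i.2 < q →
      ‖F (n * p + i.1, n * q + i.2)‖ ≤ B * (1 / 2) ^ (i.1 + i.2)) :
    Summable (blockTerm p q F n) ∧ ‖∑' i, blockTerm p q F n i‖ ≤ 4 * B := by
  have h1 : HasSum (fun i : ℕ × ℕ => B * (1 / 2 : ℝ) ^ (i.1 + i.2)) (B * 4) :=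
    hasSum_half_pow.mul_left B
  refine ⟨Summable.of_norm_bounded h1.summable (norm_blockTerm_le hB h), ?_⟩
  have := tsum_of_norm_bounded h1 (norm_blockTerm_le hB h)
  linarith

/-- The bound makes the family absolutely summable over pairs (block number, index in the block), so
it may be reindexed to the original double series and summed block by block. -/
theorem hasSum_blocks [CompleteSpace V] (hp : 0 < p) (hq : 0 < q) {F : ℕ × ℕ → V} {B x : ℝ}
    (hB : 0 ≤ B) (hx : 0 ≤ x) (hx1 : x < 1)
    (h : ∀ (n : ℕ) (i : ℕ × ℕ), i.1 < p ∨ i.2 < q →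
      ‖F (n * p + i.1, n * q + i.2)‖ ≤ B * x ^ n * (1 / 2) ^ (i.1 + i.2)) :
    Summable F ∧ HasSum (fun n => ∑' i, blockTerm p q F n i) (∑' i, F i) := by
  have hb : ∀ y : ℕ × (ℕ × ℕ), ‖blockTerm p q F y.1 y.2‖ ≤
      B * (x ^ y.1 * (1 / 2) ^ (y.2.1 + y.2.2)) := fun y => by
    rw [← mul_assoc]
    exact norm_blockTerm_le (by positivity) (h y.1) y.2
  have hs : Summable fun y : ℕ × (ℕ × ℕ) => blockTerm p q F y.1 y.2 := by
    have h1 : Summable fun y : ℕ × (ℕ × ℕ) => x ^ y.1 * (1 / 2 : ℝ) ^ (y.2.1 + y.2.2) :=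
      Summable.mul_of_nonneg (f := fun n : ℕ => x ^ n)
        (g := fun i : ℕ × ℕ => (1 / 2 : ℝ) ^ (i.1 + i.2)) (summable_geometric_of_lt_one hx hx1)
        hasSum_half_pow.summable (fun n => pow_nonneg hx n) (fun i => by positivity)
    exact Summable.of_norm_bounded (h1.mul_left B) hb
  have hF : HasSum F (∑' y : ℕ × (ℕ × ℕ), blockTerm p q F y.1 y.2) :=
    (hasSum_blockTerm_iff hp hq).1 hs.hasSum
  refine ⟨hF.summable, ?_⟩
  rw [hF.tsum_eq]
  exact hs.hasSum.prod_fiberwise fun n => (hs.prod_factor n).hasSum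

/-- The left-hand powers are at most Z^{expo} with Z = R_s(X₁, X₂), and
`rpow_mul_exp_neg_mul_Gamma_le` trades Z^{expo} for e^Z and a shift in the Gamma function. -/
theorem Gamma_block_le (hk : 0 < k) (hs : 0 < s) (hs' : s < 1) (hp : 0 < p) (hq : 0 < q)
    (n : ℕ) (i : ℕ × ℕ) {X₁ X₂ : ℝ} (h1 : 0 ≤ X₁) (h2 : 0 ≤ X₂) :
    X₁ ^ i.1 * X₂ ^ i.2 * Real.Gamma (1 + n / k) ≤
      Real.exp (X₁ ^ (p * k / s) + X₂ ^ (q * k / (1 - s))) *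
        Real.Gamma (1 + expo p q k s (n * p + i.1, n * q + i.2)) := by
  have hp' : (0 : ℝ) < p := by exact_mod_cast hp
  have hq' : (0 : ℝ) < q := by exact_mod_cast hq
  have hs1 : 0 < 1 - s := by linarith
  set Z₁ := X₁ ^ (p * k / s) with hZ1
  set Z₂ := X₂ ^ (q * k / (1 - s)) with hZ2
  have hZ1' : 0 ≤ Z₁ := by positivity
  have hZ2' : 0 ≤ Z₂ := by positivity
  have e1 : X₁ ^ i.1 = Z₁ ^ (i.1 * (s / (p * k))) := by
    rw [hZ1, ← Real.rpow_mul h1, ← Real.rpow_natCast]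
    congr 1
    field_simp
  have e2 : X₂ ^ i.2 = Z₂ ^ (i.2 * ((1 - s) / (q * k))) := by
    rw [hZ2, ← Real.rpow_mul h2, ← Real.rpow_natCast]
    congr 1
    field_simp
  have hle : X₁ ^ i.1 * X₂ ^ i.2 ≤ (Z₁ + Z₂) ^ expo p q k s i := by
    unfold expo
    rw [Real.rpow_add_of_nonneg (by positivity) (by positivity) (by positivity), e1, e2]
    gcongr <;> linarith
  have h := rpow_mul_exp_neg_mul_Gamma_le (a := n / k) (b := expo p q k s i) (Z := Z₁ + Z₂)
    (by positivity) (expo_nonneg hk hs hs' i) (by positivity)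
  rw [expo_block hp hq hk, ← add_assoc]
  have hG : 0 < Real.Gamma (1 + n / k) := Real.Gamma_pos_of_pos (by positivity)
  calc X₁ ^ i.1 * X₂ ^ i.2 * Real.Gamma (1 + n / k)
      ≤ (Z₁ + Z₂) ^ expo p q k s i * Real.Gamma (1 + n / k) := by gcongr
    _ = Real.exp (Z₁ + Z₂) *
        ((Z₁ + Z₂) ^ expo p q k s i * Real.exp (-(Z₁ + Z₂)) * Real.Gamma (1 + n / k)) := by
        rw [Real.exp_neg]
        have := Real.exp_pos (Z₁ + Z₂)
        field_simp
    _ ≤ _ := by gcongr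

/-- The terms of the formal Borel transform at `(x₁, x₂)`. -/
noncomputable def borelTerm (p q : ℕ) (k s : ℝ) (a : ℕ × ℕ → E) (x₁ x₂ : ℂ) (i : ℕ × ℕ) : E :=
  (x₁ ^ i.1 * x₂ ^ i.2) • formalBorel p q k s a i

/-- The bound holds at every point, not only near the origin: the Borel transform of each f_n is
entire of exponential growth, and only the sum over n needs the monomial to be small. -/
theorem exists_norm_borelTerm_le (hk : 0 < k) (hs : 0 < s) (hs' : s < 1) (hp : 0 < p) (hq : 0 < q)
    {a : ℕ × ℕ → E} {r C A : ℝ} (hr : 0 < r) (hC : 0 < C) (hA : 0 < A)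
    (h : ∀ (n : ℕ) (i : ℕ × ℕ), i.1 < p ∨ i.2 < q →
      ‖a (n * p + i.1, n * q + i.2)‖ * (r ^ i.1 * r ^ i.2) ≤
        C * A ^ n * (n.factorial : ℝ) ^ (1 / k)) :
    ∃ A' M : ℝ, 0 < A' ∧ 0 < M ∧ ∀ (y : ℂ × ℂ × ℝ) (n : ℕ) (i : ℕ × ℕ), i.1 < p ∨ i.2 < q →
      ‖borelTerm p q k s a y.1 y.2.1 (n * p + i.1, n * q + i.2)‖ ≤
        C * Real.exp (M * weightNorm p q k s y) * (A' * ‖y.1 ^ p * y.2.1 ^ q‖) ^ n *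
          (1 / 2) ^ (i.1 + i.2) := by
  have hp' : (0 : ℝ) < p := by exact_mod_cast hp
  have hq' : (0 : ℝ) < q := by exact_mod_cast hq
  have hs1 : 0 < 1 - s := by linarith
  set B := (Real.exp 1 * k) ^ (1 / k) with hB
  set M := (2 / r) ^ (p * k / s) + (2 / r) ^ (q * k / (1 - s)) with hM
  refine ⟨A * B, M, by positivity, by positivity, fun y n i hi => ?_⟩
  set g := Real.Gamma (1 + expo p q k s (n * p + i.1, n * q + i.2)) with hg
  set G := Real.Gamma (1 + n / k) with hG
  have hg0 : 0 < g := Real.Gamma_pos_of_pos (by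
    linarith [expo_nonneg (p := p) (q := q) hk hs hs' (n * p + i.1, n * q + i.2)])
  have hG0 : 0 < G := Real.Gamma_pos_of_pos (by positivity)
  -- The factor 1/r compensates the radius in the coefficient bound, and the factor 2 produces the
  -- summable (1/2)^{i₁+i₂}.
  have h1 := Gamma_block_le hk hs hs' hp hq n i (X₁ := 2 / r * ‖y.1‖) (X₂ := 2 / r * ‖y.2.1‖)
    (by positivity) (by positivity)
  have h2 : (2 / r * ‖y.1‖) ^ (p * k / s) + (2 / r * ‖y.2.1‖) ^ (q * k / (1 - s)) ≤
      M * weightNorm p q k s y := by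
    rw [Real.mul_rpow (by positivity) (by positivity),
      Real.mul_rpow (by positivity) (by positivity), hM, weightNorm]
    have t1 : 0 ≤ (2 / r) ^ (p * k / s) := by positivity
    have t2 : 0 ≤ (2 / r) ^ (q * k / (1 - s)) := by positivity
    have t3 : 0 ≤ ‖y.1‖ ^ (p * k / s) := by positivity
    have t4 : 0 ≤ ‖y.2.1‖ ^ (q * k / (1 - s)) := by positivity
    nlinarith
  have h3 := factorial_rpow_le_Gamma hk n
  have h4 := h n i hi
  set W := Real.exp (M * weightNorm p q k s y) with hW
  have hW1 : (2 / r * ‖y.1‖) ^ i.1 * (2 / r * ‖y.2.1‖) ^ i.2 * G ≤ W * g :=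
    h1.trans (by rw [hW]; gcongr)
  have h5 : (2 / r * ‖y.1‖) ^ i.1 * (2 / r * ‖y.2.1‖) ^ i.2 =
      2 ^ (i.1 + i.2) * (r ^ i.1 * r ^ i.2)⁻¹ * (‖y.1‖ ^ i.1 * ‖y.2.1‖ ^ i.2) := by
    rw [mul_pow, mul_pow, div_pow, div_pow, pow_add]
    field_simp
  have hR : 0 < r ^ i.1 * r ^ i.2 := by positivity
  set T := ‖y.1 ^ p * y.2.1 ^ q‖ ^ n with hT
  set Y := ‖y.1‖ ^ i.1 * ‖y.2.1‖ ^ i.2 with hY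
  have hY0 : 0 ≤ Y := by positivity
  have hT0 : 0 ≤ T := by positivity
  set α := ‖a (n * p + i.1, n * q + i.2)‖ with hα
  have h6 : α ≤ C * A ^ n * (B ^ n * G) * (r ^ i.1 * r ^ i.2)⁻¹ := by
    rw [← div_eq_mul_inv, le_div_iff₀ hR]
    refine h4.trans ?_
    gcongr
  have h7 : (r ^ i.1 * r ^ i.2)⁻¹ * Y * G ≤ (1 / 2) ^ (i.1 + i.2) * (W * g) := by
    rw [h5] at hW1
    calc (r ^ i.1 * r ^ i.2)⁻¹ * Y * G = (1 / 2) ^ (i.1 + i.2) *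
          (2 ^ (i.1 + i.2) * (r ^ i.1 * r ^ i.2)⁻¹ * Y * G) := by
          rw [one_div, inv_pow]; field_simp
      _ ≤ _ := by gcongr
  have hnorm : ‖borelTerm p q k s a y.1 y.2.1 (n * p + i.1, n * q + i.2)‖ = T * Y * (g⁻¹ * α) := by
    rw [borelTerm, formalBorel_eq hp hq hk, norm_smul, norm_smul, pow_block,
      norm_mul ((y.1 ^ p * y.2.1 ^ q) ^ n), norm_pow (y.1 ^ p * y.2.1 ^ q), ← Complex.ofReal_inv,
      Complex.norm_real, Real.norm_eq_abs, abs_of_pos (inv_pos.2 hg0), norm_mul (y.1 ^ i.1),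
      norm_pow, norm_pow]
  rw [hnorm]
  calc T * Y * (g⁻¹ * α) ≤ T * Y * (g⁻¹ * (C * A ^ n * (B ^ n * G) * (r ^ i.1 * r ^ i.2)⁻¹)) := by
        gcongr
    _ = T * (C * A ^ n * B ^ n) * g⁻¹ * ((r ^ i.1 * r ^ i.2)⁻¹ * Y * G) := by ring
    _ ≤ T * (C * A ^ n * B ^ n) * g⁻¹ * ((1 / 2) ^ (i.1 + i.2) * (W * g)) := by gcongr
    _ = C * W * (A ^ n * B ^ n * T) * (1 / 2) ^ (i.1 + i.2) := by field_simp
    _ = _ := by rw [hT, mul_pow, mul_pow]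

end MonomialSummability

namespace MonomialSummability
open MeasureTheory Set Filter Topology

variable {E : Type*} [NormedAddCommGroup E] [NormedSpace ℂ E]
variable {p q : ℕ} {k s : ℝ} {y : ℂ × ℂ × ℝ}

/-! ### From sums in the monomial to Borel sums -/

/-- A coefficient bound of Gevrey type. -/
def CoeffBound (p q : ℕ) (σ : ℝ) (a : ℕ × ℕ → E) (r C A : ℝ) : Prop :=
  0 < r ∧ 0 < C ∧ 0 < A ∧ ∀ (n : ℕ) (i : ℕ × ℕ), i.1 < p ∨ i.2 < q →
    ‖a (n * p + i.1, n * q + i.2)‖ * (r ^ i.1 * r ^ i.2) ≤ C * A ^ n * (n.factorial : ℝ) ^ σ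

theorem CoeffBound.norm_block_le {σ r C A : ℝ} {a : ℕ × ℕ → E} (h : CoeffBound p q σ a r C A)
    {x₁ x₂ : ℂ} (h1 : ‖x₁‖ ≤ r / 2) (h2 : ‖x₂‖ ≤ r / 2) (n : ℕ) (i : ℕ × ℕ)
    (hi : i.1 < p ∨ i.2 < q) :
    ‖(x₁ ^ i.1 * x₂ ^ i.2) • a (n * p + i.1, n * q + i.2)‖ ≤
      C * A ^ n * (n.factorial : ℝ) ^ σ * (1 / 2) ^ (i.1 + i.2) := by
  obtain ⟨hr, hC, hA, h⟩ := h
  have h3 := h n i hi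
  rw [norm_smul, norm_mul, norm_pow, norm_pow]
  calc ‖x₁‖ ^ i.1 * ‖x₂‖ ^ i.2 * ‖a (n * p + i.1, n * q + i.2)‖
      ≤ (r / 2) ^ i.1 * (r / 2) ^ i.2 * ‖a (n * p + i.1, n * q + i.2)‖ := by gcongr
    _ = ‖a (n * p + i.1, n * q + i.2)‖ * (r ^ i.1 * r ^ i.2) * (1 / 2) ^ (i.1 + i.2) := by
        rw [pow_add, div_pow, div_pow, div_pow, div_pow, one_pow, one_pow]
        ring
    _ ≤ _ := by gcongr

theorem CoeffBound.norm_coeffTerm_le {σ r C A : ℝ} {a : ℕ × ℕ → E}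
    (h : CoeffBound p q σ a r C A) {x₁ x₂ : ℂ} (h1 : ‖x₁‖ ≤ r / 2) (h2 : ‖x₂‖ ≤ r / 2) (n : ℕ)
    (i : ℕ × ℕ) : ‖coeffTerm p q a n x₁ x₂ i‖ ≤
      C * A ^ n * (n.factorial : ℝ) ^ σ * (1 / 2) ^ (i.1 + i.2) := by
  obtain ⟨hr, hC, hA, -⟩ := id h
  unfold coeffTerm
  split_ifs with hi
  · exact h.norm_block_le h1 h2 n i hi
  · rw [norm_zero]; positivity

theorem CoeffBound.summable_coeffTerm [CompleteSpace E] {σ r C A : ℝ} {a : ℕ × ℕ → E}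
    (h : CoeffBound p q σ a r C A) {x₁ x₂ : ℂ} (h1 : ‖x₁‖ ≤ r / 2) (h2 : ‖x₂‖ ≤ r / 2) (n : ℕ) :
    Summable (coeffTerm p q a n x₁ x₂) ∧
      ‖coeffFun p q a n x₁ x₂‖ ≤ 4 * (C * A ^ n * (n.factorial : ℝ) ^ σ) := by
  have hle := h.norm_coeffTerm_le h1 h2 n
  have hs := hasSum_half_pow.mul_left (C * A ^ n * (n.factorial : ℝ) ^ σ)
  refine ⟨Summable.of_norm_bounded hs.summable hle, ?_⟩
  have := tsum_of_norm_bounded hs hle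
  rw [coeffFun]
  linarith

/-- Along an orbit a block is an exponential series in ζ, the form in which Hankel's formula and the
Laplace integral act termwise. -/
theorem smul_coeffFun_dil [CompleteSpace E] {σ r C A : ℝ} {a : ℕ × ℕ → E}
    (h : CoeffBound p q σ a r C A) {ζ : ℂ}
    (h1 : ‖(dil p q k s ζ y).1‖ ≤ r / 2) (h2 : ‖(dil p q k s ζ y).2.1‖ ≤ r / 2) (n : ℕ) :
    ((dil p q k s ζ y).1 ^ p * (dil p q k s ζ y).2.1 ^ q) ^ n •
        coeffFun p q a n (dil p q k s ζ y).1 (dil p q k s ζ y).2.1 =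
      ∑' i : ℕ × ℕ, Complex.exp (expo p q k s (n * p + i.1, n * q + i.2) * ζ) •
        blockTerm p q (fun i => (y.1 ^ i.1 * y.2.1 ^ i.2) • a i) n i := by
  rw [coeffFun, ← (h.summable_coeffTerm h1 h2 n).1.tsum_const_smul]
  refine tsum_congr fun i => ?_
  rw [coeffTerm_smul]
  unfold blockTerm
  split_ifs
  · beta_reduce
    rw [smul_smul, pow_mul_pow_dil ζ (n * p + i.1, n * q + i.2)]
  · simp

theorem norm_blockTerm_mul_exp {a : ℕ × ℕ → E} (n : ℕ) (i : ℕ × ℕ) (R : ℝ) :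
    ‖blockTerm p q (fun i => (y.1 ^ i.1 * y.2.1 ^ i.2) • a i) n i‖ *
      Real.exp (expo p q k s (n * p + i.1, n * q + i.2) * R) =
    ‖((dil p q k s R y).1 ^ p * (dil p q k s R y).2.1 ^ q) ^ n •
      coeffTerm p q a n (dil p q k s R y).1 (dil p q k s R y).2.1 i‖ := by
  rw [coeffTerm_smul]
  unfold blockTerm
  split_ifs
  · beta_reduce
    rw [pow_mul_pow_dil (R : ℂ) (n * p + i.1, n * q + i.2), mul_smul (Complex.exp _),
      norm_smul (Complex.exp _),
      Complex.norm_exp, mul_comm]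
    simp
  · simp

theorem CoeffBound.summable_norm_blockTerm_mul_exp {σ r C A R : ℝ} {a : ℕ × ℕ → E}
    (h : CoeffBound p q σ a r C A) (h1 : ‖(dil p q k s R y).1‖ ≤ r / 2)
    (h2 : ‖(dil p q k s R y).2.1‖ ≤ r / 2) (n : ℕ) :
    Summable fun i : ℕ × ℕ => ‖blockTerm p q (fun i => (y.1 ^ i.1 * y.2.1 ^ i.2) • a i) n i‖ *
      Real.exp (expo p q k s (n * p + i.1, n * q + i.2) * R) := by
  simp_rw [norm_blockTerm_mul_exp, norm_smul]
  refine Summable.mul_left _ (Summable.of_nonneg_of_le (fun i => norm_nonneg _)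
    (h.norm_coeffTerm_le h1 h2 n) ?_)
  exact (hasSum_half_pow.mul_left _).summable

theorem norm_dil_le_of_re_le (hk : 0 < k) (hs : 0 < s) (hs' : s < 1) {ζ ζ' : ℂ}
    (h : ζ.re ≤ ζ'.re) : ‖(dil p q k s ζ y).1‖ ≤ ‖(dil p q k s ζ' y).1‖ ∧
      ‖(dil p q k s ζ y).2.1‖ ≤ ‖(dil p q k s ζ' y).2.1‖ := by
  have : 0 < 1 - s := by linarith
  rw [norm_dil_fst, norm_dil_fst, norm_dil_snd, norm_dil_snd]
  constructor <;> gcongr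

theorem hankel_block [CompleteSpace E] (hk : 0 < k) (hs : 0 < s) (hs' : s < 1) (hp : 0 < p)
    (hq : 0 < q) {σ r C A : ℝ} {a : ℕ × ℕ → E} (h : CoeffBound p q σ a r C A) {η R : ℝ}
    (hη : Real.pi / 2 < η) (hη' : η < Real.pi)
    (h1 : ‖(dil p q k s (-R : ℝ) y).1‖ ≤ r / 2) (h2 : ‖(dil p q k s (-R : ℝ) y).2.1‖ ≤ r / 2)
    (n : ℕ) :
    let g : ℂ → E := fun τ => ((dil p q k s (-τ) y).1 ^ p * (dil p q k s (-τ) y).2.1 ^ q) ^ n •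
        coeffFun p q a n (dil p q k s (-τ) y).1 (dil p q k s (-τ) y).2.1
    ContinuousOn g (Ici R ×ℂ Icc (-η) η) ∧ (∃ K, ∀ τ ∈ Ici R ×ℂ Icc (-η) η, ‖g τ‖ ≤ K) ∧
      hankel η R g = ∑' i, blockTerm p q (borelTerm p q k s a y.1 y.2.1) n i := by
  intro g
  set e : ℕ × ℕ → ℝ := fun i => expo p q k s (n * p + i.1, n * q + i.2) with he
  set c : ℕ × ℕ → E := blockTerm p q (fun i => (y.1 ^ i.1 * y.2.1 ^ i.2) • a i) n with hc
  have he0 : ∀ i, 0 ≤ e i := fun i => expo_nonneg hk hs hs' _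
  have hsum : Summable fun i => ‖c i‖ * Real.exp (-e i * R) := by
    simpa only [mul_neg, ← neg_mul] using h.summable_norm_blockTerm_mul_exp h1 h2 n
  have hterm : ∀ τ ∈ Ici R ×ℂ Icc (-η) η, ∀ i,
      ‖Complex.exp (-e i * τ) • c i‖ ≤ ‖c i‖ * Real.exp (-e i * R) := by
    intro τ hτ i
    have hτ1 : R ≤ τ.re := hτ.1
    rw [norm_smul, Complex.norm_exp, mul_comm]
    have h3 : (-e i * τ : ℂ).re = -e i * τ.re := by simp
    rw [h3]
    have h4 : -e i * τ.re ≤ -e i * R := by nlinarith [he0 i]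
    gcongr
  have hg : ∀ τ ∈ Ici R ×ℂ Icc (-η) η, g τ = ∑' i, Complex.exp (-e i * τ) • c i := by
    intro τ hτ
    have hτ1 : R ≤ τ.re := hτ.1
    have hle := norm_dil_le_of_re_le (p := p) (q := q) (y := y) hk hs hs' (ζ := -τ)
      (ζ' := (-R : ℝ)) (by simpa using hτ1)
    have := smul_coeffFun_dil h (hle.1.trans h1) (hle.2.trans h2) n
    simp only [mul_neg, ← neg_mul] at this
    exact this
  refine ⟨?_, ⟨∑' i, ‖c i‖ * Real.exp (-e i * R), fun τ hτ => ?_⟩, ?_⟩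
  · refine ContinuousOn.congr ?_ hg
    refine continuousOn_tsum (fun i => Continuous.continuousOn (by fun_prop)) hsum
      fun i τ hτ => hterm τ hτ i
  · rw [hg τ hτ]
    exact tsum_of_norm_bounded hsum.hasSum (hterm τ hτ)
  · have h3 := hasSum_hankel hη hη' he0 hsum
    have h4 : hankel η R g = hankel η R (fun τ => ∑' i, Complex.exp (-e i * τ) • c i) := by
      unfold hankel
      congr 1
      refine halfStripIntegral_congr (by linarith [Real.pi_pos]) fun τ hτ _ => ?_
      rw [hg τ hτ]
    rw [h4, ← h3.tsum_eq]
    refine tsum_congr fun i => ?_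
    simp only [hc, he, blockTerm]
    split_ifs
    · rw [borelTerm, formalBorel_eq hp hq hk, smul_comm]
    · simp

theorem hankel_sub_blocks [CompleteSpace E] (hk : 0 < k) (hs : 0 < s) (hs' : s < 1) (hp : 0 < p)
    (hq : 0 < q) {σ r C A K : ℝ} {a : ℕ × ℕ → E} (h : CoeffBound p q σ a r C A) {η R : ℝ}
    (hη : Real.pi / 2 < η) (hη' : η < Real.pi)
    (h1 : ‖(dil p q k s (-R : ℝ) y).1‖ ≤ r / 2) (h2 : ‖(dil p q k s (-R : ℝ) y).2.1‖ ≤ r / 2)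
    {F : ℂ → E} (hF : ContinuousOn F (Ici R ×ℂ Icc (-η) η))
    (hK : ∀ τ ∈ Ici R ×ℂ Icc (-η) η, ‖F τ‖ ≤ K) (N : ℕ) :
    hankel η R (fun τ => F τ - ∑ n ∈ Finset.range N,
        ((dil p q k s (-τ) y).1 ^ p * (dil p q k s (-τ) y).2.1 ^ q) ^ n •
          coeffFun p q a n (dil p q k s (-τ) y).1 (dil p q k s (-τ) y).2.1) =
      hankel η R F - ∑ n ∈ Finset.range N,
        ∑' i, blockTerm p q (borelTerm p q k s a y.1 y.2.1) n i := by
  have hη0 : 0 ≤ η := by linarith [Real.pi_pos]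
  have hcos : Real.cos η < 0 := Real.cos_neg_of_pi_div_two_lt_of_lt hη (by linarith)
  have hblock := hankel_block hk hs hs' hp hq h hη hη' h1 h2
  set g : ℕ → ℂ → E := fun n τ =>
    ((dil p q k s (-τ) y).1 ^ p * (dil p q k s (-τ) y).2.1 ^ q) ^ n •
      coeffFun p q a n (dil p q k s (-τ) y).1 (dil p q k s (-τ) y).2.1 with hg
  change hankel η R (fun τ => F τ - ∑ n ∈ Finset.range N, g n τ) = _
  -- Continuity and boundedness are carried through the induction, since additivity of the Hankel
  -- integral requires them at each step.
  suffices H : ContinuousOn (fun τ => F τ - ∑ n ∈ Finset.range N, g n τ) (Ici R ×ℂ Icc (-η) η) ∧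
      (∃ K', ∀ τ ∈ Ici R ×ℂ Icc (-η) η, ‖F τ - ∑ n ∈ Finset.range N, g n τ‖ ≤ K') ∧
      hankel η R (fun τ => F τ - ∑ n ∈ Finset.range N, g n τ) =
        hankel η R F - ∑ n ∈ Finset.range N,
          ∑' i, blockTerm p q (borelTerm p q k s a y.1 y.2.1) n i from H.2.2
  induction N with
  | zero => exact ⟨by simpa using hF, ⟨K, by simpa using hK⟩, by simp⟩
  | succ N ih =>
    obtain ⟨ih1, ⟨K', ih2⟩, ih3⟩ := ih
    obtain ⟨b1, ⟨K'', b2⟩, b3⟩ := hblock N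
    simp only [Finset.sum_range_succ, ← sub_sub]
    refine ⟨ih1.sub b1, ⟨K' + K'', fun τ hτ => norm_sub_le_of_le (ih2 τ hτ) (b2 τ hτ)⟩, ?_⟩
    rw [hankel_sub hη0 hcos ih1 ih2 b1 b2, ih3, b3]

end MonomialSummability

/-! ### The Borel transform of a function on a monomial sector. -/

namespace MonomialSummability
open MeasureTheory Set Filter Topology

variable {E : Type*} [NormedAddCommGroup E] [NormedSpace ℂ E]
variable {p q : ℕ} {k s : ℝ} {y : ℂ × ℂ × ℝ}

theorem exists_radius (p q : ℕ) {r ρ₀ : ℝ} (hr : 0 < r) (hρ₀ : 0 < ρ₀) :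
    ∃ ρ : ℝ, 0 < ρ ∧ ρ < ρ₀ ∧ (∀ x : ℝ, 0 ≤ x → x ^ p < ρ → x ≤ r) ∧
      ∀ x : ℝ, 0 ≤ x → x ^ q < ρ → x ≤ r := by
  refine ⟨min (ρ₀ / 2) (min (r ^ p) (r ^ q)), by positivity,
    (min_le_left _ _).trans_lt (by linarith), fun x hx h => ?_, fun x hx h => ?_⟩
  · exact (lt_of_pow_lt_pow_left₀ p hr.le
      (h.trans_le ((min_le_right _ _).trans (min_le_left _ _)))).le
  · exact (lt_of_pow_lt_pow_left₀ q hr.le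
      (h.trans_le ((min_le_right _ _).trans (min_le_right _ _)))).le

theorem HasGevreyExpansion.exists_bound {σ : ℝ} {a : ℕ × ℕ → E} {α β r : ℝ} {f : ℂ × ℂ × ℝ → E}
    (h : HasGevreyExpansion p q σ a α β r f) {α' β' r₀ : ℝ}
    (h1 : α < α') (h2 : α' < β') (h3 : β' < β) (hr₀ : 0 < r₀) :
    ∃ ρ C A : ℝ, 0 < ρ ∧ ρ < r ∧ 0 < C ∧ 0 < A ∧ (∀ x : ℝ, 0 ≤ x → x ^ p < ρ → x ≤ r₀) ∧
      (∀ x : ℝ, 0 ≤ x → x ^ q < ρ → x ≤ r₀) ∧ ∀ N : ℕ, ∀ y ∈ boundedSector p q α' β' ρ,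
        ‖f y - ∑ n ∈ Finset.range N, (y.1 ^ p * y.2.1 ^ q) ^ n • coeffFun p q a n y.1 y.2.1‖
          ≤ C * A ^ N * (N.factorial : ℝ) ^ σ * ‖y.1 ^ p * y.2.1 ^ q‖ ^ N := by
  obtain ⟨r', hr', hr'r, -, hexp⟩ := h
  obtain ⟨ρ, hρ, hρr, hx1, hx2⟩ := exists_radius p q hr₀ hr'
  obtain ⟨C, A, hC, hA, hb⟩ := hexp α' β' ρ h1 h2 h3 hρ hρr
  exact ⟨ρ, C, A, hρ, hρr.trans_le hr'r, hC, hA, hx1, hx2, hb⟩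

theorem boundedSector_mono {α β r α' β' r' : ℝ} (h1 : α ≤ α') (h2 : β' ≤ β) (h3 : r' ≤ r) :
    boundedSector p q α' β' r' ⊆ boundedSector p q α β r := by
  rintro y ⟨⟨hy, ha, hb⟩, hr1, hr2⟩
  exact ⟨⟨hy, h1.trans_lt ha, hb.trans_le h2⟩, hr1.trans_le h3, hr2.trans_le h3⟩

/-- The condition on `R` under which the points `(x₁ e^{-sτ/(pk)}, x₂ e^{-(1-s)τ/(qk)})` with
`Re τ ≥ R` lie in the domain of radius `ρ`. -/
def ContourAdmissible (p q : ℕ) (k s ρ : ℝ) (y : ℂ × ℂ × ℝ) (R : ℝ) : Prop :=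
  ‖(dil p q k s (-R : ℝ) y).1‖ ^ p < ρ ∧ ‖(dil p q k s (-R : ℝ) y).2.1‖ ^ q < ρ

theorem contourAdmissible_iff (hp : 0 < p) (hq : 0 < q) {ρ R : ℝ} :
    ContourAdmissible p q k s ρ y R ↔
      ‖y.1‖ ^ p * Real.exp (-(s / k * R)) < ρ ∧
        ‖y.2.1‖ ^ q * Real.exp (-((1 - s) / k * R)) < ρ := by
  unfold ContourAdmissible
  rw [norm_dil_fst_pow hp, norm_dil_snd_pow hq]
  simp

theorem ContourAdmissible.mono (hk : 0 < k) (hs : 0 < s) (hs' : s < 1) {ρ R R' : ℝ}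
    (h : ContourAdmissible p q k s ρ y R) (hR : R ≤ R') : ContourAdmissible p q k s ρ y R' := by
  have hle := norm_dil_le_of_re_le (p := p) (q := q) (y := y) hk hs hs' (ζ := (-R' : ℝ))
      (ζ' := (-R : ℝ)) (by simpa using hR)
  exact ⟨(pow_le_pow_left₀ (norm_nonneg _) hle.1 p).trans_lt h.1,
    (pow_le_pow_left₀ (norm_nonneg _) hle.2 q).trans_lt h.2⟩

theorem ContourAdmissible.dil_mem (hp : 0 < p) (hq : 0 < q) (hk : 0 < k) (hs : 0 < s)
    (hs' : s < 1) {ρ R η α β : ℝ} (h : ContourAdmissible p q k s ρ y R) (hy : y ∈ surface p q)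
    (hα : α < y.2.2 - η / k) (hβ : y.2.2 + η / k < β) {τ : ℂ} (hτ : τ ∈ Ici R ×ℂ Icc (-η) η) :
    dil p q k s (-τ) y ∈ boundedSector p q α β ρ := by
  have hR : R ≤ τ.re := hτ.1
  have him : τ.im ∈ Icc (-η) η := hτ.2
  have hle := norm_dil_le_of_re_le (p := p) (q := q) (y := y) hk hs hs' (ζ := -τ)
      (ζ' := (-R : ℝ)) (by simpa using hR)
  have h1 : τ.im / k ≤ η / k := by gcongr; exact him.2
  have h2 : -(η / k) ≤ τ.im / k := by
    rw [← neg_div]; gcongr; exact him.1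
  refine ⟨dil_mem_sector hp hq hy ?_ ?_,
    (pow_le_pow_left₀ (norm_nonneg _) hle.1 p).trans_lt h.1,
    (pow_le_pow_left₀ (norm_nonneg _) hle.2 q).trans_lt h.2⟩
  · rw [Complex.neg_im, neg_div]; linarith
  · rw [Complex.neg_im, neg_div]; linarith

/-- A constant `c` such that `e^R = 1 + c R_s(x₁, x₂)` is admissible. -/
noncomputable def contourConst (k s ρ : ℝ) : ℝ := ρ⁻¹ ^ (k / s) + ρ⁻¹ ^ (k / (1 - s))

theorem contourConst_pos {ρ : ℝ} (hρ : 0 < ρ) : 0 < contourConst k s ρ := by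
  unfold contourConst; positivity

/-- Raised to the powers k/s and k/(1-s), the admissibility conditions are lower bounds for e^R
linear in |x₁|^{pk/s} and |x₂|^{qk/(1-s)}. The summand 1 makes them strict and also ensures R ≥ 0.
-/
theorem contourAdmissible_log (hp : 0 < p) (hq : 0 < q) (hk : 0 < k) (hs : 0 < s) (hs' : s < 1)
    {ρ : ℝ} (hρ : 0 < ρ) :
    ContourAdmissible p q k s ρ y (Real.log (1 + contourConst k s ρ * weightNorm p q k s y)) := by
  have hs1 : 0 < 1 - s := by linarith
  have hp' : (0 : ℝ) < p := by exact_mod_cast hp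
  have hq' : (0 : ℝ) < q := by exact_mod_cast hq
  set B := 1 + contourConst k s ρ * weightNorm p q k s y with hB
  have hc := contourConst_pos (k := k) (s := s) hρ
  have hw := weightNorm_nonneg (p := p) (q := q) (k := k) (s := s) (y := y)
  have hB0 : 0 < B := by positivity
  have key : ∀ (t : ℝ) (m : ℕ) (x : ℝ), 0 < t → 0 < m → 0 ≤ x →
      ρ⁻¹ ^ (k / t) * x ^ (m * k / t) < B → x ^ m * Real.exp (-(t / k * Real.log B)) < ρ := by
    intro t m x ht hm hx h
    have e1 : ρ⁻¹ ^ (k / t) * x ^ (m * k / t) = (ρ⁻¹ * x ^ m) ^ (k / t) := by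
      rw [Real.mul_rpow (by positivity) (by positivity), ← Real.rpow_natCast, ← Real.rpow_mul hx]
      congr 2
      ring
    rw [e1] at h
    have h2 := Real.rpow_lt_rpow (by positivity) h (show 0 < t / k by positivity)
    rw [← Real.rpow_mul (by positivity), show k / t * (t / k) = 1 by field_simp,
      Real.rpow_one] at h2
    rw [Real.exp_neg, ← div_eq_mul_inv, div_lt_iff₀ (Real.exp_pos _), mul_comm (t / k),
      ← Real.rpow_def_of_pos hB0]
    rwa [inv_mul_lt_iff₀ hρ] at h2
  rw [contourAdmissible_iff hp hq]
  have t1 : 0 ≤ ρ⁻¹ ^ (k / s) := by positivity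
  have t2 : 0 ≤ ρ⁻¹ ^ (k / (1 - s)) := by positivity
  have t3 : 0 ≤ ‖y.1‖ ^ (p * k / s) := by positivity
  have t4 : 0 ≤ ‖y.2.1‖ ^ (q * k / (1 - s)) := by positivity
  constructor
  · refine key s p _ hs hp (norm_nonneg _) ?_
    rw [hB, contourConst, weightNorm]
    nlinarith [mul_nonneg t1 t4, mul_nonneg t2 t3, mul_nonneg t2 t4]
  · refine key (1 - s) q _ hs1 hq (norm_nonneg _) ?_
    rw [hB, contourConst, weightNorm]
    nlinarith [mul_nonneg t1 t4, mul_nonneg t2 t3, mul_nonneg t1 t3]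

/-- The Borel transform of a function `f` on a sector of radius `ρ`. -/
noncomputable def borelTransform (p q : ℕ) (k s η ρ : ℝ) (f : ℂ × ℂ × ℝ → E)
    (y : ℂ × ℂ × ℝ) : E :=
  hankel η (Real.log (1 + contourConst k s ρ * weightNorm p q k s y))
    (fun τ => f (dil p q k s (-τ) y))

section

variable {η ρ α β K : ℝ} {f : ℂ × ℂ × ℝ → E}

theorem differentiableOn_dil_neg (hp : 0 < p) (hq : 0 < q) (hk : 0 < k) (hs : 0 < s)
    (hs' : s < 1) (hf : IsHolomorphicOn p q f (boundedSector p q α β ρ)) {R : ℝ}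
    (hR : ContourAdmissible p q k s ρ y R) (hy : y ∈ sector p q (α + η / k) (β - η / k)) :
    DifferentiableOn ℂ (fun τ => f (dil p q k s (-τ) y)) (Ici R ×ℂ Icc (-η) η) := by
  intro τ hτ
  have hmem : dil p q k s (-τ) y ∈ boundedSector p q α β ρ := hR.dil_mem hp hq hk hs hs' hy.1
    (by linarith [hy.2.1]) (by linarith [hy.2.2]) hτ
  exact ((hf.differentiableAt_dil (isActOpen_boundedSector α β ρ).1 hmem).comp τ
    (f := fun τ : ℂ => -τ) (by fun_prop)).differentiableWithinAt

/-- The left edge chosen in the definition suits the growth estimate; freedom in choosing it is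
needed for holomorphy and for comparison with the formal series. -/
theorem borelTransform_eq (hp : 0 < p) (hq : 0 < q) (hk : 0 < k) (hs : 0 < s)
    (hs' : s < 1) (hη0 : 0 ≤ η) (hcos : Real.cos η < 0) (hρ : 0 < ρ)
    (hf : IsHolomorphicOn p q f (boundedSector p q α β ρ))
    (hK : ∀ y ∈ boundedSector p q α β ρ, ‖f y‖ ≤ K) {R : ℝ}
    (hR : ContourAdmissible p q k s ρ y R) (hy : y ∈ sector p q (α + η / k) (β - η / k)) :
    borelTransform p q k s η ρ f y = hankel η R (fun τ => f (dil p q k s (-τ) y)) := by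
  have key : ∀ R R' : ℝ, ContourAdmissible p q k s ρ y R → R ≤ R' →
      hankel η R (fun τ => f (dil p q k s (-τ) y)) =
        hankel η R' (fun τ => f (dil p q k s (-τ) y)) := by
    intro R R' h hle
    refine hankel_eq_of_le hη0 hcos hle (K := K)
      (differentiableOn_dil_neg hp hq hk hs hs' hf h hy) fun τ hτ => hK _ ?_
    exact h.dil_mem hp hq hk hs hs' hy.1 (by linarith [hy.2.1]) (by linarith [hy.2.2]) hτ
  unfold borelTransform
  rcases le_total (Real.log (1 + contourConst k s ρ * weightNorm p q k s y)) R with h | h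
  · exact key _ _ (contourAdmissible_log hp hq hk hs hs' hρ) h
  · exact (key _ _ hR h).symm

theorem norm_borelTransform_le (hp : 0 < p) (hq : 0 < q) (hk : 0 < k) (hs : 0 < s)
    (hs' : s < 1) (hη0 : 0 ≤ η) (hcos : Real.cos η < 0) (hρ : 0 < ρ)
    (hK : ∀ y ∈ boundedSector p q α β ρ, ‖f y‖ ≤ K)
    (hy : y ∈ sector p q (α + η / k) (β - η / k)) :
    ‖borelTransform p q k s η ρ f y‖ ≤ (2 * (-Real.cos η)⁻¹ + 2 * η) * K * Real.exp 1 *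
      Real.exp (contourConst k s ρ * weightNorm p q k s y) := by
  have hc := contourConst_pos (k := k) (s := s) hρ
  have hw := weightNorm_nonneg (p := p) (q := q) (k := k) (s := s) (y := y)
  have h := norm_hankel_le (K := K) hη0 hcos
    (R := Real.log (1 + contourConst k s ρ * weightNorm p q k s y))
    (F := fun τ => f (dil p q k s (-τ) y)) (Real.log_nonneg (by nlinarith)) fun τ hτ => hK _
      ((contourAdmissible_log hp hq hk hs hs' hρ).dil_mem hp hq hk hs hs' hy.1
        (by linarith [hy.2.1]) (by linarith [hy.2.2]) hτ)
  rw [Real.exp_log (by positivity), Real.exp_add, ← mul_assoc] at h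
  exact h

/-- The left edge in the definition depends on the moduli of the point, not holomorphically. Near a
given point it is frozen at its value there, which stays admissible. -/
theorem isHolomorphicOn_borelTransform [CompleteSpace E] (hp : 0 < p) (hq : 0 < q) (hk : 0 < k)
    (hs : 0 < s) (hs' : s < 1) (hη0 : 0 ≤ η) (hcos : Real.cos η < 0) (hρ : 0 < ρ)
    (hf : IsHolomorphicOn p q f (boundedSector p q α β ρ))
    (hK : ∀ y ∈ boundedSector p q α β ρ, ‖f y‖ ≤ K) :
    IsHolomorphicOn p q (borelTransform p q k s η ρ f) (sector p q (α + η / k) (β - η / k)) := by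
  have hopen := isActOpen_sector (p := p) (q := q) (α + η / k) (β - η / k)
  rw [isHolomorphicOn_iff hopen.1]
  intro y hy
  set R := Real.log (1 + contourConst k s ρ * weightNorm p q k s y) with hRdef
  have hR : ContourAdmissible p q k s ρ y R := contourAdmissible_log hp hq hk hs hs' hρ
  have hev1 := hopen.2 y hy
  have hev2 : ∀ᶠ w in 𝓝 (0 : ℂ × ℂ), ContourAdmissible p q k s ρ (act p q w y) R := by
    have hc : Continuous fun w : ℂ × ℂ => dil p q k s (-R : ℝ) (act p q w y) := by
      simp only [← act_dil]
      exact continuous_act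
    have hc1 : Continuous fun w : ℂ × ℂ => ‖(dil p q k s (-R : ℝ) (act p q w y)).1‖ ^ p := by
      fun_prop
    have hc2 : Continuous fun w : ℂ × ℂ => ‖(dil p q k s (-R : ℝ) (act p q w y)).2.1‖ ^ q := by
      fun_prop
    filter_upwards [hc1.continuousAt.eventually_lt continuousAt_const (by simpa using hR.1),
      hc2.continuousAt.eventually_lt continuousAt_const (by simpa using hR.2)] with w h1 h2
    exact ⟨h1, h2⟩
  obtain ⟨δ, hδ, hball⟩ := Metric.eventually_nhds_iff_ball.1 (hev1.and hev2)
  have hdiff : DifferentiableAt ℂ (fun w : ℂ × ℂ => hankel η R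
      (fun τ => f (dil p q k s (-τ) (act p q w y)))) 0 := by
    refine differentiableAt_hankel hη0 hcos hδ (K := K) (fun w hw => ?_) (fun w hw τ hτ => ?_)
      fun τ hτ w hw => ?_
    · exact (differentiableOn_dil_neg hp hq hk hs hs' hf (hball w hw).2 (hball w hw).1).continuousOn
    · have hm := (hball w hw).1
      exact hK _ ((hball w hw).2.dil_mem hp hq hk hs hs' hm.1 (by linarith [hm.2.1])
        (by linarith [hm.2.2]) hτ)
    · have hm := (hball w hw).1
      have hmem := (hball w hw).2.dil_mem hp hq hk hs hs' hm.1 (α := α) (β := β) (η := η)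
        (by linarith [hm.2.1]) (by linarith [hm.2.2]) hτ
      simp only [← act_dil] at hmem ⊢
      exact (hf.differentiableAt_act (isActOpen_boundedSector α β ρ).1
        hmem).differentiableWithinAt
  refine hdiff.congr_of_eventuallyEq ?_
  filter_upwards [hev1, hev2] with w h1 h2
  exact borelTransform_eq hp hq hk hs hs' hη0 hcos hρ hf hK h2 h1

end

/-- The N-th remainder is estimated on the contour with e^R = N. There N!^{1/k} ≤ N^{N/k} is
cancelled by the N-th power of the dilated monomial, and the kernel costs e^N, so the error is a
constant times (A₁ e t)^N. -/
theorem hasSum_borelTransform [CompleteSpace E] (hp : 0 < p) (hq : 0 < q) (hk : 0 < k) (hs : 0 < s)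
    (hs' : s < 1) {η ρ α β : ℝ} {f : ℂ × ℂ × ℝ → E} (hη : Real.pi / 2 < η) (hη' : η < Real.pi)
    (hρ : 0 < ρ) (hf : IsHolomorphicOn p q f (boundedSector p q α β ρ))
    {a : ℕ × ℕ → E} {r C A C₁ A₁ : ℝ} (hco : CoeffBound p q (1 / k) a r C A) (hC₁ : 0 < C₁)
    (hA₁ : 0 < A₁) (hx1 : ∀ x : ℝ, 0 ≤ x → x ^ p < ρ → x ≤ r / 2)
    (hx2 : ∀ x : ℝ, 0 ≤ x → x ^ q < ρ → x ≤ r / 2)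
    (hexp : ∀ N : ℕ, ∀ y ∈ boundedSector p q α β ρ,
        ‖f y - ∑ n ∈ Finset.range N, (y.1 ^ p * y.2.1 ^ q) ^ n • coeffFun p q a n y.1 y.2.1‖
          ≤ C₁ * A₁ ^ N * (N.factorial : ℝ) ^ (1 / k) * ‖y.1 ^ p * y.2.1 ^ q‖ ^ N) :
    ∃ r₂ : ℝ, 0 < r₂ ∧ ∀ y ∈ sector p q (α + η / k) (β - η / k), ‖y.1‖ < r₂ → ‖y.2.1‖ < r₂ →
      HasSum (borelTerm p q k s a y.1 y.2.1) (borelTransform p q k s η ρ f y) := by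
  have hη0 : 0 ≤ η := by linarith [Real.pi_pos]
  have hcos : Real.cos η < 0 := Real.cos_neg_of_pi_div_two_lt_of_lt hη (by linarith)
  obtain ⟨A', M, hA', hM, hterm⟩ := exists_norm_borelTerm_le hk hs hs' hp hq hco.1 hco.2.1
    hco.2.2.1 hco.2.2.2
  have hK : ∀ y ∈ boundedSector p q α β ρ, ‖f y‖ ≤ C₁ := fun y hy => by
    simpa using hexp 0 y hy
  -- The bound 1 lets the powers p and q be dropped, 1/A' gives convergence of the formal series,
  -- and 1/(A₁ e) convergence of the remainders to zero.
  refine ⟨min 1 (min (1 / A') (1 / (A₁ * Real.exp 1))), by positivity, fun y hy hy1 hy2 => ?_⟩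
  set t := ‖y.1 ^ p * y.2.1 ^ q‖ with ht
  have htlt : t < min (1 / A') (1 / (A₁ * Real.exp 1)) := by
    have h1 : ‖y.1‖ ^ p ≤ ‖y.1‖ :=
      pow_le_of_le_one (norm_nonneg _) (hy1.le.trans (min_le_left _ _)) hp.ne'
    have h2 : ‖y.2.1‖ ^ q ≤ 1 :=
      pow_le_one₀ (norm_nonneg _) (hy2.le.trans (min_le_left _ _))
    rw [ht, norm_mul, norm_pow, norm_pow]
    calc ‖y.1‖ ^ p * ‖y.2.1‖ ^ q ≤ ‖y.1‖ * 1 := by gcongr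
      _ < _ := by rw [mul_one]; exact hy1.trans_le (min_le_right _ _)
  have ht0 : 0 ≤ t := norm_nonneg _
  have ht1 : A' * t < 1 := by
    have := htlt.trans_le (min_le_left _ _)
    rw [lt_div_iff₀ hA'] at this
    linarith
  have ht2 : A₁ * Real.exp 1 * t < 1 := by
    have := htlt.trans_le (min_le_right _ _)
    rw [lt_div_iff₀ (by positivity)] at this
    linarith
  obtain ⟨hsum, hblocks⟩ := hasSum_blocks hp hq (F := borelTerm p q k s a y.1 y.2.1)
    (B := C * Real.exp (M * weightNorm p q k s y)) (x := A' * t)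
    (by have := hco.2.1; positivity) (by positivity) ht1 (hterm y)
  suffices h : Tendsto (fun N => ∑ n ∈ Finset.range N,
      ∑' i, blockTerm p q (borelTerm p q k s a y.1 y.2.1) n i) atTop
      (𝓝 (borelTransform p q k s η ρ f y)) by
    rw [tendsto_nhds_unique h hblocks.tendsto_sum_nat]
    exact hsum.hasSum
  have hgeom : Tendsto (fun N : ℕ => (2 * (-Real.cos η)⁻¹ + 2 * η) * C₁ *
      (A₁ * Real.exp 1 * t) ^ N) atTop (𝓝 0) := by
    simpa using (tendsto_pow_atTop_nhds_zero_of_lt_one (by positivity) ht2).const_mul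
      ((2 * (-Real.cos η)⁻¹ + 2 * η) * C₁)
  rw [tendsto_iff_norm_sub_tendsto_zero]
  refine squeeze_zero' (Eventually.of_forall fun _ => norm_nonneg _) ?_ hgeom
  set R₀ := Real.log (1 + contourConst k s ρ * weightNorm p q k s y) with hR₀
  have hR₀adm : ContourAdmissible p q k s ρ y R₀ := contourAdmissible_log hp hq hk hs hs' hρ
  have hlog : ∀ᶠ N : ℕ in atTop, R₀ ≤ Real.log N :=
    (Real.tendsto_log_atTop.comp tendsto_natCast_atTop_atTop).eventually_ge_atTop R₀
  filter_upwards [hlog, eventually_ge_atTop 1] with N hN hN1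
  have hNpos : (0 : ℝ) < N := by exact_mod_cast hN1
  have hadm := hR₀adm.mono hk hs hs' hN
  have hcont := (differentiableOn_dil_neg hp hq hk hs hs' hf hadm hy).continuousOn
  have hmem : ∀ τ ∈ Ici (Real.log N) ×ℂ Icc (-η) η,
      dil p q k s (-τ) y ∈ boundedSector p q α β ρ := fun τ hτ =>
    hadm.dil_mem hp hq hk hs hs' hy.1 (by linarith [hy.2.1]) (by linarith [hy.2.2]) hτ
  rw [norm_sub_rev, borelTransform_eq hp hq hk hs hs' hη0 hcos hρ hf hK hadm hy,
    ← hankel_sub_blocks hk hs hs' hp hq hco hη hη' (hx1 _ (norm_nonneg _) hadm.1)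
      (hx2 _ (norm_nonneg _) hadm.2) hcont (fun τ hτ => hK _ (hmem τ hτ)) N]
  have hbound := norm_hankel_le (K := C₁ * A₁ ^ N * t ^ N) hη0 hcos
    (R := Real.log N) (Real.log_nonneg (by exact_mod_cast hN1))
    (F := fun τ => f (dil p q k s (-τ) y) - ∑ n ∈ Finset.range N,
        ((dil p q k s (-τ) y).1 ^ p * (dil p q k s (-τ) y).2.1 ^ q) ^ n •
          coeffFun p q a n (dil p q k s (-τ) y).1 (dil p q k s (-τ) y).2.1) (fun τ hτ => by
      have hτ1 : Real.log N ≤ τ.re := hτ.1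
      refine (hexp N _ (hmem τ hτ)).trans ?_
      rw [norm_monomial_dil hp hq, ← ht, mul_pow, Complex.neg_re, ← Real.exp_nat_mul]
      have h1 : (N.factorial : ℝ) ^ (1 / k) * Real.exp (N * (-τ.re / k)) ≤ 1 := by
        have h2 : (N.factorial : ℝ) ^ (1 / k) ≤ Real.exp (N * (Real.log N / k)) := by
          have h3 : (N.factorial : ℝ) ≤ (N : ℝ) ^ N := by exact_mod_cast Nat.factorial_le_pow N
          have h4 : ((N : ℝ) ^ N) ^ (1 / k) = Real.exp (N * (Real.log N / k)) := by
            rw [Real.rpow_def_of_pos (by positivity), Real.log_pow]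
            congr 1
            ring
          rw [← h4]
          gcongr
        calc (N.factorial : ℝ) ^ (1 / k) * Real.exp (N * (-τ.re / k))
            ≤ Real.exp (N * (Real.log N / k)) * Real.exp (N * (-τ.re / k)) := by gcongr
          _ = Real.exp (N * ((Real.log N - τ.re) / k)) := by
              rw [← Real.exp_add]; congr 1; ring
          _ ≤ 1 := by
              rw [Real.exp_le_one_iff]
              exact mul_nonpos_of_nonneg_of_nonpos hNpos.le
                (div_nonpos_of_nonpos_of_nonneg (by linarith) hk.le)
      calc C₁ * A₁ ^ N * (N.factorial : ℝ) ^ (1 / k) * (t ^ N * Real.exp (N * (-τ.re / k)))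
          = C₁ * A₁ ^ N * t ^ N *
            ((N.factorial : ℝ) ^ (1 / k) * Real.exp (N * (-τ.re / k))) := by ring
        _ ≤ C₁ * A₁ ^ N * t ^ N * 1 := by gcongr
        _ = _ := mul_one _)
  refine hbound.trans (le_of_eq ?_)
  rw [Real.exp_log hNpos, mul_pow, mul_pow, ← Real.exp_nat_mul, mul_one]
  ring

/-- The contour uses up η/k of the arguments on each side; the surplus of the opening over π/k pays
for both η > π/2 and a sector of half-width ε. -/
theorem IsMonomialSum.isBorelSummable [CompleteSpace E] (hp : 0 < p) (hq : 0 < q) (hk : 0 < k)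
    (hs : 0 < s) (hs' : s < 1) {a : ℕ × ℕ → E} {d α β r : ℝ} {f : ℂ × ℂ × ℝ → E}
    (ha : IsMonomialGevrey p q (1 / k) a) (h : IsMonomialSum p q k a d α β r f) :
    IsBorelSummable p q k s a d := by
  obtain ⟨hd, hopen, hr, hhol, hexp⟩ := h
  obtain ⟨r₀, C, A, hco⟩ := ha.exists_norm_coeff_le
  have hco : CoeffBound p q (1 / k) a r₀ C A := hco
  have hπ := Real.pi_pos
  -- The first bound yields η/k + ε < (β - α)/2 for η = π/2 + δ and ε = δ/(2k); the second keeps η <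
  -- π.
  set δ : ℝ := min ((k * (β - α) - Real.pi) / 4) (Real.pi / 4) with hδ
  have hopen' : Real.pi < k * (β - α) := by
    rwa [div_lt_iff₀ hk, mul_comm] at hopen
  have hδ0 : 0 < δ := lt_min (by linarith) (by linarith)
  have hδ1 : 4 * δ ≤ k * (β - α) - Real.pi := by
    have : δ ≤ (k * (β - α) - Real.pi) / 4 := min_le_left _ _
    linarith
  have hδ2 : δ ≤ Real.pi / 4 := min_le_right _ _
  set η := Real.pi / 2 + δ with hη
  have hη1 : Real.pi / 2 < η := by linarith
  have hη2 : η < Real.pi := by linarith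
  have hη0 : 0 ≤ η := by linarith
  have hcos : Real.cos η < 0 := Real.cos_neg_of_pi_div_two_lt_of_lt hη1 (by linarith)
  set ε := δ / (2 * k) with hε
  have hε0 : 0 < ε := by positivity
  have hwidth : η / k + ε < (β - α) / 2 := by
    have h1 : η / k + ε = (η + δ / 2) / k := by rw [hε]; field_simp
    rw [h1, div_lt_iff₀ hk]
    linarith
  obtain ⟨ρ, C₁, A₁, hρ, hρr, hC₁, hA₁, hx1, hx2, hb⟩ := hexp.exists_bound
    (α' := d - ε - η / k) (β' := d + ε + η / k) (r₀ := r₀ / 2) (by linarith)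
    (by have : 0 ≤ η / k := by positivity
        linarith) (by linarith) (half_pos hco.1)
  have hf : IsHolomorphicOn p q f (boundedSector p q (d - ε - η / k) (d + ε + η / k) ρ) :=
    fun y hy => hhol y (boundedSector_mono (by linarith) (by linarith) hρr.le hy)
  have hK : ∀ y ∈ boundedSector p q (d - ε - η / k) (d + ε + η / k) ρ, ‖f y‖ ≤ C₁ :=
    fun y hy => by simpa using hb 0 y hy
  refine ⟨ε, borelTransform p q k s η ρ f, hε0, ?_, ?_, ?_⟩
  · have := isHolomorphicOn_borelTransform hp hq hk hs hs' hη0 hcos hρ hf hK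
    rwa [sub_add_cancel, add_sub_cancel_right] at this
  · have := hasSum_borelTransform hp hq hk hs hs' hη1 hη2 hρ hf hco hC₁ hA₁ hx1 hx2 hb
    rwa [sub_add_cancel, add_sub_cancel_right] at this
  · intro α' β' h1 h2 h3
    refine ⟨(2 * (-Real.cos η)⁻¹ + 2 * η) * C₁ * Real.exp 1, contourConst k s ρ, ?_,
      contourConst_pos hρ, fun y hy => ?_⟩
    · have : 0 < (-Real.cos η)⁻¹ := inv_pos.2 (by linarith)
      positivity
    · refine norm_borelTransform_le hp hq hk hs hs' hη0 hcos hρ hK ?_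
      rw [sub_add_cancel, add_sub_cancel_right]
      exact ⟨hy.1, h1.trans hy.2.1, hy.2.2.trans h3⟩

end MonomialSummability

namespace MonomialSummability
open MeasureTheory Set Filter Topology

variable {E : Type*} [NormedAddCommGroup E] [NormedSpace ℂ E]
variable {p q : ℕ} {k s : ℝ} {y : ℂ × ℂ × ℝ}

/-! ### Laplace integrals of exponential series -/

theorem integral_rpow_mul_exp_neg {e c : ℝ} (he : 0 ≤ e) (hc : 0 < c) :
    IntegrableOn (fun ρ : ℝ => ρ ^ e * Real.exp (-c * ρ)) (Ioi 0) ∧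
      ∫ ρ in Ioi (0 : ℝ), ρ ^ e * Real.exp (-c * ρ) = (1 / c) ^ (1 + e) * Real.Gamma (1 + e) := by
  have h := Real.integral_rpow_mul_exp_neg_mul_Ioi (a := 1 + e) (by positivity) hc
  simp only [add_sub_cancel_left, ← neg_mul] at h
  refine ⟨Integrable.of_integral_ne_zero ?_, h⟩
  rw [h]
  have := Real.Gamma_pos_of_pos (show 0 < 1 + e by positivity)
  positivity

theorem norm_exp_mul_log {e θ ρ : ℝ} (hρ : 0 < ρ) :
    ‖Complex.exp (e * (Real.log ρ + θ * Complex.I))‖ = ρ ^ e := by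
  rw [Complex.norm_exp, Real.rpow_def_of_pos hρ, Complex.re_ofReal_mul]
  congr 1
  simp [mul_comm]

theorem rayIntegral_exp {e θ : ℝ} (he : 0 ≤ e) (hθ : |θ| < Real.pi / 2) :
    rayIntegral θ (fun ζ => Complex.exp (e * ζ)) = (Real.Gamma (1 + e) : ℂ) := by
  have hcosθ : 0 < Real.cos θ := Real.cos_pos_of_mem_Ioo (abs_lt.1 hθ)
  have h0 : rayIntegral 0 (fun ζ => Complex.exp (e * ζ)) = (Real.Gamma (1 + e) : ℂ) := by
    unfold rayIntegral
    have : ∀ ρ ∈ Ioi (0 : ℝ), (Complex.exp (-(ρ * Complex.exp ((0 : ℝ) * Complex.I))) *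
        Complex.exp ((0 : ℝ) * Complex.I)) •
        Complex.exp (e * (Real.log ρ + (0 : ℝ) * Complex.I)) =
        ((Real.exp (-ρ) * ρ ^ (1 + e - 1) : ℝ) : ℂ) := by
      intro ρ (hρ : 0 < ρ)
      rw [add_sub_cancel_left, Real.rpow_def_of_pos hρ]
      push_cast
      simp [mul_comm]
    rw [setIntegral_congr_fun measurableSet_Ioi this, integral_complex_ofReal,
      Real.Gamma_eq_integral (by positivity)]
  -- A power of |u| is absorbed by e^{(cos θ/2)|u|}, leaving half of the decay of the kernel on
  -- every ray between 0 and θ.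
  have hbound : ∀ ζ : ℂ, ‖Complex.exp (e * ζ)‖ ≤
      ((Real.cos θ / 2) ^ e)⁻¹ * Real.Gamma (1 + e) *
        Real.exp (Real.cos θ / 2 * Real.exp ζ.re) := by
    intro ζ
    have h1 := rpow_le_exp_mul_Gamma (Z := Real.cos θ / 2 * Real.exp ζ.re) he (by positivity)
    rw [Real.mul_rpow (by positivity) (by positivity), ← Real.exp_mul] at h1
    rw [Complex.norm_exp, Complex.re_ofReal_mul, mul_comm e]
    have h2 : 0 < (Real.cos θ / 2) ^ e := by positivity
    rw [mul_assoc, ← div_eq_inv_mul, le_div_iff₀ h2]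
    linarith
  have hdiff : Differentiable ℂ fun ζ : ℂ => Complex.exp (e * ζ) := by fun_prop
  rw [← h0]
  rcases le_total 0 θ with h | h
  · refine (rayIntegral_eq_of_le h (c := Real.cos θ) (m := Real.cos θ / 2) (by linarith) ?_
      hdiff.differentiableOn fun ζ _ => hbound ζ).symm
    intro x hx
    rw [abs_of_nonneg h] at hθ
    exact Real.cos_le_cos_of_nonneg_of_le_pi hx.1 (by linarith [Real.pi_pos]) hx.2
  · refine rayIntegral_eq_of_le h (c := Real.cos θ) (m := Real.cos θ / 2) (by linarith) ?_
      hdiff.differentiableOn fun ζ _ => hbound ζ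
    intro x hx
    rw [abs_of_nonpos h] at hθ
    rw [← Real.cos_neg θ, ← Real.cos_neg x]
    exact Real.cos_le_cos_of_nonneg_of_le_pi (by linarith [hx.2]) (by linarith [Real.pi_pos])
      (by linarith [hx.1])

/-- The integral of the norm of the i-th term carries the factor (1/cos θ)^{e i}, so termwise
integration needs convergence at the point enlarged by u = 1/cos θ. -/
theorem hasSum_rayIntegral [CompleteSpace E] {ι : Type*} [Countable ι] {θ : ℝ}
    (hθ : |θ| < Real.pi / 2) {c : ι → E} {e : ι → ℝ} (he : ∀ i, 0 ≤ e i)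
    (hc : Summable fun i => ‖c i‖ * (1 / Real.cos θ) ^ e i) :
    HasSum c (rayIntegral θ (fun ζ => ∑' i, Complex.exp (e i * ζ) •
      (((Real.Gamma (1 + e i))⁻¹ : ℂ) • c i))) := by
  have hcosθ : 0 < Real.cos θ := Real.cos_pos_of_mem_Ioo (abs_lt.1 hθ)
  have hΓ : ∀ i, 0 < Real.Gamma (1 + e i) := fun i =>
    Real.Gamma_pos_of_pos (by linarith [he i])
  set F : ι → ℝ → E := fun i ρ => (Complex.exp (-(ρ * Complex.exp (θ * Complex.I))) *
    Complex.exp (θ * Complex.I)) • (Complex.exp (e i * (Real.log ρ + θ * Complex.I)) •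
      (((Real.Gamma (1 + e i))⁻¹ : ℂ) • c i)) with hF
  have hnorm : ∀ i, ∀ ρ ∈ Ioi (0 : ℝ), ‖F i ρ‖ =
      (Real.Gamma (1 + e i))⁻¹ * ‖c i‖ * (ρ ^ e i * Real.exp (-Real.cos θ * ρ)) := by
    intro i ρ hρ
    simp only [hF]
    rw [norm_smul, norm_smul, norm_smul, norm_ray_kernel, norm_exp_mul_log hρ,
      ← Complex.ofReal_inv, Complex.norm_real, Real.norm_eq_abs, abs_of_pos (inv_pos.2 (hΓ i))]
    ring
  have hint := fun i => integral_rpow_mul_exp_neg (he i) hcosθ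
  have hFint : ∀ i, IntegrableOn (F i) (Ioi 0) := by
    intro i
    refine ((hint i).1.const_mul ((Real.Gamma (1 + e i))⁻¹ * ‖c i‖)).mono' ?_ ?_
    · refine ContinuousOn.aestronglyMeasurable ?_ measurableSet_Ioi
      have hlog : ContinuousOn (fun ρ : ℝ => (Real.log ρ : ℂ)) (Ioi 0) :=
        Complex.continuous_ofReal.comp_continuousOn
          (Real.continuousOn_log.mono fun ρ (hρ : 0 < ρ) => hρ.ne')
      simp only [hF]
      fun_prop
    · filter_upwards [ae_restrict_mem measurableSet_Ioi] with ρ hρ using (hnorm i ρ hρ).le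
  have hFnorm : ∀ i, ∫ ρ in Ioi (0 : ℝ), ‖F i ρ‖ =
      ‖c i‖ * (1 / Real.cos θ) ^ e i * (1 / Real.cos θ) := by
    intro i
    rw [setIntegral_congr_fun measurableSet_Ioi (hnorm i), integral_const_mul, (hint i).2,
      Real.rpow_add (by positivity), Real.rpow_one]
    have := (hΓ i).ne'
    field_simp
  have h := hasSum_integral_of_summable_integral_norm (F := F) hFint (by
    simp_rw [hFnorm]
    exact hc.mul_right _)
  have hval : ∀ i, ∫ ρ in Ioi (0 : ℝ), F i ρ = c i := by
    intro i
    have h1 : ∀ ρ, F i ρ = ((Complex.exp (-(ρ * Complex.exp (θ * Complex.I))) *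
        Complex.exp (θ * Complex.I)) • Complex.exp (e i * (Real.log ρ + θ * Complex.I))) •
        (((Real.Gamma (1 + e i))⁻¹ : ℂ) • c i) := fun ρ => by
      simp only [hF, smul_smul, smul_eq_mul, mul_assoc]
    simp_rw [h1]
    rw [integral_smul_const]
    have h2 := rayIntegral_exp (he i) hθ
    unfold rayIntegral at h2
    rw [h2, smul_smul, mul_inv_cancel₀, one_smul]
    exact_mod_cast (hΓ i).ne'
  simp_rw [hval] at h
  simpa only [rayIntegral, hF, tsum_const_smul''] using h

theorem differentiableOn_tsum_exp [CompleteSpace E] {ι : Type*} {c : ι → E} {e : ι → ℝ}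
    (he : ∀ i, 0 ≤ e i) {κ : ℝ} (hc : Summable fun i => ‖c i‖ * Real.exp (e i * κ)) :
    DifferentiableOn ℂ (fun ζ => ∑' i, Complex.exp (e i * ζ) • c i) {ζ : ℂ | ζ.re < κ} := by
  refine Complex.differentiableOn_tsum_of_summable_norm hc
    (fun i => Differentiable.differentiableOn (by fun_prop))
    (isOpen_Iio.preimage Complex.continuous_re) fun i ζ (hζ : ζ.re < κ) => ?_
  rw [norm_smul, Complex.norm_exp, Complex.re_ofReal_mul, mul_comm]
  have := he i
  gcongr

theorem borelTerm_dil (a : ℕ × ℕ → E) (ζ : ℂ) (i : ℕ × ℕ) :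
    borelTerm p q k s a (dil p q k s ζ y).1 (dil p q k s ζ y).2.1 i =
      Complex.exp (expo p q k s i * ζ) • borelTerm p q k s a y.1 y.2.1 i := by
  unfold borelTerm
  rw [pow_mul_pow_dil, mul_smul (Complex.exp _)]

theorem norm_borelTerm_dil (a : ℕ × ℕ → E) (R : ℝ) (i : ℕ × ℕ) :
    ‖borelTerm p q k s a (dil p q k s R y).1 (dil p q k s R y).2.1 i‖ =
      ‖borelTerm p q k s a y.1 y.2.1 i‖ * Real.exp (expo p q k s i * R) := by
  rw [borelTerm_dil, norm_smul, Complex.norm_exp, mul_comm]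
  simp

theorem blockTerm_borelTerm_dil (a : ℕ × ℕ → E) (ζ : ℂ) (n : ℕ) (i : ℕ × ℕ) :
    blockTerm p q (borelTerm p q k s a (dil p q k s ζ y).1 (dil p q k s ζ y).2.1) n i =
      Complex.exp (expo p q k s (n * p + i.1, n * q + i.2) * ζ) •
        blockTerm p q (borelTerm p q k s a y.1 y.2.1) n i := by
  unfold blockTerm
  split_ifs
  · rw [borelTerm_dil]
  · simp

/-! ### The remainder of the Borel transform -/

/-- The sum of the terms of the formal Borel transform that come from
`f_n(x₁, x₂) (x₁ᵖ x₂^q)ⁿ`. -/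
noncomputable def borelBlock (p q : ℕ) (k s : ℝ) (a : ℕ × ℕ → E) (n : ℕ) (y : ℂ × ℂ × ℝ) : E :=
  ∑' i, blockTerm p q (borelTerm p q k s a y.1 y.2.1) n i

/-- A bound for the terms of the formal Borel transform. -/
def BorelTermBound (p q : ℕ) (k s : ℝ) (a : ℕ × ℕ → E) (C A M : ℝ) : Prop :=
  0 < C ∧ 0 < A ∧ 0 < M ∧ ∀ (y : ℂ × ℂ × ℝ) (n : ℕ) (i : ℕ × ℕ), i.1 < p ∨ i.2 < q →
      ‖borelTerm p q k s a y.1 y.2.1 (n * p + i.1, n * q + i.2)‖ ≤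
        C * Real.exp (M * weightNorm p q k s y) * (A * ‖y.1 ^ p * y.2.1 ^ q‖) ^ n *
          (1 / 2) ^ (i.1 + i.2)

theorem BorelTermBound.norm_borelBlock_le [CompleteSpace E] {a : ℕ × ℕ → E} {C A M : ℝ}
    (h : BorelTermBound p q k s a C A M) (n : ℕ) (y : ℂ × ℂ × ℝ) :
    ‖borelBlock p q k s a n y‖ ≤
      4 * C * Real.exp (M * weightNorm p q k s y) * (A * ‖y.1 ^ p * y.2.1 ^ q‖) ^ n := by
  obtain ⟨hC, hA, hM, h⟩ := h
  have := (summable_blockTerm (B := C * Real.exp (M * weightNorm p q k s y) *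
    (A * ‖y.1 ^ p * y.2.1 ^ q‖) ^ n) (by positivity) (h y n)).2
  rw [borelBlock]
  linarith

theorem BorelTermBound.differentiable_borelBlock [CompleteSpace E] {a : ℕ × ℕ → E} {C A M : ℝ}
    (h : BorelTermBound p q k s a C A M) (hk : 0 < k) (hs : 0 < s) (hs' : s < 1) (n : ℕ)
    (y : ℂ × ℂ × ℝ) :
    Differentiable ℂ fun ζ => borelBlock p q k s a n (dil p q k s ζ y) := by
  intro ζ
  obtain ⟨hC, hA, hM, h⟩ := h
  have hsum : Summable fun i : ℕ × ℕ => ‖blockTerm p q (borelTerm p q k s a y.1 y.2.1) n i‖ *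
      Real.exp (expo p q k s (n * p + i.1, n * q + i.2) * (ζ.re + 1)) := by
    -- The global term bound at a point further out on the orbit gives absolute convergence on a
    -- half-plane containing ζ in its interior.
    set z := dil p q k s (ζ.re + 1 : ℝ) y with hz
    have hb := norm_blockTerm_le (F := borelTerm p q k s a z.1 z.2.1)
      (B := C * Real.exp (M * weightNorm p q k s z) *
        (A * ‖z.1 ^ p * z.2.1 ^ q‖) ^ n) (by positivity) (h z n)
    refine Summable.of_nonneg_of_le (fun i => by positivity) (fun i => ?_)
      (hasSum_half_pow.mul_left (C * Real.exp (M * weightNorm p q k s z) *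
        (A * ‖z.1 ^ p * z.2.1 ^ q‖) ^ n)).summable
    refine le_trans (le_of_eq ?_) (hb i)
    rw [hz, blockTerm_borelTerm_dil, norm_smul, Complex.norm_exp, mul_comm, ← Complex.ofReal_mul,
      Complex.ofReal_re]
  have hd := differentiableOn_tsum_exp (fun i => expo_nonneg hk hs hs' _) hsum
  unfold borelBlock
  simp only [blockTerm_borelTerm_dil]
  refine (hd ζ (by simp)).differentiableAt ((isOpen_Iio.preimage Complex.continuous_re).mem_nhds ?_)
  simp

/-- The continuation is given as the sum of the series only on a small polydisc, while the series
converges wherever the monomial is small. Shrinking along the orbit reaches the polydisc, and the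
identity theorem carries the equality back. -/
theorem IsBorelContinuation.hasSum_borelTerm [CompleteSpace E] (hp : 0 < p) (hq : 0 < q)
    (hk : 0 < k) (hs : 0 < s) (hs' : s < 1) {a : ℕ × ℕ → E} {C A M d ε : ℝ}
    {φ : ℂ × ℂ × ℝ → E} (h : BorelTermBound p q k s a C A M)
    (hφ : IsBorelContinuation p q k s a d ε φ) (hy : y ∈ sector p q (d - ε) (d + ε))
    (ht : A * ‖y.1 ^ p * y.2.1 ^ q‖ < 1 / 2) :
    HasSum (borelTerm p q k s a y.1 y.2.1) (φ y) := by
  obtain ⟨hC, hA, hM, h⟩ := h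
  obtain ⟨hε, hhol, ⟨r, hr, hser⟩, -⟩ := hφ
  have hs1 : 0 < 1 - s := by linarith
  have hp' : (0 : ℝ) < p := by exact_mod_cast hp
  have hq' : (0 : ℝ) < q := by exact_mod_cast hq
  have hsum : ∀ z : ℂ × ℂ × ℝ, A * ‖z.1 ^ p * z.2.1 ^ q‖ < 1 →
      Summable fun i => ‖borelTerm p q k s a z.1 z.2.1 i‖ := by
    intro z hz
    have h1 : ∀ (n : ℕ) (i : ℕ × ℕ), i.1 < p ∨ i.2 < q →
        ‖(fun i => ‖borelTerm p q k s a z.1 z.2.1 i‖) (n * p + i.1, n * q + i.2)‖ ≤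
          C * Real.exp (M * weightNorm p q k s z) * (A * ‖z.1 ^ p * z.2.1 ^ q‖) ^ n *
          (1 / 2) ^ (i.1 + i.2) := by
      intro n i hi
      rw [norm_norm]
      exact h z n i hi
    exact (hasSum_blocks hp hq (F := fun i => ‖borelTerm p q k s a z.1 z.2.1 i‖)
      (B := C * Real.exp (M * weightNorm p q k s z)) (by positivity) (by positivity) hz h1).1
  -- Moving by κ doubles the monomial, so the margin 1/2 in the hypothesis gives convergence beyond
  -- ζ = 0 and analyticity at that point.
  set κ : ℝ := k * Real.log 2 with hκ
  have hκ0 : 0 < κ := mul_pos hk (Real.log_pos (by norm_num))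
  have hsumκ : Summable fun i => ‖borelTerm p q k s a y.1 y.2.1 i‖ *
      Real.exp (expo p q k s i * κ) := by
    have := hsum (dil p q k s κ y) (by
      rw [norm_monomial_dil hp hq, Complex.ofReal_re, hκ, mul_div_cancel_left₀ _ hk.ne',
        Real.exp_log (by norm_num)]
      linarith)
    simpa only [norm_borelTerm_dil] using this
  have hdiff := differentiableOn_tsum_exp (fun i => expo_nonneg (p := p) (q := q) hk hs hs' i) hsumκ
  set U : Set ℂ := {ζ : ℂ | ζ.re ≤ 0 ∧ ζ.im = 0} with hU
  have hUconv : Convex ℝ U :=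
    (convex_halfSpace_re_le 0).inter ((convex_singleton (0 : ℝ)).is_linear_preimage
      Complex.imLm.isLinear)
  have hopen : IsOpen {ζ : ℂ | ζ.re < κ} := isOpen_Iio.preimage Complex.continuous_re
  have han1 : AnalyticOnNhd ℂ (fun ζ : ℂ => φ (dil p q k s ζ y)) U := by
    intro ζ hζ
    refine hhol.analyticAt_dil (isActOpen_sector _ _) (dil_mem_sector hp hq hy.1 ?_ ?_)
    · rw [hζ.2]; simpa using hy.2.1
    · rw [hζ.2]; simpa using hy.2.2
  have han2 : AnalyticOnNhd ℂ (fun ζ : ℂ => ∑' i, Complex.exp (expo p q k s i * ζ) •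
      borelTerm p q k s a y.1 y.2.1 i) U := by
    intro ζ hζ
    exact hdiff.analyticAt (hopen.mem_nhds (show ζ.re < κ by linarith [hζ.1]))
  obtain ⟨X, hX⟩ : ∃ X : ℝ, ∀ ζ : ℂ, ζ.re < X → ‖(dil p q k s ζ y).1‖ < r ∧
      ‖(dil p q k s ζ y).2.1‖ < r := by
    have hlim : ∀ (c b : ℝ), 0 < c → Tendsto (fun x : ℝ => b * Real.exp (c * x)) atBot (𝓝 0) := by
      intro c b hc
      have h1 : Tendsto (fun x : ℝ => c * x) atBot atBot := tendsto_id.const_mul_atBot hc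
      simpa using (Real.tendsto_exp_atBot.comp h1).const_mul b
    have e1 := (hlim (s / (p * k)) ‖y.1‖ (by positivity)).eventually_lt_const hr
    have e2 := (hlim ((1 - s) / (q * k)) ‖y.2.1‖ (by positivity)).eventually_lt_const hr
    obtain ⟨X, hX⟩ := eventually_atBot.1 (e1.and e2)
    refine ⟨X, fun ζ hζ => ?_⟩
    rw [norm_dil_fst, norm_dil_snd]
    exact hX _ hζ.le
  have hz₀ : ((min (X - 1) 0 : ℝ) : ℂ) ∈ U := ⟨by simp, by simp⟩
  have hev : (fun ζ : ℂ => φ (dil p q k s ζ y)) =ᶠ[𝓝 ((min (X - 1) 0 : ℝ) : ℂ)]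
      fun ζ : ℂ => ∑' i, Complex.exp (expo p q k s i * ζ) •
        borelTerm p q k s a y.1 y.2.1 i := by
    have hn1 : ∀ᶠ ζ : ℂ in 𝓝 ((min (X - 1) 0 : ℝ) : ℂ), ζ.re < X :=
      Complex.continuous_re.continuousAt.eventually_lt continuousAt_const (by
        rw [Complex.ofReal_re]
        exact (min_le_left _ _).trans_lt (by linarith))
    have hn2 : ∀ᶠ ζ : ℂ in 𝓝 ((min (X - 1) 0 : ℝ) : ℂ),
        dil p q k s ζ y ∈ sector p q (d - ε) (d + ε) := by
      have hc : Continuous fun ζ : ℂ => y.2.2 + ζ.im / k := by fun_prop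
      have : ∀ᶠ ζ : ℂ in 𝓝 ((min (X - 1) 0 : ℝ) : ℂ),
          y.2.2 + ζ.im / k ∈ Ioo (d - ε) (d + ε) := by
        refine hc.continuousAt.eventually_mem (isOpen_Ioo.mem_nhds ?_)
        simpa using hy.2
      filter_upwards [this] with ζ hζ using dil_mem_sector hp hq hy.1 hζ.1 hζ.2
    filter_upwards [hn1, hn2] with ζ h1 h2
    have h3 := hser _ h2 (hX ζ h1).1 (hX ζ h1).2
    rw [← h3.tsum_eq]
    exact tsum_congr fun i => borelTerm_dil a ζ i
  have heq := han1.eqOn_of_preconnected_of_eventuallyEq han2 hUconv.isPreconnected hz₀ hev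
    (show (0 : ℂ) ∈ U from ⟨by simp, by simp⟩)
  simp only [dil_zero, mul_zero, Complex.exp_zero, one_smul] at heq
  rw [heq]
  exact (Summable.of_norm (hsum y (by linarith))).hasSum

/-- For a small monomial the remainder is the tail of the convergent block series. Otherwise (2At)^N
≥ 1, and φ and the blocks are estimated separately by their exponential growth. -/
theorem IsBorelContinuation.norm_sub_blocks_le [CompleteSpace E] (hp : 0 < p) (hq : 0 < q)
    (hk : 0 < k) (hs : 0 < s) (hs' : s < 1) {a : ℕ × ℕ → E} {C A M d ε α β C' M' : ℝ}
    {φ : ℂ × ℂ × ℝ → E} (h : BorelTermBound p q k s a C A M)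
    (hφ : IsBorelContinuation p q k s a d ε φ) (hα : d - ε ≤ α) (hβ : β ≤ d + ε) (hC' : 0 < C')
    (hM' : 0 < M') (hexp : ExpBound p q k s φ α β C' M') (hy : y ∈ sector p q α β) (N : ℕ) :
    ‖φ y - ∑ n ∈ Finset.range N, borelBlock p q k s a n y‖ ≤
      (C' + 8 * C) * (2 * A * ‖y.1 ^ p * y.2.1 ^ q‖) ^ N *
        Real.exp ((M + M') * weightNorm p q k s y) := by
  obtain ⟨hC, hA, hM, h0⟩ := id h
  set t := ‖y.1 ^ p * y.2.1 ^ q‖ with ht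
  have ht0 : 0 ≤ t := norm_nonneg _
  have hw := weightNorm_nonneg (p := p) (q := q) (k := k) (s := s) (y := y)
  set W := weightNorm p q k s y with hW
  have hblock : ∀ n, ‖borelBlock p q k s a n y‖ ≤ 4 * C * Real.exp (M * W) * (A * t) ^ n :=
    fun n => h.norm_borelBlock_le n y
  have hexpM : Real.exp (M * W) ≤ Real.exp ((M + M') * W) := by gcongr; linarith
  have hexpM' : Real.exp (M' * W) ≤ Real.exp ((M + M') * W) := by gcongr; linarith
  rcases lt_or_ge (A * t) (1 / 2) with hsmall | hlarge
  · have hsum := hφ.hasSum_borelTerm hp hq hk hs hs' h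
      ⟨hy.1, hα.trans_lt hy.2.1, hy.2.2.trans_le hβ⟩ hsmall
    have hb := (hasSum_blocks hp hq (F := borelTerm p q k s a y.1 y.2.1)
      (B := C * Real.exp (M * W)) (x := A * t) (by positivity) (by positivity) (by linarith)
      (h0 y)).2
    rw [hsum.tsum_eq] at hb
    have htail := (hasSum_nat_add_iff' N).2 hb
    have hgeo : HasSum (fun n : ℕ => 4 * C * Real.exp (M * W) * (A * t) ^ N * (1 / 2) ^ n)
        (4 * C * Real.exp (M * W) * (A * t) ^ N * 2) := hasSum_geometric_two.mul_left _
    have h1 := tsum_of_norm_bounded hgeo (f := fun n => borelBlock p q k s a (n + N) y) fun n => by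
      refine (hblock (n + N)).trans ?_
      rw [pow_add, mul_comm ((A * t) ^ n), ← mul_assoc]
      gcongr
    have h2 : ∑' n, borelBlock p q k s a (n + N) y =
        φ y - ∑ n ∈ Finset.range N, borelBlock p q k s a n y := htail.tsum_eq
    rw [h2] at h1
    refine h1.trans ?_
    calc 4 * C * Real.exp (M * W) * (A * t) ^ N * 2
        = 8 * C * (A * t) ^ N * Real.exp (M * W) := by ring
      _ ≤ (C' + 8 * C) * (2 * A * t) ^ N * Real.exp ((M + M') * W) := by
          gcongr
          · linarith
          · linarith
  · have hge : 1 ≤ 2 * A * t := by linarith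
    have hN1 : 1 ≤ (2 * A * t) ^ N := one_le_pow₀ hge
    have hφb : ‖φ y‖ ≤ C' * Real.exp (M' * W) := hexp y hy
    have hsumb : ‖∑ n ∈ Finset.range N, borelBlock p q k s a n y‖ ≤
        8 * C * Real.exp (M * W) * (2 * A * t) ^ N := by
      refine (norm_sum_le _ _).trans ?_
      calc ∑ n ∈ Finset.range N, ‖borelBlock p q k s a n y‖
          ≤ ∑ n ∈ Finset.range N, 4 * C * Real.exp (M * W) * (2 * A * t) ^ N * (1 / 2) ^ n := by
            refine Finset.sum_le_sum fun n hn => (hblock n).trans ?_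
            rw [mul_assoc (4 * C * Real.exp (M * W))]
            gcongr
            calc (A * t) ^ n = (2 * A * t) ^ n * (1 / 2) ^ n := by rw [← mul_pow]; congr 1; ring
              _ ≤ (2 * A * t) ^ N * (1 / 2) ^ n := by
                gcongr
                exact (Finset.mem_range.1 hn).le
        _ = 4 * C * Real.exp (M * W) * (2 * A * t) ^ N * ∑ n ∈ Finset.range N, (1 / 2 : ℝ) ^ n := by
            rw [Finset.mul_sum]
        _ ≤ 4 * C * Real.exp (M * W) * (2 * A * t) ^ N * 2 := by
            gcongr
            exact (summable_geometric_two.sum_le_tsum _ fun n _ => by positivity).trans_eq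
              tsum_geometric_two
        _ = _ := by ring
    refine (norm_sub_le_of_le hφb hsumb).trans ?_
    calc C' * Real.exp (M' * W) + 8 * C * Real.exp (M * W) * (2 * A * t) ^ N
        ≤ C' * Real.exp ((M + M') * W) * (2 * A * t) ^ N +
          8 * C * Real.exp ((M + M') * W) * (2 * A * t) ^ N := by
          refine add_le_add ((mul_le_mul_of_nonneg_left hexpM' hC'.le).trans
            (le_mul_of_one_le_right (by positivity) hN1)) (by gcongr)
      _ = _ := by ring

end MonomialSummability

namespace MonomialSummability
open MeasureTheory Set Filter Topology

variable {E : Type*} [NormedAddCommGroup E] [NormedSpace ℂ E]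
variable {p q : ℕ} {k s : ℝ} {y : ℂ × ℂ × ℝ}

/-! ### Laplace integrals on the surface -/

theorem integrableOn_ray {Φ : ℂ → E} {θ e C m : ℝ} (he : 0 ≤ e) (hm : m < Real.cos θ)
    (hc : ∀ ζ : ℂ, ζ.im = θ → ContinuousAt Φ ζ)
    (hb : ∀ ζ : ℂ, ζ.im = θ → ‖Φ ζ‖ ≤ C * Real.exp (e * ζ.re) * Real.exp (m * Real.exp ζ.re)) :
    IntegrableOn (fun ρ : ℝ => (Complex.exp (-(ρ * Complex.exp (θ * Complex.I))) *
      Complex.exp (θ * Complex.I)) • Φ (Real.log ρ + θ * Complex.I)) (Ioi 0) ∧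
    ‖rayIntegral θ Φ‖ ≤
      C * ((1 / (Real.cos θ - m)) ^ (1 + e) * Real.Gamma (1 + e)) := by
  have hle : ∀ ρ ∈ Ioi (0 : ℝ), ‖(Complex.exp (-(ρ * Complex.exp (θ * Complex.I))) *
      Complex.exp (θ * Complex.I)) • Φ (Real.log ρ + θ * Complex.I)‖ ≤
      C * (ρ ^ e * Real.exp (-(Real.cos θ - m) * ρ)) := by
    intro ρ (hρ : 0 < ρ)
    have h1 := hb (Real.log ρ + θ * Complex.I) (by simp)
    have h2 : (Real.log ρ + θ * Complex.I : ℂ).re = Real.log ρ := by simp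
    rw [h2, Real.exp_log hρ, mul_comm e, ← Real.rpow_def_of_pos hρ] at h1
    rw [norm_smul, norm_ray_kernel]
    calc Real.exp (-Real.cos θ * ρ) * ‖Φ (Real.log ρ + θ * Complex.I)‖
        ≤ Real.exp (-Real.cos θ * ρ) * (C * ρ ^ e * Real.exp (m * ρ)) := by gcongr
      _ = C * (ρ ^ e * (Real.exp (-Real.cos θ * ρ) * Real.exp (m * ρ))) := by ring
      _ = _ := by rw [← Real.exp_add]; congr 3; ring
  have hle' : ∀ᵐ ρ : ℝ ∂(volume.restrict (Ioi (0 : ℝ))),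
      ‖(Complex.exp (-(ρ * Complex.exp (θ * Complex.I))) *
      Complex.exp (θ * Complex.I)) • Φ (Real.log ρ + θ * Complex.I)‖ ≤
      C * (ρ ^ e * Real.exp (-(Real.cos θ - m) * ρ)) := by
    filter_upwards [ae_restrict_mem measurableSet_Ioi] with ρ hρ using hle ρ hρ
  have hint := integral_rpow_mul_exp_neg he (sub_pos.2 hm)
  refine ⟨(hint.1.const_mul C).mono' ?_ hle', ?_⟩
  · refine ContinuousOn.aestronglyMeasurable (fun ρ hρ => ?_) measurableSet_Ioi
    have hlog : ContinuousAt (fun ρ : ℝ => (Real.log ρ + θ * Complex.I : ℂ)) ρ :=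
      (Complex.continuous_ofReal.continuousAt.comp
        (Real.continuousAt_log (ne_of_gt hρ))).add continuousAt_const
    have h1 : ContinuousAt (fun ρ : ℝ => Φ (Real.log ρ + θ * Complex.I)) ρ :=
      ContinuousAt.comp (f := fun ρ : ℝ => (Real.log ρ + θ * Complex.I : ℂ)) (g := Φ)
        (hc _ (by simp)) hlog
    exact (ContinuousAt.smul (by fun_prop) h1).continuousWithinAt
  · have h3 := norm_integral_le_of_norm_le (hint.1.const_mul C) hle'
    rwa [integral_const_mul, hint.2] at h3

theorem borelSum_eq_rayIntegral (hp : 0 < p) (hq : 0 < q) (θ : ℝ) (φ : ℂ × ℂ × ℝ → E) :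
    borelSum p q k s θ φ y = rayIntegral θ fun ζ => φ (dil p q k s ζ y) := by
  unfold borelSum laplace rayIntegral laplaceIntegrand
  rw [inv_smul_smul₀ (show monomialPow p q k y ≠ 0 from Complex.exp_ne_zero _)]
  simp_rw [dilate_eq_dil hp hq]

theorem ExpBound.norm_dil_le (hp : 0 < p) (hq : 0 < q) (hk : 0 < k) (hs : 0 < s) (hs' : s < 1)
    {V : Type*} [NormedAddCommGroup V] {φ : ℂ × ℂ × ℝ → V} {α β C M : ℝ}
    (h : ExpBound p q k s φ α β C M) (hy : y ∈ surface p q)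
    {ζ : ℂ} (h1 : α < y.2.2 + ζ.im / k) (h2 : y.2.2 + ζ.im / k < β) :
    ‖φ (dil p q k s ζ y)‖ ≤ C * Real.exp (M * weightNorm p q k s y * Real.exp ζ.re) := by
  have h3 := h _ (dil_mem_sector (s := s) hp hq hy h1 h2)
  change _ ≤ C * Real.exp (M * weightNorm p q k s (dil p q k s ζ y)) at h3
  rw [weightNorm_dil hp hq hk hs hs'] at h3
  rwa [mul_assoc, mul_comm (weightNorm _ _ _ _ _)]

theorem integrableOn_borel (hp : 0 < p) (hq : 0 < q) (hk : 0 < k) (hs : 0 < s) (hs' : s < 1)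
    {φ : ℂ × ℂ × ℝ → E} {α β α' β' θ C M : ℝ} (hφ : IsHolomorphicOn p q φ (sector p q α β))
    (hα : α ≤ α') (hβ : β' ≤ β) (h : ExpBound p q k s φ α' β' C M) (hy : y ∈ surface p q)
    (h1 : α' < y.2.2 + θ / k) (h2 : y.2.2 + θ / k < β')
    (hM : M * weightNorm p q k s y < Real.cos θ) :
    IntegrableOn (fun ρ : ℝ => (Complex.exp (-(ρ * Complex.exp (θ * Complex.I))) *
      Complex.exp (θ * Complex.I)) • φ (dil p q k s (Real.log ρ + θ * Complex.I) y)) (Ioi 0) := by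
  refine (integrableOn_ray (Φ := fun ζ => φ (dil p q k s ζ y)) (C := C) le_rfl hM (fun ζ hζ => ?_)
    fun ζ hζ => ?_).1
  · refine (hφ.differentiableAt_dil (isActOpen_sector _ _).1
      (dil_mem_sector hp hq hy ?_ ?_)).continuousAt
    · rw [hζ]; linarith
    · rw [hζ]; linarith
  · rw [zero_mul, Real.exp_zero, mul_one]
    exact h.norm_dil_le hp hq hk hs hs' hy (by rwa [hζ]) (by rwa [hζ])

theorem continuous_weightNorm (hk : 0 < k) (hs : 0 < s) (hs' : s < 1) :
    Continuous (weightNorm p q k s) := by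
  have hs1 : 0 < 1 - s := by linarith
  unfold weightNorm
  exact ((continuous_norm.comp continuous_fst).rpow_const fun _ => Or.inr (by positivity)).add
    ((continuous_norm.comp (continuous_fst.comp continuous_snd)).rpow_const
      fun _ => Or.inr (by positivity))

theorem eventually_act_mem (hk : 0 < k) (hs : 0 < s) (hs' : s < 1) {α β c M m : ℝ}
    (h1 : α < y.2.2 + c) (h2 : y.2.2 + c < β) (h3 : M * weightNorm p q k s y < m) :
    ∀ᶠ w in 𝓝 (0 : ℂ × ℂ), α < (act p q w y).2.2 + c ∧ (act p q w y).2.2 + c < β ∧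
      M * weightNorm p q k s (act p q w y) < m := by
  have hc1 : Continuous fun w : ℂ × ℂ => (act p q w y).2.2 + c :=
    (continuous_snd.comp (continuous_snd.comp continuous_act)).add continuous_const
  have hc2 : Continuous fun w : ℂ × ℂ => M * weightNorm p q k s (act p q w y) :=
    continuous_const.mul ((continuous_weightNorm hk hs hs').comp continuous_act)
  have e1 := hc1.continuousAt.eventually_mem (x := 0) (Ioo_mem_nhds (a := α) (b := β)
    (by simpa using h1) (by simpa using h2))
  have e2 := hc2.continuousAt.eventually_lt (x₀ := 0) (continuousAt_const (y := m))
    (by simpa using h3)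
  filter_upwards [e1, e2] with w hw1 hw2 using ⟨hw1.1, hw1.2, hw2⟩

/-- The conditions are strict, so nearby points can use the same subsector and the same growth
constants. -/
theorem isActOpen_laplaceDomain {V : Type*} [NormedAddCommGroup V] (hk : 0 < k) (hs : 0 < s)
    (hs' : s < 1) (θ : ℝ) (φ : ℂ × ℂ × ℝ → V) (α β : ℝ) :
    IsActOpen p q (laplaceDomain p q k s θ φ α β) := by
  refine ⟨fun y hy => hy.1, fun y hy => ?_⟩
  obtain ⟨hy, α', β', C, M, hα, hβ, h1, h2, hC, hM, hexp, h3⟩ := hy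
  filter_upwards [eventually_act_mem (p := p) (q := q) hk hs hs' h1 h2 h3] with w hw
  exact ⟨act_mem_surface hy w, α', β', C, M, hα, hβ, hw.1, hw.2.1, hC, hM, hexp, hw.2.2⟩

theorem isHolomorphicOn_borelSum [CompleteSpace E] (hp : 0 < p) (hq : 0 < q) (hk : 0 < k)
    (hs : 0 < s) (hs' : s < 1) {φ : ℂ × ℂ × ℝ → E} {α β : ℝ}
    (hφ : IsHolomorphicOn p q φ (sector p q α β)) (θ : ℝ) :
    IsHolomorphicOn p q (borelSum p q k s θ φ) (laplaceDomain p q k s θ φ α β) := by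
  refine (isHolomorphicOn_iff fun y hy => hy.1).2 fun y hy => ?_
  obtain ⟨hy, α', β', C, M, hα, hβ, h1, h2, hC, hM, hexp, h3⟩ := hy
  change M * weightNorm p q k s y < Real.cos θ at h3
  -- The intermediate m bounds M R_s on a whole neighbourhood and still leaves the uniform decay
  -- rate cos θ - m.
  obtain ⟨m, hm1, hm2⟩ := exists_between h3
  obtain ⟨r, hr, hball⟩ := Metric.eventually_nhds_iff_ball.1
    (eventually_act_mem (p := p) (q := q) hk hs hs' h1 h2 hm1)
  simp_rw [borelSum_eq_rayIntegral hp hq]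
  unfold rayIntegral
  have hint : IntegrableOn (fun ρ : ℝ => C * Real.exp (-(Real.cos θ - m) * ρ)) (Ioi 0) :=
    (exp_neg_integrableOn_Ioi 0 (sub_pos.2 hm2)).const_mul C
  refine differentiableAt_integral_of_norm_le hr (fun w hw => ?_) ?_ hint ?_
  · obtain ⟨b1, b2, b3⟩ := hball w hw
    exact (integrableOn_borel hp hq hk hs hs' hφ hα.le hβ.le hexp (act_mem_surface hy w) b1 b2
      (b3.trans hm2)).aestronglyMeasurable
  · filter_upwards [ae_restrict_mem measurableSet_Ioi] with ρ hρ w hw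
    obtain ⟨b1, b2, b3⟩ := hball w hw
    have h4 := hexp.norm_dil_le hp hq hk hs hs' (act_mem_surface hy w)
      (ζ := Real.log ρ + θ * Complex.I) (by simpa using b1) (by simpa using b2)
    have h5 : (Real.log ρ + θ * Complex.I : ℂ).re = Real.log ρ := by simp
    rw [h5, Real.exp_log hρ] at h4
    rw [norm_smul, norm_ray_kernel]
    calc Real.exp (-Real.cos θ * ρ) * ‖φ (dil p q k s (Real.log ρ + θ * Complex.I) (act p q w y))‖
        ≤ Real.exp (-Real.cos θ * ρ) * (C * Real.exp (m * ρ)) := by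
          have : 0 < ρ := hρ
          refine mul_le_mul_of_nonneg_left (h4.trans ?_) (by positivity)
          gcongr
      _ = C * (Real.exp (-Real.cos θ * ρ) * Real.exp (m * ρ)) := by ring
      _ = _ := by rw [← Real.exp_add]; congr 2; ring
  · filter_upwards with ρ w hw
    obtain ⟨b1, b2, b3⟩ := hball w hw
    refine (DifferentiableAt.const_smul ?_ _).differentiableWithinAt
    simp_rw [← act_dil]
    refine hφ.differentiableAt_act (isActOpen_sector _ _).1 ?_
    rw [act_dil]
    refine dil_mem_sector hp hq (act_mem_surface hy w) ?_ ?_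
    · simpa using hα.trans b1
    · simpa using b2.trans hβ

/-- Rotation of the direction of integration. -/
theorem borelSum_eq_borelSum [CompleteSpace E] (hp : 0 < p) (hq : 0 < q) (hk : 0 < k) (hs : 0 < s)
    (hs' : s < 1) {φ : ℂ × ℂ × ℝ → E} {α β α' β' C M Θ θ₁ θ₂ : ℝ}
    (hφ : IsHolomorphicOn p q φ (sector p q α β)) (hα : α ≤ α') (hβ : β' ≤ β)
    (h : ExpBound p q k s φ α' β' C M) (hy : y ∈ surface p q) (hΘ : Θ < Real.pi / 2)
    (h₁ : |θ₁| ≤ Θ) (h₂ : |θ₂| ≤ Θ) (h11 : α' < y.2.2 + θ₁ / k) (h12 : y.2.2 + θ₁ / k < β')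
    (h21 : α' < y.2.2 + θ₂ / k) (h22 : y.2.2 + θ₂ / k < β')
    (hM : M * weightNorm p q k s y < Real.cos Θ) :
    borelSum p q k s θ₁ φ y = borelSum p q k s θ₂ φ y := by
  wlog hle : θ₁ ≤ θ₂ generalizing θ₁ θ₂
  · exact (this h₂ h₁ h21 h22 h11 h12 (le_of_not_ge hle)).symm
  rw [borelSum_eq_rayIntegral hp hq, borelSum_eq_rayIntegral hp hq]
  have hmem : ∀ ζ ∈ (univ ×ℂ Icc θ₁ θ₂ : Set ℂ),
      α' < y.2.2 + ζ.im / k ∧ y.2.2 + ζ.im / k < β' := by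
    intro ζ hζ
    have a1 : θ₁ / k ≤ ζ.im / k := by gcongr; exact hζ.2.1
    have a2 : ζ.im / k ≤ θ₂ / k := by gcongr; exact hζ.2.2
    exact ⟨by linarith, by linarith⟩
  refine rayIntegral_eq_of_le hle hM (C := C) (fun x hx => ?_) (fun ζ hζ => ?_) fun ζ hζ => ?_
  · have hx' : |x| ≤ Θ := abs_le.2 ⟨(abs_le.1 h₁).1.trans hx.1, hx.2.trans (abs_le.1 h₂).2⟩
    rw [← Real.cos_abs x]
    exact Real.cos_le_cos_of_nonneg_of_le_pi (abs_nonneg _) (by linarith [Real.pi_pos]) hx'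
  · have := hmem ζ hζ
    exact (hφ.differentiableAt_dil (isActOpen_sector _ _).1 (dil_mem_sector hp hq hy
      (hα.trans_lt this.1) (this.2.trans_le hβ))).differentiableWithinAt
  · exact h.norm_dil_le hp hq hk hs hs' hy (hmem ζ hζ).1 (hmem ζ hζ).2

/-! ### The expansion of the Borel sum -/

/-- The Gamma factors introduced by the formal Borel transform are cancelled termwise. The
hypotheses place the point enlarged by 1/cos θ inside the polydisc where the block converges. -/
theorem rayIntegral_borelBlock [CompleteSpace E] (hp : 0 < p) (hq : 0 < q) (hk : 0 < k)
    (hs : 0 < s) (hs' : s < 1) {σ r C A θ : ℝ} {a : ℕ × ℕ → E} (h : CoeffBound p q σ a r C A)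
    (hθ : |θ| < Real.pi / 2)
    (h1 : ‖(dil p q k s (-Real.log (Real.cos θ) : ℝ) y).1‖ ≤ r / 2)
    (h2 : ‖(dil p q k s (-Real.log (Real.cos θ) : ℝ) y).2.1‖ ≤ r / 2) (n : ℕ) :
    rayIntegral θ (fun ζ => borelBlock p q k s a n (dil p q k s ζ y)) =
      (y.1 ^ p * y.2.1 ^ q) ^ n • coeffFun p q a n y.1 y.2.1 := by
  have hcosθ : 0 < Real.cos θ := Real.cos_pos_of_mem_Ioo (abs_lt.1 hθ)
  set c : ℕ × ℕ → E := blockTerm p q (fun i => (y.1 ^ i.1 * y.2.1 ^ i.2) • a i) n with hc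
  set e : ℕ × ℕ → ℝ := fun i => expo p q k s (n * p + i.1, n * q + i.2) with he
  have hsum : Summable fun i => ‖c i‖ * (1 / Real.cos θ) ^ e i := by
    have hrw : ∀ i, (1 / Real.cos θ) ^ e i = Real.exp (e i * -Real.log (Real.cos θ)) := fun i => by
      rw [Real.rpow_def_of_pos (by positivity), one_div, Real.log_inv, mul_comm]
    simp_rw [hrw]
    exact h.summable_norm_blockTerm_mul_exp h1 h2 n
  have hs1 := hasSum_rayIntegral hθ (c := c) (e := e) (fun i => expo_nonneg hk hs hs' _) hsum
  have hlog : (0 : ℂ).re ≤ ((-Real.log (Real.cos θ) : ℝ) : ℂ).re := by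
    rw [Complex.ofReal_re, Complex.zero_re, neg_nonneg]
    exact Real.log_nonpos hcosθ.le (Real.cos_le_one θ)
  have hle := norm_dil_le_of_re_le (p := p) (q := q) (y := y) hk hs hs' hlog
  have h3 := smul_coeffFun_dil (k := k) (s := s) (ζ := 0) h (hle.1.trans h1) (hle.2.trans h2) n
  simp only [dil_zero, mul_zero, Complex.exp_zero, one_smul] at h3
  rw [h3, hs1.tsum_eq]
  congr 1
  funext ζ
  unfold borelBlock
  refine tsum_congr fun i => ?_
  rw [blockTerm_borelTerm_dil]
  congr 1
  simp only [hc, he, blockTerm]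
  split_ifs
  · rw [borelTerm, formalBorel_eq hp hq hk, smul_comm]
  · simp

/-- Along the ray the remainder bound grows like |u|^{N/k} e^{(M+M') R_s |u|}; against a kernel
leaving decay rate at least c, this integrates to the last factor. -/
theorem IsBorelContinuation.norm_borelSum_sub_le [CompleteSpace E] (hp : 0 < p) (hq : 0 < q)
    (hk : 0 < k) (hs : 0 < s) (hs' : s < 1) {a : ℕ × ℕ → E}
    {σ r C₀ A₀ C A M d ε α β C' M' θ c : ℝ}
    {φ : ℂ × ℂ × ℝ → E} (ha : CoeffBound p q σ a r C₀ A₀) (h : BorelTermBound p q k s a C A M)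
    (hφ : IsBorelContinuation p q k s a d ε φ) (hα : d - ε ≤ α) (hβ : β ≤ d + ε) (hC' : 0 < C')
    (hM' : 0 < M') (hexp : ExpBound p q k s φ α β C' M') (hy : y ∈ surface p q)
    (hθ : |θ| < Real.pi / 2) (hθ1 : α < y.2.2 + θ / k) (hθ2 : y.2.2 + θ / k < β)
    (h1 : ‖(dil p q k s (-Real.log (Real.cos θ) : ℝ) y).1‖ ≤ r / 2)
    (h2 : ‖(dil p q k s (-Real.log (Real.cos θ) : ℝ) y).2.1‖ ≤ r / 2)
    (hc : 0 < c) (hcM : c + (M + M') * weightNorm p q k s y ≤ Real.cos θ) (N : ℕ) :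
    ‖borelSum p q k s θ φ y -
        ∑ n ∈ Finset.range N, (y.1 ^ p * y.2.1 ^ q) ^ n • coeffFun p q a n y.1 y.2.1‖ ≤
      (C' + 8 * C) * (2 * A * ‖y.1 ^ p * y.2.1 ^ q‖) ^ N *
        ((1 / c) ^ (1 + N / k) * Real.Gamma (1 + N / k)) := by
  obtain ⟨hC, hA, hM, -⟩ := id h
  have hw := weightNorm_nonneg (p := p) (q := q) (k := k) (s := s) (y := y)
  set W := weightNorm p q k s y with hW
  set t := ‖y.1 ^ p * y.2.1 ^ q‖ with ht
  have hMW : 0 ≤ M * W := by positivity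
  have hMW' : 0 ≤ M' * W := by positivity
  have hexpN : ∀ (n : ℕ) (x : ℝ), Real.exp (x / k) ^ n = Real.exp (n / k * x) := by
    intro n x
    rw [← Real.exp_nat_mul]
    congr 1
    ring
  have hφint := integrableOn_borel (θ := θ) hp hq hk hs hs' hφ.2.1 hα hβ hexp hy hθ1 hθ2
    (by rw [← hW]; linarith)
  have hblock : ∀ n, IntegrableOn (fun ρ : ℝ =>
      (Complex.exp (-(ρ * Complex.exp (θ * Complex.I))) *
      Complex.exp (θ * Complex.I)) •
        borelBlock p q k s a n (dil p q k s (Real.log ρ + θ * Complex.I) y)) (Ioi 0) := by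
    intro n
    refine (integrableOn_ray (Φ := fun ζ => borelBlock p q k s a n (dil p q k s ζ y))
      (e := n / k) (m := M * W) (C := 4 * C * (A * t) ^ n) (by positivity) (by linarith)
      (fun ζ _ => (h.differentiable_borelBlock hk hs hs' n y ζ).continuousAt) fun ζ _ => ?_).1
    refine (h.norm_borelBlock_le n _).trans_eq ?_
    rw [weightNorm_dil hp hq hk hs hs', norm_monomial_dil hp hq, ← hW, ← ht, ← hexpN, mul_pow,
      mul_pow, mul_pow, mul_left_comm M]
    ring_nf
  have hdiff : borelSum p q k s θ φ y -
      ∑ n ∈ Finset.range N, (y.1 ^ p * y.2.1 ^ q) ^ n • coeffFun p q a n y.1 y.2.1 =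
      rayIntegral θ fun ζ => φ (dil p q k s ζ y) -
        ∑ n ∈ Finset.range N, borelBlock p q k s a n (dil p q k s ζ y) := by
    simp_rw [← rayIntegral_borelBlock hp hq hk hs hs' ha hθ h1 h2]
    rw [borelSum_eq_rayIntegral hp hq]
    simp only [rayIntegral, smul_sub, Finset.smul_sum]
    rw [integral_sub hφint (integrable_finsetSum _ fun n _ => hblock n),
      integral_finsetSum _ fun n _ => hblock n]
  rw [hdiff]
  have hmem : ∀ ζ : ℂ, ζ.im = θ → dil p q k s ζ y ∈ sector p q α β := fun ζ hζ =>
    dil_mem_sector hp hq hy (by rwa [hζ]) (by rwa [hζ])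
  refine (integrableOn_ray (e := N / k) (m := (M + M') * W)
    (C := (C' + 8 * C) * (2 * A * t) ^ N) (by positivity) (by linarith) (fun ζ hζ => ?_)
    fun ζ hζ => ?_).2.trans ?_
  · refine ContinuousAt.sub ?_ ?_
    · have := hmem ζ hζ
      exact (hφ.2.1.differentiableAt_dil (isActOpen_sector _ _).1 ⟨this.1, hα.trans_lt this.2.1,
        this.2.2.trans_le hβ⟩).continuousAt
    · exact tendsto_finsetSum _ fun n _ =>
        (h.differentiable_borelBlock hk hs hs' n y ζ).continuousAt
  · refine (hφ.norm_sub_blocks_le hp hq hk hs hs' h hα hβ hC' hM' hexp (hmem ζ hζ) N).trans_eq ?_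
    rw [weightNorm_dil hp hq hk hs hs', norm_monomial_dil hp hq, ← hW, ← ht, ← hexpN,
      mul_left_comm (M + M'), ← mul_assoc (2 * A), mul_pow (2 * A * t)]
    ring_nf
  · have hΓ := Real.Gamma_pos_of_pos (show (0 : ℝ) < 1 + N / k by positivity)
    have : c ≤ Real.cos θ - (M + M') * W := by linarith
    have h0 : 0 ≤ 1 / (Real.cos θ - (M + M') * W) := one_div_nonneg.2 (by linarith)
    gcongr

end MonomialSummability

namespace MonomialSummability
open MeasureTheory Set Filter Topology

variable {E : Type*} [NormedAddCommGroup E] [NormedSpace ℂ E]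
variable {p q : ℕ} {k s : ℝ} {y : ℂ × ℂ × ℝ}

/-! ### Borel sums are sums in the monomial -/

theorem weightNorm_le (hk : 0 < k) (hs : 0 < s) (hs' : s < 1) {x : ℝ} (h1 : ‖y.1‖ ≤ x)
    (h2 : ‖y.2.1‖ ≤ x) : weightNorm p q k s y ≤ x ^ (p * k / s) + x ^ (q * k / (1 - s)) := by
  have hs1 : 0 < 1 - s := by linarith
  unfold weightNorm
  gcongr

theorem exists_weightNorm_bound (hp : 0 < p) (hq : 0 < q) (hk : 0 < k) (hs : 0 < s) (hs' : s < 1)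
    (M : ℝ) {c K r : ℝ} (hc : 0 < c) (hr : 0 < r) :
    ∃ x : ℝ, 0 < x ∧ M * (x ^ (p * k / s) + x ^ (q * k / (1 - s))) < c ∧
      x * Real.exp (s / (p * k) * K) < r ∧ x * Real.exp ((1 - s) / (q * k) * K) < r ∧ x < r := by
  have hp' : (0 : ℝ) < p := by exact_mod_cast hp
  have hq' : (0 : ℝ) < q := by exact_mod_cast hq
  have hs1 : 0 < 1 - s := by linarith
  have hlim : Tendsto (fun x : ℝ => M * (x ^ (p * k / s) + x ^ (q * k / (1 - s)))) (𝓝 0)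
      (𝓝 0) := by
    have h : Continuous fun x : ℝ => M * (x ^ (p * k / s) + x ^ (q * k / (1 - s))) :=
      continuous_const.mul ((continuous_id.rpow_const fun _ => Or.inr (by positivity)).add
        (continuous_id.rpow_const fun _ => Or.inr (by positivity)))
    have h0 := h.tendsto 0
    rwa [Real.zero_rpow (by positivity), Real.zero_rpow (by positivity), add_zero, mul_zero] at h0
  have hlin : ∀ b : ℝ, ∀ᶠ x : ℝ in 𝓝 0, x * b < r := fun b => by
    have h : Tendsto (fun x : ℝ => x * b) (𝓝 0) (𝓝 (0 * b)) := (continuous_mul_const b).tendsto 0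
    rw [zero_mul] at h
    exact h.eventually_lt_const hr
  have hall := (hlim.eventually_lt_const hc).and ((hlin (Real.exp (s / (p * k) * K))).and
    ((hlin (Real.exp ((1 - s) / (q * k) * K))).and (hlin 1)))
  obtain ⟨x, ⟨h1, h2, h3, h4⟩, h5⟩ :=
    ((hall.filter_mono nhdsWithin_le_nhds).and (self_mem_nhdsWithin (s := Ioi (0 : ℝ)))).exists
  exact ⟨x, h5, h1, h2, h3, by simpa using h4⟩

theorem abs_clamp_le {Θ : ℝ} (hΘ : 0 ≤ Θ) (x : ℝ) : |max (-Θ) (min Θ x)| ≤ Θ := by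
  rw [abs_le]
  exact ⟨le_max_left _ _, max_le (by linarith) (min_le_left _ _)⟩

theorem abs_sub_clamp_le {Θ x b : ℝ} (hb : 0 ≤ b) (hx : |x| ≤ Θ + b) :
    |x - max (-Θ) (min Θ x)| ≤ b := by
  rw [abs_le] at hx ⊢
  rcases le_total Θ x with h | h
  · rw [min_eq_left h]
    rcases le_total (-Θ) Θ with h' | h'
    · rw [max_eq_right h']; constructor <;> linarith
    · rw [max_eq_left h']; constructor <;> linarith
  · rw [min_eq_right h]
    rcases le_total (-Θ) x with h' | h'
    · rw [max_eq_right h']; constructor <;> linarith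
    · rw [max_eq_left h']; constructor <;> linarith

/-- The sum at argument ω is computed in the direction θ, |θ| ≤ Θ, that brings ω + θ/k closest to d.
With Θ near π/2 this works for |ω - d| slightly beyond π/(2k), while cos θ ≥ cos Θ keeps all the
estimates uniform. -/
theorem IsBorelContinuation.exists_isMonomialSum [CompleteSpace E] (hp : 0 < p) (hq : 0 < q)
    (hk : 0 < k) (hs : 0 < s) (hs' : s < 1) {a : ℕ × ℕ → E} (ha : IsMonomialGevrey p q (1 / k) a)
    {d ε : ℝ} {φ : ℂ × ℂ × ℝ → E} (hφ : IsBorelContinuation p q k s a d ε φ) :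
    ∃ (α β r Θ : ℝ) (f : ℂ × ℂ × ℝ → E), IsMonomialSum p q k a d α β r f ∧ Θ < Real.pi / 2 ∧
      ∀ y ∈ boundedSector p q α β r, ∃ θ : ℝ, |θ| ≤ Θ ∧ |y.2.2 + θ / k - d| < ε / 2 ∧
        y ∈ laplaceDomain p q k s θ φ (d - ε) (d + ε) ∧ f y = borelSum p q k s θ φ y := by
  have hε : 0 < ε := hφ.1
  have hs1 : 0 < 1 - s := by linarith
  have hpi := Real.pi_pos
  obtain ⟨r₀, C₀, A₀, hr₀, hC₀, hA₀, hco'⟩ := ha.exists_norm_coeff_le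
  have hco : CoeffBound p q (1 / k) a r₀ C₀ A₀ := ⟨hr₀, hC₀, hA₀, hco'⟩
  obtain ⟨A, M, hA, hM, hbt'⟩ := exists_norm_borelTerm_le hk hs hs' hp hq hr₀ hC₀ hA₀ hco'
  have hbt : BorelTermBound p q k s a C₀ A M := ⟨hC₀, hA, hM, hbt'⟩
  obtain ⟨C', M', hC', hM', hexp⟩ := hφ.2.2.2 (d - ε / 2) (d + ε / 2) (by linarith) (by linarith)
    (by linarith)
  -- Stopping δ short of π/2 loses δ/k ≤ ε/8 of argument. Together with the extra ε/8 of the sector,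
  -- ω + θ/k stays within ε/4 of d.
  set δ := min (k * ε / 8) (Real.pi / 4) with hδ
  have hδ0 : 0 < δ := by positivity
  have hδ1 : δ ≤ k * ε / 8 := min_le_left _ _
  have hδ2 : δ ≤ Real.pi / 4 := min_le_right _ _
  set Θ := Real.pi / 2 - δ with hΘ
  have hΘ0 : 0 ≤ Θ := by linarith
  have hΘ1 : Θ < Real.pi / 2 := by linarith
  set c := Real.cos Θ with hc
  have hc0 : 0 < c := Real.cos_pos_of_mem_Ioo ⟨by linarith, hΘ1⟩
  -- Points of modulus at most x leave half of c as decay rate and, enlarged by the factor 1/c in u,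
  -- remain where the f_n are controlled.
  obtain ⟨x, hx, hxW, hxr1, hxr2, hxr⟩ := exists_weightNorm_bound (K := -Real.log c) hp hq hk hs hs'
    (M + M') (half_pos hc0) (half_pos hr₀)
  obtain ⟨r, hr, -, hrx1, hrx2⟩ := exists_radius p q hx one_pos
  set dir : ℝ → ℝ := fun ω => max (-Θ) (min Θ (k * (d - ω))) with hdir
  set f : ℂ × ℂ × ℝ → E := fun y => borelSum p q k s (dir y.2.2) φ y with hf
  have hdirΘ : ∀ ω, |dir ω| ≤ Θ := fun ω => abs_clamp_le hΘ0 _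
  have hcos : ∀ θ, |θ| ≤ Θ → c ≤ Real.cos θ := by
    intro θ h
    rw [← Real.cos_abs θ]
    exact Real.cos_le_cos_of_nonneg_of_le_pi (abs_nonneg _) (by linarith) h
  have hdirε : ∀ ω, |ω - d| < Real.pi / (2 * k) + ε / 8 → |ω + dir ω / k - d| < ε / 2 := by
    intro ω hω
    have h1 : |k * (d - ω)| ≤ Θ + k * ε / 4 := by
      rw [abs_mul, abs_of_pos hk, abs_sub_comm]
      have : k * |ω - d| < k * (Real.pi / (2 * k) + ε / 8) := by gcongr
      rw [mul_add, show k * (Real.pi / (2 * k)) = Real.pi / 2 by field_simp] at this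
      linarith
    have h2 := abs_sub_clamp_le (by positivity) h1
    have h3 : ω + dir ω / k - d = -((k * (d - ω) - dir ω) / k) := by field_simp; ring
    rw [h3, abs_neg, abs_div, abs_of_pos hk, div_lt_iff₀ hk]
    have : 0 < k * ε := by positivity
    calc |k * (d - ω) - dir ω| ≤ k * ε / 4 := h2
      _ < ε / 2 * k := by linarith
  have hdirI : ∀ ω, |ω - d| < Real.pi / (2 * k) + ε / 8 →
      d - ε / 2 < ω + dir ω / k ∧ ω + dir ω / k < d + ε / 2 := fun ω hω => by
    have := abs_lt.1 (hdirε ω hω)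
    constructor <;> linarith
  set b := Real.pi / (2 * k) + ε / 8 with hb
  have hpik : 0 < Real.pi / (2 * k) := by positivity
  have habs : ∀ y ∈ boundedSector p q (d - b) (d + b) r, |y.2.2 - d| < b := fun y hy =>
    abs_lt.2 ⟨by linarith [hy.1.2.1], by linarith [hy.1.2.2]⟩
  have hsmall : ∀ y ∈ boundedSector p q (d - b) (d + b) r, ‖y.1‖ ≤ x ∧ ‖y.2.1‖ ≤ x :=
    fun y hy => ⟨hrx1 _ (norm_nonneg _) hy.2.1, hrx2 _ (norm_nonneg _) hy.2.2⟩
  have hW : ∀ y ∈ boundedSector p q (d - b) (d + b) r,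
      (M + M') * weightNorm p q k s y < c / 2 := fun y hy =>
    lt_of_le_of_lt (by
      gcongr
      exact weightNorm_le hk hs hs' (hsmall y hy).1 (hsmall y hy).2) hxW
  have hW' : ∀ y ∈ boundedSector p q (d - b) (d + b) r, M' * weightNorm p q k s y < c :=
    fun y hy => by
      have h1 := hW y hy
      have h2 : 0 ≤ M * weightNorm p q k s y := mul_nonneg hM.le weightNorm_nonneg
      linarith
  have hlap : ∀ y ∈ boundedSector p q (d - b) (d + b) r,
      y ∈ laplaceDomain p q k s (dir y.2.2) φ (d - ε) (d + ε) := fun y hy =>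
    ⟨hy.1.1, d - ε / 2, d + ε / 2, C', M', by linarith, by linarith, (hdirI _ (habs y hy)).1,
      (hdirI _ (habs y hy)).2, hC', hM', hexp,
      (hW' y hy).trans_le (hcos _ (hdirΘ _))⟩
  refine ⟨d - b, d + b, r, Θ, f, ⟨by ring, ?_, hr, ?_, r, hr, le_rfl, fun n => ?_, ?_⟩, hΘ1,
    fun y hy => ⟨dir y.2.2, hdirΘ _, hdirε _ (habs y hy), hlap y hy, rfl⟩⟩
  · rw [hb, show Real.pi / k = 2 * (Real.pi / (2 * k)) by field_simp]
    linarith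
  · refine (isHolomorphicOn_iff (isActOpen_boundedSector _ _ _).1).2 fun y hy => ?_
    have h1 := (isHolomorphicOn_iff (fun y hy => hy.1)).1
      (isHolomorphicOn_borelSum hp hq hk hs hs' hφ.2.1 (dir y.2.2)) y (hlap y hy)
    -- The direction varies with ω, and not holomorphically, but rotating the ray shows that nearby
    -- points may all use the direction of the centre.
    refine h1.congr_of_eventuallyEq ?_
    filter_upwards [(isActOpen_boundedSector _ _ _).2 y hy,
      eventually_act_mem (p := p) (q := q) hk hs hs' (hdirI _ (habs y hy)).1
        (hdirI _ (habs y hy)).2 (hW' y hy)] with w hw hw'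
    have h2 := hdirI _ (habs _ hw)
    exact borelSum_eq_borelSum hp hq hk hs hs' hφ.2.1 (by linarith) (by linarith) hexp hw.1.1 hΘ1
      (hdirΘ _) (hdirΘ _) h2.1 h2.2 hw'.1 hw'.2.1 hw'.2.2
  · refine ⟨4 * (C₀ * A₀ ^ n * (n.factorial : ℝ) ^ (1 / k)), fun x₁ x₂ h1 h2 => ?_⟩
    exact hco.summable_coeffTerm ((hrx1 _ (norm_nonneg _) h1).trans hxr.le)
      ((hrx2 _ (norm_nonneg _) h2).trans hxr.le) n
  · intro α' β' ρ h1 _ h3 _ h4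
    set B := (2 * Real.exp 1 / k) ^ (1 / k) with hB
    refine ⟨(C' + 8 * C₀) * (1 / (c / 2)) * 2, 2 * A * (1 / (c / 2)) ^ (1 / k) * B, by positivity,
      by positivity, fun N y hy => ?_⟩
    have hy' := boundedSector_mono h1.le h3.le h4.le hy
    have hθ := hdirΘ y.2.2
    set θ := dir y.2.2 with hθdef
    have hcosθ := hcos θ hθ
    have hlog : ((-Real.log (Real.cos θ) : ℝ) : ℂ).re ≤ ((-Real.log c : ℝ) : ℂ).re := by
      simp only [Complex.ofReal_re, neg_le_neg_iff]
      exact Real.log_le_log hc0 hcosθ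
    have hle := norm_dil_le_of_re_le (p := p) (q := q) (y := y) hk hs hs' hlog
    have hd1 : ‖(dil p q k s (-Real.log c : ℝ) y).1‖ ≤ r₀ / 2 := by
      rw [norm_dil_fst, Complex.ofReal_re]
      refine le_trans ?_ hxr1.le
      gcongr
      exact (hsmall y hy').1
    have hd2 : ‖(dil p q k s (-Real.log c : ℝ) y).2.1‖ ≤ r₀ / 2 := by
      rw [norm_dil_snd, Complex.ofReal_re]
      refine le_trans ?_ hxr2.le
      gcongr
      exact (hsmall y hy').2
    have hest := hφ.norm_borelSum_sub_le hp hq hk hs hs' hco hbt (by linarith) (by linarith) hC'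
      hM' hexp hy.1.1 (hθ.trans_lt hΘ1) (hdirI _ (habs y hy')).1 (hdirI _ (habs y hy')).2
      (hle.1.trans hd1) (hle.2.trans hd2) (half_pos hc0) (by linarith [hW y hy']) N
    refine hest.trans ?_
    have hΓ := Gamma_le_factorial_rpow hk N
    have hpow : (1 / (c / 2)) ^ (1 + N / k) = 1 / (c / 2) * ((1 / (c / 2)) ^ (1 / k)) ^ N := by
      rw [Real.rpow_add (by positivity), Real.rpow_one, ← Real.rpow_mul_natCast (by positivity),
        one_div_mul_eq_div k]
    set t := ‖y.1 ^ p * y.2.1 ^ q‖ with ht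
    rw [hpow]
    calc (C' + 8 * C₀) * (2 * A * t) ^ N *
          (1 / (c / 2) * ((1 / (c / 2)) ^ (1 / k)) ^ N * Real.Gamma (1 + N / k))
        ≤ (C' + 8 * C₀) * (2 * A * t) ^ N * (1 / (c / 2) * ((1 / (c / 2)) ^ (1 / k)) ^ N *
          (2 * B ^ N * (N.factorial : ℝ) ^ (1 / k))) := by gcongr
      _ = _ := by simp only [mul_pow]; ring

/-! ### Uniqueness -/

theorem exists_dil_lt (hp : 0 < p) (hq : 0 < q) (hk : 0 < k) (hs : 0 < s) (hs' : s < 1)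
    (y : ℂ × ℂ × ℝ) {r : ℝ} (hr : 0 < r) :
    ∃ X : ℝ, X ≤ 0 ∧ ∀ ζ : ℂ, ζ.re ≤ X → ‖(dil p q k s ζ y).1‖ ≤ r ∧
      ‖(dil p q k s ζ y).2.1‖ ≤ r := by
  have hp' : (0 : ℝ) < p := by exact_mod_cast hp
  have hq' : (0 : ℝ) < q := by exact_mod_cast hq
  have hs1 : 0 < 1 - s := by linarith
  have hlim : ∀ (c b : ℝ), 0 < c → Tendsto (fun x : ℝ => b * Real.exp (c * x)) atBot (𝓝 0) := by
    intro c b hc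
    have h1 : Tendsto (fun x : ℝ => c * x) atBot atBot := tendsto_id.const_mul_atBot hc
    simpa using (Real.tendsto_exp_atBot.comp h1).const_mul b
  have e1 := (hlim (s / (p * k)) ‖y.1‖ (by positivity)).eventually_lt_const hr
  have e2 := (hlim ((1 - s) / (q * k)) ‖y.2.1‖ (by positivity)).eventually_lt_const hr
  obtain ⟨X, hX⟩ := eventually_atBot.1 (e1.and e2)
  refine ⟨min X 0, min_le_right _ _, fun ζ hζ => ?_⟩
  rw [norm_dil_fst, norm_dil_snd]
  have := hX _ (hζ.trans (min_le_left _ _))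
  exact ⟨this.1.le, this.2.le⟩

theorem exists_dil_pow_lt (hp : 0 < p) (hq : 0 < q) (hk : 0 < k) (hs : 0 < s) (hs' : s < 1)
    (y : ℂ × ℂ × ℝ) {r : ℝ} (hr : 0 < r) :
    ∃ X : ℝ, X ≤ 0 ∧ ∀ ζ : ℂ, ζ.re ≤ X → ‖(dil p q k s ζ y).1‖ ^ p < r ∧
      ‖(dil p q k s ζ y).2.1‖ ^ q < r := by
  obtain ⟨X, hX, h⟩ := exists_dil_lt hp hq hk hs hs' y (r := min (r / 2) 1) (by positivity)
  have key : ∀ (n : ℕ), 0 < n → ∀ x : ℝ, 0 ≤ x → x ≤ min (r / 2) 1 → x ^ n < r := by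
    intro n hn x hx hxr
    calc x ^ n ≤ x := pow_le_of_le_one hx (hxr.trans (min_le_right _ _)) hn.ne'
      _ ≤ r / 2 := hxr.trans (min_le_left _ _)
      _ < r := by linarith
  exact ⟨X, hX, fun ζ hζ => ⟨key p hp _ (norm_nonneg _) (h ζ hζ).1,
    key q hq _ (norm_nonneg _) (h ζ hζ).2⟩⟩

theorem exists_dil_weightNorm_lt (hp : 0 < p) (hq : 0 < q) (hk : 0 < k) (hs : 0 < s) (hs' : s < 1)
    {s' : ℝ} (h0 : 0 < s') (h1 : s' < 1) (y : ℂ × ℂ × ℝ) {M c : ℝ} (hM : 0 ≤ M) (hc : 0 < c) :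
    ∃ X : ℝ, X ≤ 0 ∧ ∀ ζ : ℂ, ζ.re ≤ X → M * weightNorm p q k s' (dil p q k s ζ y) < c := by
  obtain ⟨x, hx, hxM, -⟩ := exists_weightNorm_bound (K := 0) hp hq hk h0 h1 M hc one_pos
  obtain ⟨X, hX, h⟩ := exists_dil_lt hp hq hk hs hs' y hx
  refine ⟨X, hX, fun ζ hζ => lt_of_le_of_lt ?_ hxM⟩
  gcongr
  exact weightNorm_le hk h0 h1 (h ζ hζ).1 (h ζ hζ).2

theorem IsMonomialSum.exists_bound {a : ℕ × ℕ → E} {d α β r b : ℝ}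
    {f : ℂ × ℂ × ℝ → E} (h : IsMonomialSum p q k a d α β r f) (hb : 0 < b)
    (hb' : b < (β - α) / 2) :
    ∃ ρ C A : ℝ, 0 < ρ ∧ 0 < C ∧ 0 < A ∧
      IsHolomorphicOn p q f (boundedSector p q (d - b) (d + b) ρ) ∧
      ∀ N : ℕ, ∀ y ∈ boundedSector p q (d - b) (d + b) ρ,
        ‖f y - ∑ n ∈ Finset.range N, (y.1 ^ p * y.2.1 ^ q) ^ n • coeffFun p q a n y.1 y.2.1‖
          ≤ C * A ^ N * (N.factorial : ℝ) ^ (1 / k) * ‖y.1 ^ p * y.2.1 ^ q‖ ^ N := by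
  obtain ⟨hd, -, hr, hhol, hexp⟩ := h
  obtain ⟨ρ, C, A, hρ, hρr, hC, hA, -, -, hb⟩ := hexp.exists_bound (α' := d - b) (β' := d + b)
    (by linarith) (by linarith) (by linarith) one_pos
  exact ⟨ρ, C, A, hρ, hC, hA, fun y hy =>
    hhol y (boundedSector_mono (by linarith) (by linarith) hρr.le hy), hb⟩

/-- On the orbit the difference of the two sums satisfies the bounds of Watson's lemma. Openings
larger than π/k become strips wider than π in ζ, because the argument of the monomial is Im ζ / k.
-/
theorem IsMonomialSum.exists_eq [CompleteSpace E] (hp : 0 < p) (hq : 0 < q) (hk : 0 < k)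
    (hs : 0 < s) (hs' : s < 1) {a : ℕ × ℕ → E} {d α β r α' β' r' : ℝ} {f f' : ℂ × ℂ × ℝ → E}
    (h : IsMonomialSum p q k a d α β r f) (h' : IsMonomialSum p q k a d α' β' r' f')
    (hy : y ∈ surface p q) (hω : |y.2.2 - d| < Real.pi / (2 * k)) :
    ∃ X : ℝ, ∀ x : ℝ, x < X → f (dil p q k s x y) = f' (dil p q k s x y) := by
  have hpik : Real.pi / k = 2 * (Real.pi / (2 * k)) := by field_simp
  have hpos : 0 < Real.pi / (2 * k) := by have := Real.pi_pos; positivity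
  obtain ⟨b, hb1, hb2⟩ := exists_between (show Real.pi / (2 * k) <
    min ((β - α) / 2) ((β' - α') / 2) from
      lt_min (by linarith [h.2.1]) (by linarith [h'.2.1]))
  obtain ⟨ρ, C, A, hρ, hC, hA, hhol, hbd⟩ := h.exists_bound (b := b) (by linarith)
    (hb2.trans_le (min_le_left _ _))
  obtain ⟨ρ', C', A', hρ', hC', hA', hhol', hbd'⟩ := h'.exists_bound (b := b) (by linarith)
    (hb2.trans_le (min_le_right _ _))
  obtain ⟨X₀, -, hX₀⟩ := exists_dil_pow_lt hp hq hk hs hs' y (r := min ρ ρ') (by positivity)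
  -- The base point is moved to the bisecting argument d and to small moduli, so that the half-strip
  -- of Watson's lemma is symmetric and lies in both domains.
  set ζ₀ : ℂ := X₀ + (k * (d - y.2.2) : ℝ) * Complex.I with hζ₀
  set y₀ := dil p q k s ζ₀ y with hy₀
  have hy₀s : y₀ ∈ surface p q := dil_mem_surface hy _
  have hy₀n := hX₀ ζ₀ (by simp [hζ₀])
  have hy₀d : y₀.2.2 = d := by
    rw [hy₀, dil_arg hp hq]
    simp only [hζ₀, Complex.add_im, Complex.ofReal_im, Complex.im_ofReal_mul, Complex.I_im]
    field_simp
    ring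
  set η := k * b with hη
  have hη2 : Real.pi / 2 < η := by
    have : k * (Real.pi / (2 * k)) < k * b := by gcongr
    rwa [show k * (Real.pi / (2 * k)) = Real.pi / 2 by field_simp] at this
  have hmem : ∀ τ ∈ (Iio 0 ×ℂ Ioo (-η) η : Set ℂ),
      dil p q k s τ y₀ ∈ boundedSector p q (d - b) (d + b) ρ ∧
      dil p q k s τ y₀ ∈ boundedSector p q (d - b) (d + b) ρ' := by
    rintro τ ⟨h1, h2, h3⟩
    have e1 : -b < τ.im / k := by
      rw [lt_div_iff₀ hk]
      linarith
    have e2 : τ.im / k < b := by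
      rw [div_lt_iff₀ hk]
      linarith
    have h1' : τ.re ≤ 0 := le_of_lt h1
    constructor
    · exact dil_mem_boundedSector hp hq hk hs hs' hy₀s (hy₀n.1.trans_le (min_le_left _ _))
        (hy₀n.2.trans_le (min_le_left _ _)) h1' (by linarith) (by linarith)
    · exact dil_mem_boundedSector hp hq hk hs hs' hy₀s (hy₀n.1.trans_le (min_le_right _ _))
        (hy₀n.2.trans_le (min_le_right _ _)) h1' (by linarith) (by linarith)
  set t := ‖y₀.1 ^ p * y₀.2.1 ^ q‖ with ht
  have ht0 : 0 < t := norm_pos_iff.2 (mul_ne_zero (pow_ne_zero _ hy₀s.1) (pow_ne_zero _ hy₀s.2.1))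
  have hσ : |k * (y.2.2 - d)| < Real.pi / 2 := by
    rw [abs_mul, abs_of_pos hk]
    have : k * |y.2.2 - d| < k * (Real.pi / (2 * k)) := by gcongr
    rwa [show k * (Real.pi / (2 * k)) = Real.pi / 2 by field_simp] at this
  obtain ⟨X, hX⟩ := watson (Δ := fun τ => f (dil p q k s τ y₀) - f' (dil p q k s τ y₀))
    (k := k) (C := C + C') (A := max A A' * t) hη2 hk (by positivity) (by positivity)
    (fun τ hτ => ((hhol.differentiableAt_dil (isActOpen_boundedSector _ _ _).1 (hmem τ hτ).1).sub
      (hhol'.differentiableAt_dil (isActOpen_boundedSector _ _ _).1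
        (hmem τ hτ).2)).differentiableWithinAt)
    (fun N τ hτ => by
      have b1 := hbd N _ (hmem τ hτ).1
      have b2 := hbd' N _ (hmem τ hτ).2
      rw [← sub_sub_sub_cancel_right _ _ (∑ n ∈ Finset.range N,
        ((dil p q k s τ y₀).1 ^ p * (dil p q k s τ y₀).2.1 ^ q) ^ n •
          coeffFun p q a n (dil p q k s τ y₀).1 (dil p q k s τ y₀).2.1)]
      refine (norm_sub_le_of_le b1 b2).trans ?_
      rw [norm_monomial_dil hp hq, ← ht, Real.exp_nat_mul]
      have m1 : A ≤ max A A' := le_max_left _ _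
      have m2 : A' ≤ max A A' := le_max_right _ _
      calc C * A ^ N * (N.factorial : ℝ) ^ (1 / k) * (t * Real.exp (τ.re / k)) ^ N +
            C' * A' ^ N * (N.factorial : ℝ) ^ (1 / k) * (t * Real.exp (τ.re / k)) ^ N
          ≤ C * max A A' ^ N * (N.factorial : ℝ) ^ (1 / k) * (t * Real.exp (τ.re / k)) ^ N +
            C' * max A A' ^ N * (N.factorial : ℝ) ^ (1 / k) * (t * Real.exp (τ.re / k)) ^ N := by
            gcongr
        _ = _ := by simp only [mul_pow]; ring) hσ
  refine ⟨X + X₀, fun x hx => ?_⟩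
  have h1 := hX (x - X₀) (by linarith)
  have h2 : dil p q k s (((x - X₀ : ℝ) : ℂ) + (k * (y.2.2 - d) : ℝ) * Complex.I) y₀ =
      dil p q k s x y := by
    rw [hy₀, ← dil_add]
    congr 1
    rw [hζ₀]
    push_cast
    ring
  rw [h2] at h1
  exact sub_eq_zero.1 h1

/-- On small points the Borel sum in direction `θ` is equal to every sum in the monomial. -/
theorem IsBorelContinuation.exists_borelSum_eq [CompleteSpace E] (hp : 0 < p) (hq : 0 < q)
    (hk : 0 < k) (hs : 0 < s) (hs' : s < 1) {s₀ : ℝ} (hs₀ : 0 < s₀) (hs₀' : s₀ < 1)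
    {a : ℕ × ℕ → E} (ha : IsMonomialGevrey p q (1 / k) a)
    {d ε α β r θ : ℝ} {φ f : ℂ × ℂ × ℝ → E} (hφ : IsBorelContinuation p q k s a d ε φ)
    (hf : IsMonomialSum p q k a d α β r f) (hθ : |θ| < Real.pi / 2)
    (hy : y ∈ surface p q) (hω : |y.2.2 - d| < Real.pi / (2 * k))
    (hωθ : |y.2.2 + θ / k - d| < ε) :
    ∃ X : ℝ, ∀ x : ℝ, x < X →
      borelSum p q k s θ φ (dil p q k s₀ x y) = f (dil p q k s₀ x y) := by
  obtain ⟨α', β', r', Θ, f', hf', hΘ, hf'eq⟩ := hφ.exists_isMonomialSum hp hq hk hs hs' ha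
  have hε := hφ.1
  obtain ⟨X₁, hX₁⟩ := hf'.exists_eq hp hq hk hs₀ hs₀' hf hy hω
  obtain ⟨X₂, -, hX₂⟩ := exists_dil_pow_lt hp hq hk hs₀ hs₀' y hf'.2.2.1
  -- One subsector must contain the ray in direction θ and the ray used by the constructed sum,
  -- which is only known to stay within ε/2 of d.
  obtain ⟨ε', h1, h2⟩ := exists_between (max_lt hωθ (half_lt_self hε))
  have hε' : 0 < ε' := (half_pos hε).trans ((le_max_right _ _).trans_lt h1)
  obtain ⟨C, M, hC, hM, hexp⟩ := hφ.2.2.2 (d - ε') (d + ε') (by linarith) (by linarith)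
    (by linarith)
  have hΘ' : max Θ |θ| < Real.pi / 2 := max_lt hΘ hθ
  have hcos : 0 < Real.cos (max Θ |θ|) := Real.cos_pos_of_mem_Ioo
    ⟨by linarith [abs_nonneg θ, le_max_right Θ |θ|, Real.pi_pos], hΘ'⟩
  obtain ⟨X₃, -, hX₃⟩ := exists_dil_weightNorm_lt hp hq hk hs₀ hs₀' hs hs' y hM.le hcos
  refine ⟨min X₁ (min X₂ X₃), fun x hx => ?_⟩
  obtain ⟨hx1, hx2, hx3⟩ : x < X₁ ∧ x < X₂ ∧ x < X₃ := by simpa using hx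
  rw [← hX₁ x hx1]
  have harg : (dil p q k s₀ x y).2.2 = y.2.2 := by
    rw [dil_arg hp hq]
    simp
  have hpik : Real.pi / k = 2 * (Real.pi / (2 * k)) := by field_simp
  have hω' := abs_lt.1 hω
  have hmem : dil p q k s₀ x y ∈ boundedSector p q α' β' r' := by
    have hd := hf'.1
    have hop := hf'.2.1
    have := hX₂ x (by simpa using hx2.le)
    exact ⟨dil_mem_sector hp hq hy (by simp; linarith) (by simp; linarith), this.1, this.2⟩
  obtain ⟨θ', t1, t2, -, t4⟩ := hf'eq _ hmem
  rw [t4]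
  have u1 := abs_lt.1 (((le_max_left _ _).trans_lt h1) : _ < ε')
  have u2 := abs_lt.1 (t2.trans ((le_max_right _ _).trans_lt h1))
  rw [← harg] at u1
  exact borelSum_eq_borelSum hp hq hk hs hs' hφ.2.1 (by linarith) (by linarith) hexp
    (dil_mem_surface hy _) hΘ' (le_max_right _ _) (t1.trans (le_max_left _ _)) (by linarith)
    (by linarith) (by linarith) (by linarith) (hX₃ x (by simpa using hx3.le))

end MonomialSummability

/-! ### Coincidence of sums by analytic continuation. -/

namespace MonomialSummability
open MeasureTheory Set Filter Topology

variable {E : Type*} [NormedAddCommGroup E] [NormedSpace ℂ E]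
variable {p q : ℕ} {k s : ℝ} {y : ℂ × ℂ × ℝ}

theorem convex_reProdIm {A B : Set ℝ} (hA : Convex ℝ A) (hB : Convex ℝ B) : Convex ℝ (A ×ℂ B) :=
  (hA.is_linear_preimage Complex.reLm.isLinear).inter
    (hB.is_linear_preimage Complex.imLm.isLinear)

/-- Analytic continuation along a path that first tends to the origin and then turns around it. -/
theorem eq_of_exists_eq_dil [CompleteSpace E] {S S' : Set (ℂ × ℂ × ℝ)} (hS : IsActOpen p q S)
    (hS' : IsActOpen p q S') {g g' : ℂ × ℂ × ℝ → E} (hg : IsHolomorphicOn p q g S)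
    (hg' : IsHolomorphicOn p q g' S') {σ X₀ : ℝ} (hX₀ : X₀ ≤ 0)
    (h0 : ∀ x : ℝ, x ≤ 0 → dil p q k s x y ∈ S ∧ dil p q k s x y ∈ S')
    (h1 : ∀ ζ : ℂ, ζ.re ≤ X₀ → ζ.im ∈ uIcc 0 σ → dil p q k s ζ y ∈ S ∧ dil p q k s ζ y ∈ S')
    (heq : ∃ X : ℝ, ∀ x : ℝ, x < X →
      g (dil p q k s (x + σ * Complex.I) y) = g' (dil p q k s (x + σ * Complex.I) y)) :
    g y = g' y := by
  -- A half-line from the given point towards the origin, joined at X₀ to a half-strip in which the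
  -- argument may turn. No turning is required at the moduli of the original point, where the
  -- domains may be too narrow.
  set U₁ : Set ℂ := Iic 0 ×ℂ {0} with hU₁
  set U₂ : Set ℂ := Iic X₀ ×ℂ uIcc 0 σ with hU₂
  have hpre : IsPreconnected (U₁ ∪ U₂) :=
    IsPreconnected.union (X₀ : ℂ) ⟨by simpa using hX₀, by simp⟩ ⟨by simp, by simp⟩
      (convex_reProdIm (convex_Iic 0) (convex_singleton 0)).isPreconnected
      (convex_reProdIm (convex_Iic X₀) (convex_uIcc 0 σ)).isPreconnected
  have hmem : ∀ ζ ∈ U₁ ∪ U₂, dil p q k s ζ y ∈ S ∧ dil p q k s ζ y ∈ S' := by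
    rintro ζ (⟨h2, h3⟩ | ⟨h2, h3⟩)
    · have : ζ = (ζ.re : ℂ) := Complex.ext rfl (by simpa using h3)
      rw [this]
      exact h0 _ h2
    · exact h1 ζ h2 h3
  have han : AnalyticOnNhd ℂ (fun ζ => g (dil p q k s ζ y)) (U₁ ∪ U₂) := fun ζ hζ =>
    hg.analyticAt_dil hS (hmem ζ hζ).1
  have han' : AnalyticOnNhd ℂ (fun ζ => g' (dil p q k s ζ y)) (U₁ ∪ U₂) := fun ζ hζ =>
    hg'.analyticAt_dil hS' (hmem ζ hζ).2
  obtain ⟨X, hX⟩ := heq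
  set x₀ : ℝ := min X₀ (X - 1) with hx₀
  have hx₀X : x₀ < X := (min_le_right _ _).trans_lt (by linarith)
  have hz₀ : (x₀ + σ * Complex.I : ℂ) ∈ U₁ ∪ U₂ :=
    Or.inr ⟨by simp [hx₀], by simp⟩
  -- Equality is known only on a real ray, which accumulates at x₀ + iσ; that suffices for the
  -- identity theorem.
  have hfreq : ∃ᶠ ζ in 𝓝[≠] (x₀ + σ * Complex.I : ℂ),
      g (dil p q k s ζ y) = g' (dil p q k s ζ y) := by
    have ht : Tendsto (fun x : ℝ => (x + σ * Complex.I : ℂ)) (𝓝[≠] x₀)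
        (𝓝[≠] (x₀ + σ * Complex.I : ℂ)) := by
      refine tendsto_nhdsWithin_iff.2 ⟨?_, ?_⟩
      · have : Continuous fun x : ℝ => (x + σ * Complex.I : ℂ) := by fun_prop
        exact (this.tendsto x₀).mono_left nhdsWithin_le_nhds
      · filter_upwards [self_mem_nhdsWithin] with x hx
        simpa using hx
    refine ht.frequently (Eventually.frequently ?_)
    filter_upwards [nhdsWithin_le_nhds (Iio_mem_nhds hx₀X)] with x hx using hX x hx
  have h := han.eqOn_of_preconnected_of_frequently_eq han' hpre hz₀ hfreq
    (show (0 : ℂ) ∈ U₁ ∪ U₂ from Or.inl ⟨by simp, by simp⟩)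
  simpa using h

theorem add_div_mem_Ioo (hk : 0 < k) {u t σ a b : ℝ} (h0 : u ∈ Ioo a b) (h1 : u + σ / k ∈ Ioo a b)
    (ht : t ∈ uIcc 0 σ) : u + t / k ∈ Ioo a b := by
  rcases le_total 0 σ with h | h
  · rw [uIcc_of_le h] at ht
    have e1 : 0 ≤ t / k := div_nonneg ht.1 hk.le
    have e2 : t / k ≤ σ / k := by gcongr; exact ht.2
    exact ⟨by linarith [h0.1], by linarith [h1.2]⟩
  · rw [uIcc_of_ge h] at ht
    have e1 : t / k ≤ 0 := div_nonpos_of_nonpos_of_nonneg ht.2 hk.le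
    have e2 : σ / k ≤ t / k := by gcongr; exact ht.1
    exact ⟨by linarith [h1.1], by linarith [h0.2]⟩

theorem abs_arg_sub_lt_of_mem_laplaceDomain {V : Type*} [NormedAddCommGroup V] {θ d ε : ℝ}
    {φ : ℂ × ℂ × ℝ → V} (hy : y ∈ laplaceDomain p q k s θ φ (d - ε) (d + ε)) :
    |y.2.2 + θ / k - d| < ε := by
  obtain ⟨-, α', β', C, M, hα, hβ, h1, h2, -⟩ := hy
  exact abs_lt.2 ⟨by linarith, by linarith⟩

/-- Both moduli shrink and the argument is fixed for any weight s₀. One orbit can therefore serve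
two Laplace domains with different weights. -/
theorem dil_mem_laplaceDomain {V : Type*} [NormedAddCommGroup V] (hp : 0 < p) (hq : 0 < q)
    (hk : 0 < k) (hs : 0 < s) (hs' : s < 1) {s₀ : ℝ} (hs₀ : 0 < s₀) (hs₀' : s₀ < 1)
    {θ α β : ℝ} {φ : ℂ × ℂ × ℝ → V}
    (hy : y ∈ laplaceDomain p q k s θ φ α β) {x : ℝ} (hx : x ≤ 0) :
    dil p q k s₀ x y ∈ laplaceDomain p q k s θ φ α β := by
  obtain ⟨hy, α', β', C, M, hα, hβ, h1, h2, hC, hM, hexp, h3⟩ := hy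
  have hs1 : 0 < 1 - s := by linarith
  have hle := norm_dil_le_of_re_le (p := p) (q := q) (y := y) hk hs₀ hs₀' (ζ := x) (ζ' := 0)
    (by simpa using hx)
  rw [dil_zero] at hle
  have harg : (dil p q k s₀ x y).2.2 = y.2.2 := by
    rw [dil_arg hp hq]
    simp
  refine ⟨dil_mem_surface hy _, α', β', C, M, hα, hβ, by rwa [harg], by rwa [harg], hC, hM, hexp,
    lt_of_le_of_lt ?_ h3⟩
  gcongr
  · exact hle.1
  · exact hle.2

theorem IsBorelContinuation.exists_dil_mem_laplaceDomain (hp : 0 < p) (hq : 0 < q) (hk : 0 < k)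
    (hs : 0 < s) (hs' : s < 1) {s₀ : ℝ} (hs₀ : 0 < s₀) (hs₀' : s₀ < 1) {a : ℕ × ℕ → E}
    {d ε θ σ : ℝ} {φ : ℂ × ℂ × ℝ → E} (hφ : IsBorelContinuation p q k s a d ε φ)
    (hθ : |θ| < Real.pi / 2) (hy : y ∈ surface p q) (h1 : |y.2.2 + θ / k - d| < ε)
    (h2 : |y.2.2 + σ / k + θ / k - d| < ε) :
    ∃ X₀ : ℝ, X₀ ≤ 0 ∧ ∀ ζ : ℂ, ζ.re ≤ X₀ → ζ.im ∈ uIcc 0 σ →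
      dil p q k s₀ ζ y ∈ laplaceDomain p q k s θ φ (d - ε) (d + ε) := by
  obtain ⟨ε', e1, e2⟩ := exists_between (max_lt h1 h2)
  obtain ⟨e3, e4⟩ := max_lt_iff.1 e1
  have hε' : 0 < ε' := (abs_nonneg _).trans_lt e3
  obtain ⟨C, M, hC, hM, hexp⟩ := hφ.2.2.2 (d - ε') (d + ε') (by linarith) (by linarith)
    (by linarith)
  obtain ⟨X₀, hX₀, hX⟩ := exists_dil_weightNorm_lt hp hq hk hs₀ hs₀' hs hs' y hM.le
    (Real.cos_pos_of_mem_Ioo (abs_lt.1 hθ))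
  refine ⟨X₀, hX₀, fun ζ h3 h4 => ?_⟩
  rw [abs_lt] at e3 e4
  have h5 := add_div_mem_Ioo hk (u := y.2.2 + θ / k) (a := d - ε') (b := d + ε')
    ⟨by linarith, by linarith⟩ ⟨by linarith, by linarith⟩ h4
  refine ⟨dil_mem_surface hy _, d - ε', d + ε', C, M, by linarith, by linarith, ?_, ?_, hC, hM,
    hexp, hX ζ h3⟩
  · rw [dil_arg hp hq]; linarith [h5.1]
  · rw [dil_arg hp hq]; linarith [h5.2]

/-- Close to the origin the argument can be turned to d - θ/k: there the ray has its arguments at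
the centre d of the sector of φ, and the distance to d is less than π/(2k) because |θ| < π/2, so
uniqueness applies. -/
theorem IsBorelContinuation.borelSum_eq [CompleteSpace E] (hp : 0 < p) (hq : 0 < q) (hk : 0 < k)
    (hs : 0 < s) (hs' : s < 1) {a : ℕ × ℕ → E} (ha : IsMonomialGevrey p q (1 / k) a)
    {d ε α β r θ : ℝ} {φ f : ℂ × ℂ × ℝ → E} (hφ : IsBorelContinuation p q k s a d ε φ)
    (hf : IsMonomialSum p q k a d α β r f) (hθ : |θ| < Real.pi / 2)
    (hy : y ∈ laplaceDomain p q k s θ φ (d - ε) (d + ε)) (hy' : y ∈ boundedSector p q α β r) :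
    borelSum p q k s θ φ y = f y := by
  have hys : y ∈ surface p q := hy.1
  set σ := k * (d - y.2.2) - θ with hσ
  have hend : y.2.2 + σ / k = d - θ / k := by
    rw [hσ]
    field_simp
    ring
  have hθk : |θ / k| < Real.pi / (2 * k) := by
    rw [abs_div, abs_of_pos hk, ← div_div]
    gcongr
  have hpik : Real.pi / k = 2 * (Real.pi / (2 * k)) := by field_simp
  obtain ⟨hd, hop, -, hhol, -⟩ := id hf
  obtain ⟨X₀, hX₀, hX⟩ := hφ.exists_dil_mem_laplaceDomain hp hq hk hs hs' hs hs' (σ := σ) hθ hys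
    (abs_arg_sub_lt_of_mem_laplaceDomain hy) (by rw [hend]; simpa using hφ.1)
  have hθk' := abs_lt.1 hθk
  refine eq_of_exists_eq_dil (s := s) (σ := σ) (isActOpen_laplaceDomain hk hs hs' _ _ _ _)
    (isActOpen_boundedSector _ _ _) (isHolomorphicOn_borelSum hp hq hk hs hs' hφ.2.1 θ) hhol hX₀
    (fun x hx => ⟨dil_mem_laplaceDomain hp hq hk hs hs' hs hs' hy hx, ?_⟩)
    (fun ζ h1 h2 => ⟨hX ζ h1 h2, ?_⟩) ?_
  · exact dil_mem_boundedSector hp hq hk hs hs' hys hy'.2.1 hy'.2.2 (by simpa using hx)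
      (by simpa using hy'.1.2.1) (by simpa using hy'.1.2.2)
  · have h3 := add_div_mem_Ioo hk (a := α) (b := β) ⟨hy'.1.2.1, hy'.1.2.2⟩
      ⟨by linarith, by linarith⟩ h2
    exact dil_mem_boundedSector hp hq hk hs hs' hys hy'.2.1 hy'.2.2 (h1.trans hX₀) h3.1 h3.2
  · have harg : (dil p q k s (σ * Complex.I) y).2.2 = d - θ / k := by
      rw [dil_arg hp hq, ← hend]
      simp
    have h3 := hφ.exists_borelSum_eq hp hq hk hs hs' hs hs' ha hf hθ
      (dil_mem_surface (k := k) (s := s) hys (σ * Complex.I))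
      (by rw [harg, sub_sub_cancel_left, abs_neg]; exact hθk) (by rw [harg]; simpa using hφ.1)
    simpa only [← dil_add] using h3

/-- The nearest point of the interval spanned by c and c' is no farther than ω from either end. -/
theorem exists_mem_Icc_abs_sub_le (c c' ω : ℝ) :
    ∃ ω' ∈ Icc (min c c') (max c c'), |ω' - c| ≤ |ω - c| ∧ |ω' - c'| ≤ |ω - c'| := by
  wlog h : c ≤ c' generalizing c c'
  · obtain ⟨ω', h1, h2, h3⟩ := this c' c (le_of_not_ge h)
    exact ⟨ω', by rwa [min_comm, max_comm], h3, h2⟩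
  rw [min_eq_left h, max_eq_right h]
  rcases le_total ω c with h1 | h1
  · refine ⟨c, ⟨le_rfl, h⟩, by simp, ?_⟩
    rw [abs_of_nonpos (by linarith), abs_of_nonpos (by linarith)]
    linarith
  rcases le_total c' ω with h2 | h2
  · refine ⟨c', ⟨h, le_rfl⟩, ?_, by simp⟩
    rw [abs_of_nonneg (by linarith), abs_of_nonneg (by linarith)]
    linarith
  · exact ⟨ω, ⟨h1, h2⟩, le_rfl, le_rfl⟩

/-- A k-sum built from φ serves as intermediary: near the origin, at a suitable argument, both Borel
sums equal it. The domain of that k-sum need not contain y. -/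
theorem IsBorelContinuation.borelSum_eq_borelSum [CompleteSpace E] (hp : 0 < p) (hq : 0 < q)
    (hk : 0 < k) (hs : 0 < s) (hs1 : s < 1) {s' : ℝ} (hs' : 0 < s') (hs1' : s' < 1)
    {a : ℕ × ℕ → E} (ha : IsMonomialGevrey p q (1 / k) a) {d ε ε' θ θ' : ℝ}
    {φ φ' : ℂ × ℂ × ℝ → E} (hφ : IsBorelContinuation p q k s a d ε φ)
    (hφ' : IsBorelContinuation p q k s' a d ε' φ') (hθ : |θ| < Real.pi / 2)
    (hθ' : |θ'| < Real.pi / 2) (hy : y ∈ laplaceDomain p q k s θ φ (d - ε) (d + ε))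
    (hy' : y ∈ laplaceDomain p q k s' θ' φ' (d - ε') (d + ε')) :
    borelSum p q k s θ φ y = borelSum p q k s' θ' φ' y := by
  have hys : y ∈ surface p q := hy.1
  obtain ⟨α, β, r, Θ, f, hf, -⟩ := hφ.exists_isMonomialSum hp hq hk hs hs1 ha
  have hθk : ∀ θ : ℝ, |θ| < Real.pi / 2 →
      d - θ / k ∈ Ioo (d - Real.pi / (2 * k)) (d + Real.pi / (2 * k)) := by
    intro θ hθ
    have : |θ / k| < Real.pi / (2 * k) := by
      rw [abs_div, abs_of_pos hk, ← div_div]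
      gcongr
    rw [abs_lt] at this
    exact ⟨by linarith, by linarith⟩
  -- The target argument must be within π/(2k) of d and stay in both sectors after adding θ/k or
  -- θ'/k. The interval gives the first requirement, the distance estimates the others.
  obtain ⟨ω, hω, hω1, hω2⟩ := exists_mem_Icc_abs_sub_le (d - θ / k) (d - θ' / k) y.2.2
  rw [sub_sub_eq_add_sub, sub_sub_eq_add_sub] at hω1 hω2
  have hωd : |ω - d| < Real.pi / (2 * k) := by
    have h1 := lt_min (hθk θ hθ).1 (hθk θ' hθ').1
    have h2 := max_lt (hθk θ hθ).2 (hθk θ' hθ').2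
    exact abs_lt.2 ⟨by linarith [hω.1], by linarith [hω.2]⟩
  have hyε := abs_arg_sub_lt_of_mem_laplaceDomain hy
  have hyε' := abs_arg_sub_lt_of_mem_laplaceDomain hy'
  have hωε := hω1.trans_lt hyε
  have hωε' := hω2.trans_lt hyε'
  set σ := k * (ω - y.2.2) with hσ
  have hend : y.2.2 + σ / k = ω := by
    rw [hσ]
    field_simp
    ring
  obtain ⟨X₁, hX₁, hX₁'⟩ := hφ.exists_dil_mem_laplaceDomain hp hq hk hs hs1 hs hs1 (σ := σ) hθ hys
    hyε (by rwa [hend])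
  obtain ⟨X₂, -, hX₂'⟩ := hφ'.exists_dil_mem_laplaceDomain hp hq hk hs' hs1' hs hs1 (σ := σ) hθ'
    hys hyε' (by rwa [hend])
  refine eq_of_exists_eq_dil (s := s) (σ := σ) (X₀ := min X₁ X₂)
    (isActOpen_laplaceDomain hk hs hs1 _ _ _ _) (isActOpen_laplaceDomain hk hs' hs1' _ _ _ _)
    (isHolomorphicOn_borelSum hp hq hk hs hs1 hφ.2.1 θ)
    (isHolomorphicOn_borelSum hp hq hk hs' hs1' hφ'.2.1 θ') ((min_le_left _ _).trans hX₁)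
    (fun x hx => ⟨dil_mem_laplaceDomain hp hq hk hs hs1 hs hs1 hy hx,
      dil_mem_laplaceDomain hp hq hk hs' hs1' hs hs1 hy' hx⟩)
    (fun ζ h1 h2 => ⟨hX₁' ζ (h1.trans (min_le_left _ _)) h2,
      hX₂' ζ (h1.trans (min_le_right _ _)) h2⟩) ?_
  have harg : (dil p q k s (σ * Complex.I) y).2.2 = ω := by
    rw [dil_arg hp hq, ← hend]
    simp
  have hsurf := dil_mem_surface (k := k) (s := s) hys (σ * Complex.I)
  obtain ⟨Y₁, hY₁⟩ := hφ.exists_borelSum_eq hp hq hk hs hs1 hs hs1 ha hf hθ hsurf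
    (by rwa [harg]) (by rwa [harg])
  obtain ⟨Y₂, hY₂⟩ := hφ'.exists_borelSum_eq hp hq hk hs' hs1' hs hs1 ha hf hθ' hsurf
    (by rwa [harg]) (by rwa [harg])
  refine ⟨min Y₁ Y₂, fun x hx => ?_⟩
  rw [dil_add, hY₁ x (hx.trans_le (min_le_left _ _)), hY₂ x (hx.trans_le (min_le_right _ _))]

theorem integrableOn_laplaceIntegrand (hp : 0 < p) (hq : 0 < q) (hk : 0 < k) (hs : 0 < s)
    (hs' : s < 1) {φ : ℂ × ℂ × ℝ → E} {α β θ : ℝ} (hφ : IsHolomorphicOn p q φ (sector p q α β))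
    (hy : y ∈ laplaceDomain p q k s θ φ α β) :
    IntegrableOn (laplaceIntegrand p q k s θ φ y) (Ioi 0) := by
  obtain ⟨hy, α', β', C, M, hα, hβ, h1, h2, hC, hM, hexp, h3⟩ := hy
  have h := integrableOn_borel (θ := θ) hp hq hk hs hs' hφ hα.le hβ.le hexp hy h1 h2 h3
  unfold laplaceIntegrand
  simp_rw [dilate_eq_dil hp hq]
  exact h

end MonomialSummability

/-! ### The main theorem. -/

theorem theorem4p1 {E : Type*} [NormedAddCommGroup E] [NormedSpace ℂ E] [CompleteSpace E]
    (p q : ℕ) (hp : 0 < p) (hq : 0 < q) (k : ℝ) (hk : 0 < k) (d : ℝ)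
    (a : ℕ × ℕ → E) (ha : IsMonomialGevrey p q (1 / k) a) :
    -- the three notions of summability in direction `d` are equivalent
    List.TFAE [
      IsMonomialSummable p q k a d,
      ∃ s : ℝ, 0 < s ∧ s < 1 ∧ IsBorelSummable p q k s a d,
      ∀ s : ℝ, 0 < s → s < 1 → IsBorelSummable p q k s a d] ∧
    -- a Borel sum is well defined and coincides with every `k`-sum in the monomial
    (∀ (s ε : ℝ) (φ : ℂ × ℂ × ℝ → E), 0 < s → s < 1 → IsBorelContinuation p q k s a d ε φ →
      (∀ θ : ℝ, |θ| < Real.pi / 2 → ∀ y ∈ laplaceDomain p q k s θ φ (d - ε) (d + ε),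
        MeasureTheory.IntegrableOn (laplaceIntegrand p q k s θ φ y) (Set.Ioi 0)) ∧
      (∀ (α β r : ℝ) (f : ℂ × ℂ × ℝ → E), IsMonomialSum p q k a d α β r f →
        ∀ θ : ℝ, |θ| < Real.pi / 2 → ∀ y ∈ laplaceDomain p q k s θ φ (d - ε) (d + ε),
          y ∈ boundedSector p q α β r → borelSum p q k s θ φ y = f y) ∧
      (∃ (α β r : ℝ) (f : ℂ × ℂ × ℝ → E), IsMonomialSum p q k a d α β r f ∧
        ∀ y ∈ boundedSector p q α β r, ∃ θ : ℝ, |θ| < Real.pi / 2 ∧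
          y ∈ laplaceDomain p q k s θ φ (d - ε) (d + ε) ∧ f y = borelSum p q k s θ φ y)) ∧
    -- the Borel sums for different weights and different directions of integration coincide
    (∀ (s s' ε ε' : ℝ) (φ φ' : ℂ × ℂ × ℝ → E), 0 < s → s < 1 → 0 < s' → s' < 1 →
      IsBorelContinuation p q k s a d ε φ → IsBorelContinuation p q k s' a d ε' φ' →
      ∀ θ θ' : ℝ, |θ| < Real.pi / 2 → |θ'| < Real.pi / 2 →
        ∀ y ∈ laplaceDomain p q k s θ φ (d - ε) (d + ε),
          y ∈ laplaceDomain p q k s' θ' φ' (d - ε') (d + ε') →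
            borelSum p q k s θ φ y = borelSum p q k s' θ' φ' y) := by
  refine ⟨?_, ?_, ?_⟩
  · tfae_have 1 → 3 := by
      rintro ⟨α, β, r, f, hf⟩ s hs hs'
      exact hf.isBorelSummable hp hq hk hs hs' ha
    tfae_have 3 → 2 := fun h => ⟨1 / 2, by norm_num, by norm_num, h _ (by norm_num) (by norm_num)⟩
    tfae_have 2 → 1 := by
      rintro ⟨s, hs, hs', ε, φ, hφ⟩
      obtain ⟨α, β, r, Θ, f, hf, -⟩ := hφ.exists_isMonomialSum hp hq hk hs hs' ha
      exact ⟨α, β, r, f, hf⟩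
    tfae_finish
  · intro s ε φ hs hs' hφ
    refine ⟨fun θ _ y hy => integrableOn_laplaceIntegrand hp hq hk hs hs' hφ.2.1 hy,
      fun α β r f hf θ hθ y hy hy' => hφ.borelSum_eq hp hq hk hs hs' ha hf hθ hy hy', ?_⟩
    obtain ⟨α, β, r, Θ, f, hf, hΘ, hθ⟩ := hφ.exists_isMonomialSum hp hq hk hs hs' ha
    refine ⟨α, β, r, f, hf, fun y hy => ?_⟩
    obtain ⟨θ, h1, -, h2, h3⟩ := hθ y hy
    exact ⟨θ, h1.trans_lt hΘ, h2, h3⟩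
  · intro s s' ε ε' φ φ' hs hs1 hs' hs1' hφ hφ' θ θ' hθ hθ' y hy hy'
    exact hφ.borelSum_eq_borelSum hp hq hk hs hs1 hs' hs1' ha hφ' hθ hθ' hy hy'
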